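/- Setting. Let $d_x,d_y\ge 1$, $d=d_x+d_y$; let $\mathcal X\subset\mathbb R^{d_x}$, $\mathcal Y\subset\mathbb R^{d_y}$ be convex and compact, and assume that $\mathcal Z=\mathcal X\times\mathcal Y\subset\mathbb R^d$ has at least two points. Let $p\in[1,2]$, $1/p+1/q=1$. Let $\omega:\mathcal Z\to\mathbb R$ be a differentiable prox-function compatible with $\|\cdot\|_p$: its Bregman divergence $V_z(v)=\omega(v)-\omega(z)-\langle\nabla\omega(z),v-z\rangle$ satisfies $V_z(v)\ge\frac12\|z-v\|_p^2$ for $z,v\in\mathcal Z$. Let $\mathcal D=\sup_{z,v\in\mathcal Z}\sqrt{2V_z(v)}$ be finite. Let $\mathrm{Prox}_z(s)=\arg\min_{v\in\mathcal Z}\left(V_z(v)+\langle s,v\rangle\right)$. Fix $\tau>0$ and let $\mathcal Z_\tau$ be the set of points of $\mathbb R^d$ at Euclidean distance at most $\tau$ from $\mathcal Z$. Let $\xi$ be a random element, and let $f(z,\xi)$, $z\in\mathcal Z_\tau$, be integrable in $\xi$, with $|f(z_1,\xi)-f(z_2,\xi)|\le M_2(\xi)\|z_1-z_2\|_2$ for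 all $z_1,z_2\in\mathcal Z_\tau$ and all $\xi$, where $\mathbb E[M_2(\xi)^2]\le M_2^2$ for a constant $M_2>0$. Suppose that $f(x,y)=\mathbb E_\xi f(x,y,\xi)$ is convex in $x$ and concave in $y$ on $\mathcal Z_\tau$, and let $(x_*,y_*)\in\mathcal X\times\mathcal Y$ be a saddle point of $f$ on $\mathcal X\times\mathcal Y$. The oracle returns $\varphi(z,\xi)=f(z,\xi)+\delta(z)$, $z\in\mathcal Z_\tau$, where $\delta$ is a deterministic (measurable) noise. Zeroth-order stochastic mirror descent. Put $z^1=\arg\min_{z\in\mathcal Z}\omega(z)$. For $k=1,\dots,N$ ($N\ge1$) sample $e^k=(e^k_x,e^k_y)$ uniformly from the unit Euclidean sphere of $\mathbb R^d$ and $\xi^k$ distributed as $\xi$, all independent, and put $$g^k=\frac{d}{2\tau}\bigl(\varphi(z^k+\tau e^k,\xi^k)-\varphi(z^k-\tau e^k,\xi^k)\bigr)\begin{pmatrix}e^k_x\\-e^k_y\end{pmatrix},\qquad z^{k+1}=\mathrm{Prox}_{z^k}(\gamma_k g^k).$$ The output is $\hat z^N=(\hat x^N,\hat y^N)=\bigl(\sum_{k=1}^N\gamma_k\bigr)^{-1}\sum_{k=1}^N\gamma_kz^k$.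 Let $a_q$ be any number with $\sqrt{\mathbb E\|e\|_q^4}\le a_q^2$, where $e$ is uniform on the unit Euclidean sphere of $\mathbb R^d$. Theorem. There is a universal numerical constant $c>0$ such that, in every such setting, the following holds. 1. If $|\delta(z)|\le\Delta$ for all $z\in\mathcal Z_\tau$, $M_{\rm case1}^2=c\left(d\,a_q^2M_2^2+d^2a_q^2\Delta^2\tau^{-2}\right)$ and $\gamma_k=\frac{\mathcal D}{M_{\rm case1}}\sqrt{2/N}$ for all $k$, then $$\mathbb E\left[f(\hat x^N,y_*)-f(x_*,\hat y^N)\right]\le M_{\rm case1}\mathcal D\sqrt{2/N}+\sqrt d\,\Delta\,\mathcal D\,\tau^{-1}+2\tau M_2.$$ 2. If $|\delta(z_1)-\delta(z_2)|\le M_{2,\delta}\|z_1-z_2\|_2$ for all $z_1,z_2\in\mathcal Z_\tau$, $M_{\rm case2}^2=c\,d\,a_q^2\left(M_2^2+M_{2,\delta}^2\right)$ and $\gamma_k=\frac{\mathcal D}{M_{\rm case2}}\sqrt{2/N}$ for all $k$, then $$\mathbb E\left[f(\hat x^N,y_*)-f(x_*,\hat y^N)\right]\le M_{\rm case2}\mathcal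 D\sqrt{2/N}+M_{2,\delta}\sqrt d\,\mathcal D+2\tau M_2.$$ In both cases the expectation exists. Moreover, $\sqrt{\mathbb E\|e\|_q^4}\le C\min\{q,\log d\}\,d^{2/q-1}$ for all $d\ge2$ and $q\in[2,\infty]$, with a universal constant $C$. -/

import Mathlib

open MeasureTheory ProbabilityTheory Set
open scoped ENNReal

noncomputable section

namespace ZOSMD

/-- The space `ℝ^{dx} × ℝ^{dy} = ℝ^d`, `d = dx + dy`, with its Euclidean structure. -/
abbrev Vec (dx dy : ℕ) : Type := EuclideanSpace ℝ (Fin dx ⊕ Fin dy)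

/-- The vector `z = (x, y)`. -/
def pair {dx dy : ℕ} (x : EuclideanSpace ℝ (Fin dx)) (y : EuclideanSpace ℝ (Fin dy)) :
    Vec dx dy :=
  WithLp.toLp 2 (Sum.elim (fun i => x i) (fun j => y j))

/-- The `x`-block of `z = (x, y)`. -/
def xPart {dx dy : ℕ} (z : Vec dx dy) : EuclideanSpace ℝ (Fin dx) :=
  WithLp.toLp 2 (fun i => z (Sum.inl i))

/-- The `y`-block of `z = (x, y)`. -/
def yPart {dx dy : ℕ} (z : Vec dx dy) : EuclideanSpace ℝ (Fin dy) :=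
  WithLp.toLp 2 (fun j => z (Sum.inr j))

/-- The vector `(e_x, -e_y)` built from `e = (e_x, e_y)`. -/
def flipY {dx dy : ℕ} (e : Vec dx dy) : Vec dx dy :=
  pair (xPart e) (-yPart e)

/-- The set `X × Y` as a subset of `ℝ^d`. -/
def prodSet {dx dy : ℕ} (X : Set (EuclideanSpace ℝ (Fin dx)))
    (Y : Set (EuclideanSpace ℝ (Fin dy))) : Set (Vec dx dy) :=
  {z | xPart z ∈ X ∧ yPart z ∈ Y}

/-- The `ℓ_p`-norm of a vector, `1 ≤ p ≤ ∞`. -/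
def ellNorm {ι : Type*} [Fintype ι] (p : ℝ≥0∞) (z : EuclideanSpace ℝ ι) : ℝ :=
  ‖(WithLp.toLp p (WithLp.ofLp z) : PiLp p (fun _ : ι => ℝ))‖

/-- The unit Euclidean sphere of `ℝ^d`. -/
abbrev USphere (dx dy : ℕ) : Type := Metric.sphere (0 : Vec dx dy) 1

/-- The uniform distribution on the unit Euclidean sphere: the surface measure, normalized. -/
def sphereUniform (dx dy : ℕ) : Measure (USphere dx dy) :=
  ((volume : Measure (Vec dx dy)).toSphere univ)⁻¹ • (volume : Measure (Vec dx dy)).toSphere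

/-- `√(E ‖e‖_q^4)` for `e` uniform on the unit Euclidean sphere of `ℝ^{dx+dy}`. -/
def sphereMoment (dx dy : ℕ) (q : ℝ≥0∞) : ℝ :=
  Real.sqrt (∫ e, ellNorm q (e : Vec dx dy) ^ 4 ∂(sphereUniform dx dy))

/-- The Bregman divergence `V_z(v) = ω(v) - ω(z) - ⟨∇ω(z), v - z⟩` of `ω` on `Z`. The derivative
is taken within `Z`, so `ω` is needed on `Z` only; for `v`, `z` in a convex set `Z` the value
`⟨∇ω(z), v - z⟩` does not depend on the choice of a derivative within `Z`. -/
def bregman {dx dy : ℕ} (Z : Set (Vec dx dy)) (ω : Vec dx dy → ℝ) (z v : Vec dx dy) : ℝ :=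
  ω v - ω z - fderivWithin ℝ ω Z z (v - z)

/-- `ω` is a prox-function on `Z` compatible with the `ℓ_p`-norm: it is differentiable on `Z` and
its Bregman divergence is at least half of the squared `ℓ_p`-distance. -/
structure IsProxFunction {dx dy : ℕ} (p : ℝ≥0∞) (Z : Set (Vec dx dy)) (ω : Vec dx dy → ℝ) :
    Prop where
  differentiableOn : DifferentiableOn ℝ ω Z
  half_sq_le : ∀ z ∈ Z, ∀ v ∈ Z, ellNorm p (z - v) ^ 2 / 2 ≤ bregman Z ω z v

/-- `D` is the `ω`-diameter of `Z`, the (finite) supremum of `√(2 V_z(v))` over `z, v ∈ Z`. -/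
def IsOmegaDiameter {dx dy : ℕ} (Z : Set (Vec dx dy)) (ω : Vec dx dy → ℝ) (D : ℝ) : Prop :=
  IsLUB {r : ℝ | ∃ z ∈ Z, ∃ v ∈ Z, r = Real.sqrt (2 * bregman Z ω z v)} D

/-- `v` is a value of the prox-operator, `v ∈ argmin_{v ∈ Z} (V_z(v) + ⟨s, v⟩)`. -/
def IsProx {dx dy : ℕ} (Z : Set (Vec dx dy)) (ω : Vec dx dy → ℝ) (z s v : Vec dx dy) : Prop :=
  v ∈ Z ∧ IsMinOn (fun w => bregman Z ω z w + inner ℝ s w) Z v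

/-- The two-point gradient estimator
`(d / 2τ) (φ(z + τ e, ξ) - φ(z - τ e, ξ)) (e_x, -e_y)`. -/
def gradEst {dx dy : ℕ} {Ξ : Type*} (φ : Vec dx dy → Ξ → ℝ) (τ : ℝ)
    (z : Vec dx dy) (ξ : Ξ) (e : Vec dx dy) : Vec dx dy :=
  ((((dx + dy : ℕ) : ℝ) / (2 * τ)) * (φ (z + τ • e) ξ - φ (z - τ • e) ξ)) • flipY e

/-- `z` is a trajectory of zeroth-order stochastic mirror descent with step sizes `γ`, for the
directions `e` and the samples `ξ`. Indices are shifted by one: `z 0, …, z (N - 1)` are the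
first, …, `N`-th iterates. -/
structure IsRun {dx dy : ℕ} {Ξ : Type*} (Z : Set (Vec dx dy)) (ω : Vec dx dy → ℝ)
    (φ : Vec dx dy → Ξ → ℝ) (τ : ℝ) (γ : ℕ → ℝ) (N : ℕ)
    (e : ℕ → USphere dx dy) (ξ : ℕ → Ξ) (z : ℕ → Vec dx dy) : Prop where
  init_mem : z 0 ∈ Z
  init_min : IsMinOn ω Z (z 0)
  step : ∀ k < N, IsProx Z ω (z k) (γ k • gradEst φ τ (z k) (ξ k) (e k)) (z (k + 1))

/-- The output of the method, the weighted average of the first `N` iterates. -/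
def output {dx dy : ℕ} (γ : ℕ → ℝ) (N : ℕ) (z : ℕ → Vec dx dy) : Vec dx dy :=
  (∑ k ∈ Finset.range N, γ k)⁻¹ • ∑ k ∈ Finset.range N, γ k • z k

/-- The objective `F(z) = E f(z, ξ)`. -/
def objective {dx dy : ℕ} {Ξ : Type*} [MeasurableSpace Ξ] (Pξ : Measure Ξ)
    (f : Vec dx dy → Ξ → ℝ) (z : Vec dx dy) : ℝ :=
  ∫ ξ, f z ξ ∂Pξ

/-- `F` is convex in `x` and concave in `y` on the convex set `U`. -/
def ConvexConcaveOn {dx dy : ℕ} (U : Set (Vec dx dy)) (F : Vec dx dy → ℝ) : Prop :=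
  (∀ y, ConvexOn ℝ {x | pair x y ∈ U} (fun x => F (pair x y))) ∧
  (∀ x, ConcaveOn ℝ {y | pair x y ∈ U} (fun y => F (pair x y)))

/-- The stochastic function `f(·, ξ)` is measurable and integrable in `ξ`, and Lipschitz on `U`
for the Euclidean norm, with a random constant whose second moment is at most `M₂²`. -/
structure IsLipschitzOracle {dx dy : ℕ} {Ξ : Type*} [MeasurableSpace Ξ] (Pξ : Measure Ξ)
    (U : Set (Vec dx dy)) (f : Vec dx dy → Ξ → ℝ) (M₂ : ℝ) : Prop where
  measurable : ∀ z ∈ U, Measurable (f z)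
  integrable : ∀ z ∈ U, Integrable (f z) Pξ
  lipschitz : ∃ L : Ξ → ℝ, MemLp L 2 Pξ ∧ ∫ ξ, L ξ ^ 2 ∂Pξ ≤ M₂ ^ 2 ∧
    ∀ ξ, ∀ z ∈ U, ∀ w ∈ U, |f z ξ - f w ξ| ≤ L ξ * ‖z - w‖

/-- The directions `e k` are uniform on the sphere, the samples `ξ k` have law `Pξ`, and all of
them are independent. -/
structure IsSampling {dx dy : ℕ} {Ω Ξ : Type*} [MeasurableSpace Ω] [MeasurableSpace Ξ]
    (P : Measure Ω) (Pξ : Measure Ξ) (e : ℕ → Ω → USphere dx dy) (ξ : ℕ → Ω → Ξ) : Prop where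
  measurable_e : ∀ k, Measurable (e k)
  measurable_ξ : ∀ k, Measurable (ξ k)
  law_e : ∀ k, P.map (e k) = sphereUniform dx dy
  law_ξ : ∀ k, P.map (ξ k) = Pξ
  indep_pair : ∀ k, IndepFun (e k) (ξ k) P
  indep : iIndepFun (fun k θ => (e k θ, ξ k θ)) P

end ZOSMD

end

open ZOSMD

open ZOSMD

/-! Mirror descent has average regret of order `M * D / √N` once the `ℓ_q`-norm of the stochastic
gradient has second moment at most `M ^ 2`. So everything rests on two facts about the two-point
estimator at a fixed point `z`: its mean nearly dominates the saddle gap, and its second moment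
grows like `d * a ^ 2`, not `d ^ 2 * a ^ 2`.

Mean. Put `G = F (z + ·)`. By the divergence theorem, `d / τ` times the spherical mean of `G (τ e)
⟨e, v⟩` is the average over the `τ`-ball of the derivative of `G` along `v`
(`integral_unifSphere_mul_inner`). Along the direction that carries the `x`-block of `z` to that of
a competitor, `G` is convex, so the derivative is at most the full increment; along the `y`-block it
is concave and the inequality reverses. Comparing increments at shifted points with those at the
origin costs `2 * τ * M₂` (`sub_le_integral_unifSphere_mul_inner`, `gap_le_integral_two_point`). No
smoothness is needed. Noise whose two-point difference is at most `κ` shifts the mean by at most `d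
κ / (2 τ)` times the mean of `|⟨e, v⟩|`, and that mean is at most `‖v‖ / √d`
(`gap_le_integral_inner_stepGrad`).

Second moment. As a function of `e`, the two-point difference of an `L`-Lipschitz function is odd
and `2 τ L`-Lipschitz on the sphere, so its fourth moment is of order `(τ L) ^ 4 / d ^ 2`
(`lintegral_pow_four_unifSphere_le`). Cauchy–Schwarz against `‖e‖_q ^ 4` then saves one factor `d`
(`lintegral_two_point_sq_le`). The concentration estimate is the Maurey–Pisier argument: the
function is extended with homogeneity one to an odd Lipschitz `H`; for independent Gaussian `X`,
`Y`, the value `2 H(X)` is minus the integral of `∇H(X_t) · Y_t` over a half-turn, and each rotated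
pair has the law of `(X, Y)`. Homogeneous functions pass between the Gaussian law and the sphere by
a moment of the norm, which also yields the order of `a_q ^ 2` (`sphereMoment_le`).

Assembly. Prox-minimizers have quadratic growth, so each iterate is a measurable function of the
past samples (`measurable_iterate`) and is independent of the next one; the sample can be integrated
out with the iterate frozen. With the regret bound and Jensen's inequality this gives
`integral_saddleGap_output_le`, in which a noise model enters only through its bias parameter `κ`
and second-moment parameter `σ`. -/

namespace ZOSMD

open Filter Topology Module
open scoped NNReal

/-! ### Polar coordinates -/

section Polar

variable {E : Type*} [NormedAddCommGroup E] [InnerProductSpace ℝ E] [FiniteDimensional ℝ E]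
  [MeasurableSpace E] [BorelSpace E]

/-- Integration in polar coordinates, for nonnegative functions. -/
lemma lintegral_polar [Nontrivial E] (μ : Measure E) [μ.IsAddHaarMeasure] {f : E → ℝ≥0∞}
    (hf : Measurable f) :
    ∫⁻ x, f x ∂μ = ∫⁻ r in Ioi (0 : ℝ), ENNReal.ofReal (r ^ (finrank ℝ E - 1)) *
      ∫⁻ e : Metric.sphere (0 : E) 1, f (r • (e : E)) ∂μ.toSphere := by
  calc ∫⁻ x, f x ∂μ = ∫⁻ x : ({(0)}ᶜ : Set E), f x ∂(μ.comap (↑)) := by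
        rw [lintegral_subtype_comap (measurableSet_singleton _).compl, restrict_compl_singleton]
    _ = ∫⁻ x : Metric.sphere (0 : E) 1 × Ioi (0 : ℝ), f ((x.2 : ℝ) • (x.1 : E))
          ∂μ.toSphere.prod (.volumeIoiPow (finrank ℝ E - 1)) := by
        have h := μ.measurePreserving_homeomorphUnitSphereProd.lintegral_comp_emb
          (Homeomorph.measurableEmbedding _)
          (fun x : Metric.sphere (0 : E) 1 × Ioi (0 : ℝ) => f ((x.2 : ℝ) • (x.1 : E)))
        rw [← h]
        refine lintegral_congr fun x => ?_
        congr 1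
        have hx : ‖(x : E)‖ ≠ 0 := norm_ne_zero_iff.2 x.2
        simp [smul_smul, hx]
    _ = ∫⁻ r : Ioi (0 : ℝ), ∫⁻ e : Metric.sphere (0 : E) 1, f ((r : ℝ) • (e : E)) ∂μ.toSphere
          ∂(.volumeIoiPow (finrank ℝ E - 1)) := by
        rw [lintegral_prod_symm']
        exact hf.comp (by fun_prop)
    _ = _ := by
        simp only [Measure.volumeIoiPow]
        have hm : Measurable fun r : ℝ =>
            ∫⁻ e : Metric.sphere (0 : E) 1, f (r • (e : E)) ∂μ.toSphere := by
          refine Measurable.lintegral_prod_right' (ν := μ.toSphere)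
            (f := fun x : ℝ × Metric.sphere (0 : E) 1 => f (x.1 • (x.2 : E))) ?_
          exact hf.comp (by fun_prop)
        have hm' : Measurable fun r : Ioi (0 : ℝ) =>
            ∫⁻ e : Metric.sphere (0 : E) 1, f ((r : ℝ) • (e : E)) ∂μ.toSphere :=
          hm.comp measurable_subtype_coe
        rw [lintegral_withDensity_eq_lintegral_mul _ (by fun_prop) hm']
        exact lintegral_subtype_comap measurableSet_Ioi
          (fun r : ℝ => ENNReal.ofReal (r ^ (finrank ℝ E - 1)) *
            ∫⁻ e : Metric.sphere (0 : E) 1, f (r • (e : E)) ∂μ.toSphere)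

/-- Integration in polar coordinates, for integrable functions. -/
lemma integral_polar [Nontrivial E] (μ : Measure E) [μ.IsAddHaarMeasure] {f : E → ℝ}
    (hf : Integrable f μ) :
    ∫ x, f x ∂μ = ∫ r in Ioi (0 : ℝ), r ^ (finrank ℝ E - 1) *
      ∫ e : Metric.sphere (0 : E) 1, f (r • (e : E)) ∂μ.toSphere := by
  have hemb := Homeomorph.measurableEmbedding (homeomorphUnitSphereProd E)
  have key : ∀ x : ({(0)}ᶜ : Set E),
      (fun x : Metric.sphere (0 : E) 1 × Ioi (0 : ℝ) => f ((x.2 : ℝ) • (x.1 : E)))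
        (homeomorphUnitSphereProd E x) = f x := by
    intro x
    have hx : ‖(x : E)‖ ≠ 0 := norm_ne_zero_iff.2 x.2
    simp [smul_smul, hx]
  have hint : Integrable (fun x : Metric.sphere (0 : E) 1 × Ioi (0 : ℝ) => f ((x.2 : ℝ) • (x.1 : E)))
      (μ.toSphere.prod (.volumeIoiPow (finrank ℝ E - 1))) := by
    rw [← μ.measurePreserving_homeomorphUnitSphereProd.integrable_comp_emb hemb]
    have : Integrable (fun x : ({(0)}ᶜ : Set E) => f x) (μ.comap (↑)) := by
      have := (MeasurableEmbedding.subtype_coe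
        (measurableSet_singleton (0 : E)).compl).integrable_map_iff (g := f) (μ := μ.comap (↑))
      rw [(MeasurableEmbedding.subtype_coe
        (measurableSet_singleton (0 : E)).compl).map_comap] at this
      exact this.1 hf.restrict
    exact this.congr (ae_of_all _ fun x => (key x).symm)
  calc ∫ x, f x ∂μ = ∫ x : ({(0)}ᶜ : Set E), f x ∂(μ.comap (↑)) := by
        rw [integral_subtype_comap (measurableSet_singleton _).compl, restrict_compl_singleton]
    _ = ∫ x : Metric.sphere (0 : E) 1 × Ioi (0 : ℝ), f ((x.2 : ℝ) • (x.1 : E))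
          ∂μ.toSphere.prod (.volumeIoiPow (finrank ℝ E - 1)) := by
        rw [← μ.measurePreserving_homeomorphUnitSphereProd.integral_comp hemb]
        exact integral_congr_ae (ae_of_all _ fun x => (key x).symm)
    _ = ∫ r : Ioi (0 : ℝ), ∫ e : Metric.sphere (0 : E) 1, f ((r : ℝ) • (e : E)) ∂μ.toSphere
          ∂(.volumeIoiPow (finrank ℝ E - 1)) := integral_prod_symm _ hint
    _ = _ := by
        simp only [Measure.volumeIoiPow, ENNReal.ofReal]
        rw [integral_withDensity_eq_integral_smul,
          integral_subtype_comap measurableSet_Ioi fun r : ℝ =>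
            Real.toNNReal (r ^ (finrank ℝ E - 1)) •
              ∫ e : Metric.sphere (0 : E) 1, f (r • (e : E)) ∂μ.toSphere,
          setIntegral_congr_fun measurableSet_Ioi fun x hx ↦ ?_]
        · rw [NNReal.smul_def, Real.coe_toNNReal _ (pow_nonneg hx.out.le _), smul_eq_mul]
        · exact (measurable_subtype_coe.pow_const _).real_toNNReal

end Polar

/-! ### Gaussian density and homogeneous functions -/

section Gaussian

variable {E : Type*} [NormedAddCommGroup E] [InnerProductSpace ℝ E] [FiniteDimensional ℝ E]
  [MeasurableSpace E] [BorelSpace E]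

/-- The density of the standard Gaussian measure. -/
lemma stdGaussian_eq_withDensity :
    stdGaussian E = (volume : Measure E).withDensity (fun x => ENNReal.ofReal
      ((2 * Real.pi) ^ (-(finrank ℝ E / 2 : ℝ)) * Real.exp (-(1 / 2) * ‖x‖ ^ 2))) := by
  set c : ℝ := (2 * Real.pi) ^ (-(finrank ℝ E / 2 : ℝ)) with hc
  have hc0 : 0 < c := by positivity
  have hint : Integrable (fun x : E => c * Real.exp (-(1 / 2) * ‖x‖ ^ 2)) := by
    have : ∫ x : E, Real.exp (-(1 / 2) * ‖x‖ ^ 2) ≠ 0 := by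
      rw [GaussianFourier.integral_rexp_neg_mul_sq_norm (by norm_num)]; positivity
    exact (Integrable.of_integral_ne_zero this).const_mul c
  have hfin : IsFiniteMeasure ((volume : Measure E).withDensity (fun x => ENNReal.ofReal
      (c * Real.exp (-(1 / 2) * ‖x‖ ^ 2)))) := isFiniteMeasure_withDensity_ofReal hint.2
  -- Both measures are finite, so it suffices to match characteristic functions; that of the density
  -- is a closed-form Gaussian integral.
  refine Measure.ext_of_charFun ?_
  funext t
  rw [charFun_stdGaussian, charFun_apply]
  have hm : Measurable fun x : E => c * Real.exp (-(1 / 2) * ‖x‖ ^ 2) := by fun_prop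
  rw [integral_withDensity_eq_integral_toReal_smul (by fun_prop) (by simp)]
  have h1 : ∀ x : E, (ENNReal.ofReal (c * Real.exp (-(1 / 2) * ‖x‖ ^ 2))).toReal •
      Complex.exp (inner ℝ x t * Complex.I) =
      (c : ℂ) * Complex.exp (-(1 / 2 : ℂ) * ‖x‖ ^ 2 + Complex.I * inner ℝ t x) := by
    intro x
    rw [ENNReal.toReal_ofReal (by positivity), Complex.exp_add, Complex.real_smul,
      real_inner_comm]
    push_cast
    ring_nf
  simp_rw [h1]
  rw [integral_const_mul, GaussianFourier.integral_cexp_neg_mul_sq_norm_add (by norm_num)]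
  have h2 : (c : ℂ) * ((Real.pi : ℂ) / (1 / 2)) ^ ((finrank ℝ E : ℂ) / 2) = 1 := by
    have : ((Real.pi : ℂ) / (1 / 2)) ^ ((finrank ℝ E : ℂ) / 2) =
        (((2 * Real.pi) ^ (finrank ℝ E / 2 : ℝ) : ℝ) : ℂ) := by
      rw [Complex.ofReal_cpow (by positivity)]
      push_cast
      congr 1
      ring
    rw [this, ← Complex.ofReal_mul, hc, Real.rpow_neg (by positivity),
      inv_mul_cancel₀ (by positivity)]
    simp
  rw [← mul_assoc, h2, one_mul]
  congr 1
  rw [Complex.I_sq]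
  ring

/-- Carries Rademacher's theorem from Lebesgue-almost every to Gaussian-almost every point. -/
lemma stdGaussian_absolutelyContinuous : stdGaussian E ≪ (volume : Measure E) := by
  rw [stdGaussian_eq_withDensity]
  exact withDensity_absolutelyContinuous _ _

/-- The uniform distribution on the unit sphere. -/
noncomputable def unifSphere (E : Type*) [NormedAddCommGroup E] [InnerProductSpace ℝ E]
    [FiniteDimensional ℝ E] [MeasurableSpace E] [BorelSpace E] :
    Measure (Metric.sphere (0 : E) 1) :=
  ((volume : Measure E).toSphere univ)⁻¹ • (volume : Measure E).toSphere

instance [Nontrivial E] : IsProbabilityMeasure (unifSphere E) := by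
  refine ⟨?_⟩
  rw [unifSphere, Measure.smul_apply, smul_eq_mul]
  exact ENNReal.inv_mul_cancel (Measure.measure_univ_ne_zero.2 (Measure.toSphere_ne_zero _))
    (measure_ne_top _ _)

/-- The norm and the direction of a Gaussian vector are independent: a nonnegative function that
is homogeneous of degree `n` integrates to the product of the `n`-th moment of the norm with its
mean over the sphere. -/
lemma lintegral_stdGaussian_of_homogeneous [Nontrivial E] {H : E → ℝ≥0∞} (hH : Measurable H)
    (n : ℕ) (hom : ∀ r : ℝ, 0 < r → ∀ x, H (r • x) = ENNReal.ofReal (r ^ n) * H x) :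
    ∫⁻ x, H x ∂(stdGaussian E) =
      (∫⁻ x, ENNReal.ofReal (‖x‖ ^ n) ∂(stdGaussian E)) * ∫⁻ e, H (e : E) ∂(unifSphere E) := by
  set ρ : ℝ → ℝ≥0∞ := fun r => ENNReal.ofReal
      ((2 * Real.pi) ^ (-(finrank ℝ E / 2 : ℝ)) * Real.exp (-(1 / 2) * r ^ 2)) with hρ
  have hρm : Measurable ρ := by fun_prop
  -- The radial factor depends on `n` only. Applying this to `H` and to `‖x‖ ^ n`, whose spherical
  -- integral is the total mass, eliminates it.
  have gen : ∀ K : E → ℝ≥0∞, Measurable K →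
      (∀ r : ℝ, 0 < r → ∀ x, K (r • x) = ENNReal.ofReal (r ^ n) * K x) →
      ∫⁻ x, K x ∂(stdGaussian E) =
        (∫⁻ r in Ioi (0 : ℝ), ENNReal.ofReal (r ^ (finrank ℝ E - 1)) *
          (ρ r * ENNReal.ofReal (r ^ n))) *
        ∫⁻ e : Metric.sphere (0 : E) 1, K e ∂(volume : Measure E).toSphere := by
    intro K hK hKhom
    have : stdGaussian E = (volume : Measure E).withDensity (fun x => ρ ‖x‖) :=
      stdGaussian_eq_withDensity
    have hρm' : Measurable fun x : E => ρ ‖x‖ := hρm.comp measurable_norm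
    rw [this, lintegral_withDensity_eq_lintegral_mul _ hρm' hK,
      lintegral_polar _ (hρm'.mul hK), ← lintegral_mul_const _ (by fun_prop)]
    refine setLIntegral_congr_fun measurableSet_Ioi fun r hr => ?_
    have hr : 0 < r := hr
    simp only [Pi.mul_apply]
    rw [mul_assoc]
    congr 1
    have hK' : Measurable fun e : Metric.sphere (0 : E) 1 => K (e : E) :=
      hK.comp measurable_subtype_coe
    rw [← lintegral_const_mul _ hK']
    refine lintegral_congr fun e => ?_
    rw [hKhom r hr, norm_smul, norm_eq_of_mem_sphere e, mul_one, Real.norm_of_nonneg hr.le, mul_assoc]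
  have h1 := gen H hH hom
  have h2 := gen (fun x => ENNReal.ofReal (‖x‖ ^ n)) (by fun_prop) (fun r hr x => by
    rw [norm_smul, Real.norm_of_nonneg hr.le, mul_pow, ENNReal.ofReal_mul (by positivity)])
  have h3 : ∫⁻ e : Metric.sphere (0 : E) 1, ENNReal.ofReal (‖(e : E)‖ ^ n)
      ∂(volume : Measure E).toSphere = (volume : Measure E).toSphere univ := by
    simp
  rw [h1, h2, h3, unifSphere, lintegral_smul_measure, smul_eq_mul, mul_assoc, ← mul_assoc
    ((volume : Measure E).toSphere univ), ENNReal.mul_inv_cancel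
    (Measure.measure_univ_ne_zero.2 (Measure.toSphere_ne_zero _)) (measure_ne_top _ _), one_mul]

end Gaussian

/-! ### Moments of Gaussian vectors -/

section Moments

/-- Jensen's inequality for powers of nonnegative functions. -/
lemma lintegral_pow_le {α : Type*} [MeasurableSpace α] (μ : Measure α) {f : α → ℝ≥0∞}
    (hf : AEMeasurable f μ) (n : ℕ) :
    (∫⁻ a, f a ∂μ) ^ (n + 1) ≤ μ univ ^ n * ∫⁻ a, f a ^ (n + 1) ∂μ := by
  rcases Nat.eq_zero_or_pos n with rfl | hn
  · simp
  have hn' : (0 : ℝ) < n := by exact_mod_cast hn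
  have hpq : ((n : ℝ) + 1).HolderConjugate (((n : ℝ) + 1) / n) := by
    rw [Real.holderConjugate_iff]
    refine ⟨by linarith, ?_⟩
    field_simp
    ring
  have h := ENNReal.lintegral_mul_le_Lp_mul_Lq μ hpq hf (g := fun _ => 1) aemeasurable_const
  simp only [Pi.mul_apply, mul_one, ENNReal.one_rpow, lintegral_const, one_mul] at h
  calc (∫⁻ a, f a ∂μ) ^ (n + 1)
      ≤ ((∫⁻ a, f a ^ ((n : ℝ) + 1) ∂μ) ^ (1 / ((n : ℝ) + 1)) *
          μ univ ^ (1 / (((n : ℝ) + 1) / n))) ^ (n + 1) := by gcongr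
    _ = μ univ ^ n * ∫⁻ a, f a ^ (n + 1) ∂μ := by
        rw [mul_pow, mul_comm, ← ENNReal.rpow_natCast, ← ENNReal.rpow_natCast (_ ^ (1 / ((n : ℝ) + 1))),
          ← ENNReal.rpow_mul, ← ENNReal.rpow_mul]
        have e1 : 1 / (((n : ℝ) + 1) / n) * ((n + 1 : ℕ) : ℝ) = n := by
          push_cast; field_simp
        have e2 : 1 / ((n : ℝ) + 1) * ((n + 1 : ℕ) : ℝ) = 1 := by
          push_cast; field_simp
        rw [e1, e2, ENNReal.rpow_one, ENNReal.rpow_natCast]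
        congr 1
        refine lintegral_congr fun a => ?_
        rw [← ENNReal.rpow_natCast]
        push_cast
        rfl

/-- The exponent `x ^ 2 / 4` stays below the critical `x ^ 2 / 2`, so a single finite integral
dominates all even moments at once. -/
lemma lintegral_exp_sq_gaussianReal :
    ∫⁻ x, ENNReal.ofReal (Real.exp (x ^ 2 / 4)) ∂(gaussianReal 0 1) = ENNReal.ofReal √2 := by
  rw [gaussianReal_of_var_ne_zero _ one_ne_zero,
    lintegral_withDensity_eq_lintegral_mul _ (by fun_prop) (by fun_prop)]
  have h : ∀ x : ℝ, (gaussianPDF 0 1 * fun x => ENNReal.ofReal (Real.exp (x ^ 2 / 4))) x =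
      ENNReal.ofReal ((√(2 * Real.pi))⁻¹ * Real.exp (-(1 / 4) * x ^ 2)) := by
    intro x
    rw [Pi.mul_apply, gaussianPDF, ← ENNReal.ofReal_mul (gaussianPDFReal_nonneg _ _ _),
      gaussianPDFReal, mul_assoc, ← Real.exp_add]
    congr 2
    · simp
    · congr 1
      simp
      ring
  simp_rw [h]
  rw [← ofReal_integral_eq_lintegral_ofReal
    ((integrable_exp_neg_mul_sq (by norm_num)).const_mul _) (ae_of_all _ fun x => by positivity),
    integral_const_mul, integral_gaussian]
  congr 1
  rw [← Real.sqrt_inv, ← Real.sqrt_mul (by positivity)]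
  congr 1
  field_simp
  norm_num

/-- Even moments of the standard normal law. -/
lemma lintegral_pow_gaussianReal_le (m : ℕ) :
    ∫⁻ x, ENNReal.ofReal (x ^ (2 * m)) ∂(gaussianReal 0 1) ≤
      ENNReal.ofReal (m.factorial * 4 ^ m * √2) := by
  -- One term of the exponential series: `t ^ m / m! ≤ exp t` at `t = x ^ 2 / 4`.
  have hle : ∀ x : ℝ, x ^ (2 * m) ≤ m.factorial * 4 ^ m * Real.exp (x ^ 2 / 4) := by
    intro x
    have h := Real.pow_div_factorial_le_exp (x ^ 2 / 4) (by positivity) m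
    rw [div_le_iff₀ (by positivity), div_pow, div_le_iff₀ (by positivity), ← pow_mul] at h
    linarith
  calc ∫⁻ x, ENNReal.ofReal (x ^ (2 * m)) ∂(gaussianReal 0 1)
      ≤ ∫⁻ x, ENNReal.ofReal (m.factorial * 4 ^ m) * ENNReal.ofReal (Real.exp (x ^ 2 / 4))
          ∂(gaussianReal 0 1) := by
        refine lintegral_mono fun x => ?_
        rw [← ENNReal.ofReal_mul (by positivity)]
        exact ENNReal.ofReal_le_ofReal (hle x)
    _ = _ := by
        rw [lintegral_const_mul _ (by fun_prop), lintegral_exp_sq_gaussianReal,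
          ← ENNReal.ofReal_mul (by positivity)]

variable {E : Type*} [NormedAddCommGroup E] [InnerProductSpace ℝ E] [FiniteDimensional ℝ E]
  [MeasurableSpace E] [BorelSpace E]

lemma stdGaussian_map_dual (L : StrongDual ℝ E) :
    (stdGaussian E).map L = (gaussianReal 0 1).map (fun x => ‖L‖ * x) := by
  rw [IsGaussian.map_eq_gaussianReal, gaussianReal_map_const_mul, variance_dual_stdGaussian,
    integral_strongDual_stdGaussian]
  congr 1
  · simp
  · ext; simp

/-- Even moments of a linear functional of a Gaussian vector. -/
lemma lintegral_dual_pow_stdGaussian_le (L : StrongDual ℝ E) (m : ℕ) :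
    ∫⁻ x, ENNReal.ofReal (L x ^ (2 * m)) ∂(stdGaussian E) ≤
      ENNReal.ofReal (‖L‖ ^ (2 * m) * (m.factorial * 4 ^ m * √2)) := by
  rw [← lintegral_map (f := fun y : ℝ => ENNReal.ofReal (y ^ (2 * m))) (by fun_prop)
    L.continuous.measurable, stdGaussian_map_dual, lintegral_map (by fun_prop) (by fun_prop),
    ENNReal.ofReal_mul (by positivity)]
  simp_rw [mul_pow]
  have : ∀ x : ℝ, ENNReal.ofReal (‖L‖ ^ (2 * m) * x ^ (2 * m)) =
      ENNReal.ofReal (‖L‖ ^ (2 * m)) * ENNReal.ofReal (x ^ (2 * m)) := fun x =>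
    ENNReal.ofReal_mul (by positivity)
  simp_rw [this]
  rw [lintegral_const_mul _ (by fun_prop)]
  gcongr
  exact lintegral_pow_gaussianReal_le m

lemma lintegral_dual_sq_stdGaussian (L : StrongDual ℝ E) :
    ∫⁻ x, ENNReal.ofReal (L x ^ 2) ∂(stdGaussian E) = ENNReal.ofReal (‖L‖ ^ 2) := by
  have hm : MemLp L 2 (stdGaussian E) := by
    have := (IsGaussian.memLp_id (stdGaussian E) 2 (by simp)).continuousLinearMap_comp L
    simpa using this
  rw [← ofReal_integral_eq_lintegral_ofReal hm.integrable_sq (ae_of_all _ fun x => sq_nonneg _),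
    ← variance_dual_stdGaussian L, variance_of_integral_eq_zero hm.aemeasurable
      (integral_strongDual_stdGaussian L)]

lemma lintegral_norm_sq_stdGaussian :
    ∫⁻ x, ENNReal.ofReal (‖x‖ ^ 2) ∂(stdGaussian E) = finrank ℝ E := by
  have h : ∀ x : E, ENNReal.ofReal (‖x‖ ^ 2) =
      ∑ i, ENNReal.ofReal ((innerSL ℝ (stdOrthonormalBasis ℝ E i)) x ^ 2) := by
    intro x
    rw [← ENNReal.ofReal_sum_of_nonneg (fun i _ => sq_nonneg _),
      ← OrthonormalBasis.sum_sq_inner_left (stdOrthonormalBasis ℝ E) x]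
    simp [real_inner_comm]
  simp_rw [h]
  rw [lintegral_finsetSum _ (fun i _ => by fun_prop)]
  simp_rw [lintegral_dual_sq_stdGaussian]
  simp

/-- Jensen's inequality for `‖x‖ ^ 2`, whose mean is the dimension. A lower bound is what is wanted:
going from the Gaussian law to the sphere divides by this moment. -/
lemma finrank_sq_le_lintegral_norm_pow_four :
    (finrank ℝ E : ℝ≥0∞) ^ 2 ≤ ∫⁻ x, ENNReal.ofReal (‖x‖ ^ 4) ∂(stdGaussian E) := by
  have h := lintegral_pow_le (stdGaussian E) (f := fun x => ENNReal.ofReal (‖x‖ ^ 2))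
    (by fun_prop) 1
  rw [lintegral_norm_sq_stdGaussian, measure_univ, one_pow, one_mul] at h
  refine h.trans (lintegral_mono fun x => ?_)
  rw [← ENNReal.ofReal_pow (by positivity), ← pow_mul]

end Moments

/-! ### Rotation of a pair of Gaussian vectors -/

section MaureyPisier

/-- The fundamental theorem of calculus along a half-circle, for an odd Lipschitz function. -/
lemma two_mul_eq_neg_integral_rotation {E : Type*} [NormedAddCommGroup E]
    [InnerProductSpace ℝ E] {K : ℝ≥0} {H : E → ℝ} (hH : LipschitzWith K H)
    (hodd : ∀ x, H (-x) = -H x) (p : E × E)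
    (hp : ∀ᵐ t : ℝ, DifferentiableAt ℝ H (ContinuousLinearMap.rotation t p).1) :
    2 * H p.1 = - ∫ t in (0 : ℝ)..Real.pi, fderiv ℝ H (ContinuousLinearMap.rotation t p).1
      (ContinuousLinearMap.rotation t p).2 := by
  set c : ℝ → E := fun t => (ContinuousLinearMap.rotation t p).1 with hc
  have hc' : ∀ t, HasDerivAt c (ContinuousLinearMap.rotation t p).2 t := by
    intro t
    simp only [hc, ContinuousLinearMap.rotation_apply]
    exact ((Real.hasDerivAt_cos t).smul_const p.1).add ((Real.hasDerivAt_sin t).smul_const p.2)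
  have hcL : LipschitzWith (‖p.1‖₊ + ‖p.2‖₊) c := by
    refine lipschitzWith_of_nnnorm_deriv_le (fun t => (hc' t).differentiableAt) fun t => ?_
    rw [(hc' t).deriv, ContinuousLinearMap.rotation_apply]
    refine (nnnorm_add_le _ _).trans (add_le_add ?_ ?_)
    · rw [nnnorm_smul, nnnorm_neg]
      exact mul_le_of_le_one_left' (by
        rw [← NNReal.coe_le_coe]; simpa using Real.abs_sin_le_one t)
    · rw [nnnorm_smul]
      exact mul_le_of_le_one_left' (by
        rw [← NNReal.coe_le_coe]; simpa using Real.abs_cos_le_one t)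
  have hcomp : LipschitzWith (K * (‖p.1‖₊ + ‖p.2‖₊)) (H ∘ c) := hH.comp hcL
  have hftc := (hcomp.lipschitzOnWith (s := uIcc 0 Real.pi)).absolutelyContinuousOnInterval
    |>.integral_deriv_eq_sub
  -- The half-turn ends at `-p.1`, so oddness makes the increment a multiple of `H p.1`; no centring
  -- by a mean is needed.
  have hend : (H ∘ c) Real.pi - (H ∘ c) 0 = -(2 * H p.1) := by
    simp [hc, ContinuousLinearMap.rotation_apply, hodd]
    ring
  rw [hend] at hftc
  rw [← neg_eq_iff_eq_neg.2 hftc, neg_inj]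
  · refine intervalIntegral.integral_congr_ae ?_
    filter_upwards [hp] with t ht _
    exact (ht.hasFDerivAt.comp_hasDerivAt t (hc' t)).deriv

variable {E : Type*} [NormedAddCommGroup E] [InnerProductSpace ℝ E] [FiniteDimensional ℝ E]
  [MeasurableSpace E] [BorelSpace E]

lemma map_rotation_stdGaussian (θ : ℝ) :
    ((stdGaussian E).prod (stdGaussian E)).map (ContinuousLinearMap.rotation θ) =
      (stdGaussian E).prod (stdGaussian E) :=
  IsGaussian.map_rotation_eq_self_of_forall_strongDual_eq_zero
    (fun L => integral_strongDual_stdGaussian L) θ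

/-- Almost every half-circle through Gaussian points meets the points of differentiability of a
Lipschitz function almost everywhere. -/
lemma ae_ae_differentiableAt_rotation {K : ℝ≥0} {H : E → ℝ} (hH : LipschitzWith K H) :
    ∀ᵐ p : E × E ∂((stdGaussian E).prod (stdGaussian E)), ∀ᵐ t : ℝ,
      DifferentiableAt ℝ H (ContinuousLinearMap.rotation t p).1 := by
  have hcont : Measurable fun x : (E × E) × ℝ => (ContinuousLinearMap.rotation x.2 x.1).1 := by
    simp only [ContinuousLinearMap.rotation_apply]
    fun_prop
  have hS := measurableSet_of_differentiableAt ℝ H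
  -- Fubini reduces to one fixed angle; there the rotation preserves the product Gaussian law and
  -- Rademacher's theorem applies to the first coordinate.
  refine (Measure.ae_ae_comm (p := fun (p : E × E) (t : ℝ) =>
    DifferentiableAt ℝ H (ContinuousLinearMap.rotation t p).1) (hcont hS)).2 (ae_of_all _ fun t => ?_)
  have h1 : ∀ᵐ p : E × E ∂((stdGaussian E).prod (stdGaussian E)), DifferentiableAt ℝ H p.1 :=
    Measure.quasiMeasurePreserving_fst.ae
      (stdGaussian_absolutelyContinuous.ae_le hH.ae_differentiableAt)
  have h2 : MeasurePreserving (ContinuousLinearMap.rotation t)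
      ((stdGaussian E).prod (stdGaussian E)) ((stdGaussian E).prod (stdGaussian E)) :=
    ⟨(ContinuousLinearMap.rotation t).continuous.measurable, map_rotation_stdGaussian t⟩
  exact h2.quasiMeasurePreserving.ae h1

end MaureyPisier

/-! ### Dimension-free fourth moments of odd Lipschitz functions -/

section Concentration

variable {E : Type*} [NormedAddCommGroup E] [InnerProductSpace ℝ E] [FiniteDimensional ℝ E]
  [MeasurableSpace E] [BorelSpace E]

/-- Fourth moments of odd Lipschitz functions of a Gaussian vector are bounded independently of
the dimension. -/
lemma lintegral_pow_four_stdGaussian_le {K : ℝ≥0} {H : E → ℝ} (hH : LipschitzWith K H)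
    (hodd : ∀ x, H (-x) = -H x) :
    ∫⁻ x, ENNReal.ofReal (H x ^ 4) ∂(stdGaussian E) ≤ ENNReal.ofReal (300 * (K : ℝ) ^ 4) := by
  set γ := stdGaussian E with hγ
  set φ : E × E → ℝ≥0∞ := fun p => ENNReal.ofReal (fderiv ℝ H p.1 p.2 ^ 4) with hφ
  have hφ0 : Measurable fun p : E × E => fderiv ℝ H p.1 p.2 := by
    exact (ContinuousLinearMap.measurable_apply₂ (𝕜 := ℝ) (E := E) (F := ℝ)).comp
      (((measurable_fderiv ℝ H).comp measurable_fst).prodMk measurable_snd)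
  have hφm : Measurable φ := (hφ0.pow_const 4).ennreal_ofReal
  have henorm : ∀ a : ℝ, ‖a‖ₑ ^ 4 = ENNReal.ofReal (a ^ 4) := by
    intro a
    rw [Real.enorm_eq_ofReal_abs, ← ENNReal.ofReal_pow (abs_nonneg _),
      Even.pow_abs (by decide)]
  have hrot : Measurable fun x : (E × E) × ℝ => ContinuousLinearMap.rotation x.2 x.1 := by
    simp only [ContinuousLinearMap.rotation_apply]
    fun_prop
  -- The factor `π ^ 3` is the price of moving the fourth power inside an integral over an interval
  -- of length `π`.
  have hpoint : ∀ᵐ p ∂(γ.prod γ), ENNReal.ofReal (16 * H p.1 ^ 4) ≤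
      ENNReal.ofReal Real.pi ^ 3 *
        ∫⁻ t in Ioc 0 Real.pi, φ (ContinuousLinearMap.rotation t p) := by
    filter_upwards [ae_ae_differentiableAt_rotation hH] with p hp
    have h1 := two_mul_eq_neg_integral_rotation hH hodd p hp
    have h2 : ENNReal.ofReal (16 * H p.1 ^ 4) = ‖2 * H p.1‖ₑ ^ 4 := by
      rw [henorm]; congr 1; ring
    rw [h2, h1, enorm_neg, intervalIntegral.integral_of_le Real.pi_pos.le]
    have hm : Measurable fun t : ℝ => ‖fderiv ℝ H (ContinuousLinearMap.rotation t p).1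
        (ContinuousLinearMap.rotation t p).2‖ₑ :=
      (hφ0.comp (hrot.comp (measurable_const.prodMk measurable_id))).enorm
    refine (pow_le_pow_left' (enorm_integral_le_lintegral_enorm _) 4).trans
      ((lintegral_pow_le _ hm.aemeasurable 3).trans ?_)
    simp only [henorm]
    simp [hφ]
  have hinv : ∀ t : ℝ, ∫⁻ p, φ (ContinuousLinearMap.rotation t p) ∂(γ.prod γ) =
      ∫⁻ p, φ p ∂(γ.prod γ) := by
    intro t
    rw [← lintegral_map hφm (ContinuousLinearMap.rotation t).continuous.measurable, hγ,
      map_rotation_stdGaussian]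
  -- With the first coordinate fixed, the derivative is a linear functional of norm at most `K` of
  -- an independent Gaussian; `32 * √2` is `m! * 4 ^ m * √2` at `m = 2`.
  have hφint : ∫⁻ p, φ p ∂(γ.prod γ) ≤ ENNReal.ofReal ((K : ℝ) ^ 4 * (32 * √2)) := by
    rw [lintegral_prod _ hφm.aemeasurable]
    calc ∫⁻ x, ∫⁻ y, φ (x, y) ∂γ ∂γ
        ≤ ∫⁻ _, ENNReal.ofReal ((K : ℝ) ^ 4 * (32 * √2)) ∂γ := by
          refine lintegral_mono fun x => ?_
          refine (lintegral_dual_pow_stdGaussian_le (fderiv ℝ H x) 2).trans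
            (ENNReal.ofReal_le_ofReal ?_)
          have hK : ‖fderiv ℝ H x‖ ≤ K := norm_fderiv_le_of_lipschitz ℝ hH
          have : ‖fderiv ℝ H x‖ ^ 4 ≤ (K : ℝ) ^ 4 := by gcongr
          norm_num [Nat.factorial] at this ⊢
          gcongr
      _ = _ := by simp
  have hmain : ∫⁻ p, ENNReal.ofReal (16 * H p.1 ^ 4) ∂(γ.prod γ) ≤
      ENNReal.ofReal Real.pi ^ 4 * ENNReal.ofReal ((K : ℝ) ^ 4 * (32 * √2)) := by
    have hφrm : Measurable fun x : (E × E) × ℝ => φ (ContinuousLinearMap.rotation x.2 x.1) :=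
      hφm.comp hrot
    calc ∫⁻ p, ENNReal.ofReal (16 * H p.1 ^ 4) ∂(γ.prod γ)
        ≤ ∫⁻ p, ENNReal.ofReal Real.pi ^ 3 *
          (∫⁻ t in Ioc 0 Real.pi, φ (ContinuousLinearMap.rotation t p)) ∂(γ.prod γ) :=
          lintegral_mono_ae hpoint
      _ = ENNReal.ofReal Real.pi ^ 3 * ∫⁻ t in Ioc 0 Real.pi,
          ∫⁻ p, φ (ContinuousLinearMap.rotation t p) ∂(γ.prod γ) := by
          rw [lintegral_const_mul' _ _ (by simp), lintegral_lintegral_swap hφrm.aemeasurable]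
      _ = ENNReal.ofReal Real.pi ^ 4 * ∫⁻ p, φ p ∂(γ.prod γ) := by
          simp_rw [hinv]
          rw [setLIntegral_const, Real.volume_Ioc, sub_zero, mul_comm (∫⁻ p, φ p ∂(γ.prod γ)),
            ← mul_assoc, ← pow_succ]
      _ ≤ _ := by gcongr
  have hfst : ∫⁻ p, ENNReal.ofReal (16 * H p.1 ^ 4) ∂(γ.prod γ) =
      16 * ∫⁻ x, ENNReal.ofReal (H x ^ 4) ∂γ := by
    have hHm : Measurable H := hH.continuous.measurable
    rw [lintegral_prod _ (by fun_prop)]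
    simp only [lintegral_const, measure_univ, mul_one]
    rw [← lintegral_const_mul _ (by fun_prop)]
    refine lintegral_congr fun x => ?_
    rw [ENNReal.ofReal_mul (by norm_num)]
    simp
  rw [hfst] at hmain
  have h16 : (16 : ℝ≥0∞) * ∫⁻ x, ENNReal.ofReal (H x ^ 4) ∂γ ≤
      16 * ENNReal.ofReal (300 * (K : ℝ) ^ 4) := by
    refine hmain.trans ?_
    rw [← ENNReal.ofReal_pow Real.pi_pos.le, ← ENNReal.ofReal_mul (by positivity),
      show (16 : ℝ≥0∞) = ENNReal.ofReal 16 by simp, ← ENNReal.ofReal_mul (by norm_num)]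
    refine ENNReal.ofReal_le_ofReal ?_
    -- The constant 300 closes because `98 * 32 * 1.5 = 4704 ≤ 16 * 300`.
    have hpi : Real.pi ^ 4 ≤ 98 := by
      have : Real.pi ^ 4 ≤ 3.1416 ^ 4 := by
        gcongr
        exact Real.pi_lt_d4.le
      linarith
    have hsq : √2 ≤ 1.5 := by
      rw [Real.sqrt_le_left (by norm_num)]; norm_num
    calc Real.pi ^ 4 * ((K : ℝ) ^ 4 * (32 * √2)) ≤ 98 * ((K : ℝ) ^ 4 * (32 * 1.5)) := by gcongr
      _ ≤ 16 * (300 * (K : ℝ) ^ 4) := by nlinarith [pow_nonneg K.coe_nonneg 4]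
  exact (ENNReal.mul_le_mul_iff_right (by norm_num) (by norm_num)).1 h16

/-- The extension, homogeneous of degree one, of a function on the unit sphere. -/
noncomputable def radialExtension (h : E → ℝ) (x : E) : ℝ := ‖x‖ * h (‖x‖⁻¹ • x)

end Concentration

/-! ### Homogeneous extension from the sphere -/

section RadialExtension

variable {E : Type*} [NormedAddCommGroup E] [InnerProductSpace ℝ E]

lemma radialExtension_smul (h : E → ℝ) {r : ℝ} (hr : 0 < r) (x : E) :
    radialExtension h (r • x) = r * radialExtension h x := by
  rw [radialExtension, radialExtension, norm_smul, Real.norm_of_nonneg hr.le, smul_smul, mul_assoc]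
  congr 4
  field_simp

lemma radialExtension_of_norm_eq_one (h : E → ℝ) {x : E} (hx : ‖x‖ = 1) :
    radialExtension h x = h x := by
  simp [radialExtension, hx]

/-- Comparing `x` with its antipode at distance 2: by oddness the difference of values is `2 * h x`.
-/
lemma abs_le_of_lipschitzOn_sphere_of_odd {h : E → ℝ} {L : ℝ}
    (hL : ∀ x y, ‖x‖ = 1 → ‖y‖ = 1 → |h x - h y| ≤ L * ‖x - y‖)
    (hodd : ∀ x, ‖x‖ = 1 → h (-x) = -h x) {x : E} (hx : ‖x‖ = 1) : |h x| ≤ L := by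
  have h1 := hL x (-x) hx (by rwa [norm_neg])
  rw [hodd x hx, sub_neg_eq_add, sub_neg_eq_add, ← two_mul, ← two_smul ℝ x, norm_smul, hx,
    abs_mul] at h1
  norm_num at h1
  linarith

lemma radialExtension_neg {h : E → ℝ} (hodd : ∀ x, ‖x‖ = 1 → h (-x) = -h x) (x : E) :
    radialExtension h (-x) = -radialExtension h x := by
  rcases eq_or_ne x 0 with rfl | hx
  · simp [radialExtension]
  · have hxn : ‖‖x‖⁻¹ • x‖ = 1 := norm_smul_inv_norm (𝕜 := ℝ) hx
    rw [radialExtension, radialExtension, norm_neg, smul_neg, hodd _ hxn, mul_neg]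

/-- The change of direction, rescaled by `‖x‖`, is at most `2 * ‖x - y‖` and meets the Lipschitz
bound. The change of length is at most `‖x - y‖` and meets the bound `|h| ≤ L`, which comes from
oddness. Together they give the factor 3. -/
lemma abs_radialExtension_sub_le {h : E → ℝ} {L : ℝ}
    (hL : ∀ x y, ‖x‖ = 1 → ‖y‖ = 1 → |h x - h y| ≤ L * ‖x - y‖)
    (hodd : ∀ x, ‖x‖ = 1 → h (-x) = -h x) (x y : E) :
    |radialExtension h x - radialExtension h y| ≤ 3 * L * ‖x - y‖ := by
  rcases eq_or_ne x 0 with rfl | hx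
  · rcases eq_or_ne y 0 with rfl | hy
    · simp
    · have h1 := abs_le_of_lipschitzOn_sphere_of_odd hL hodd (norm_smul_inv_norm (𝕜 := ℝ) hy)
      have hL0 : 0 ≤ L := (abs_nonneg _).trans h1
      simp only [radialExtension, norm_zero, zero_mul, zero_sub, abs_neg, abs_mul, abs_norm,
        norm_neg]
      have := mul_le_mul_of_nonneg_left h1 (norm_nonneg y)
      simp only [RCLike.ofReal_real_eq_id, id_eq] at this
      nlinarith [norm_nonneg y, mul_nonneg hL0 (norm_nonneg y)]
  rcases eq_or_ne y 0 with rfl | hy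
  · have h1 := abs_le_of_lipschitzOn_sphere_of_odd hL hodd (norm_smul_inv_norm (𝕜 := ℝ) hx)
    have hL0 : 0 ≤ L := (abs_nonneg _).trans h1
    simp only [radialExtension, norm_zero, zero_mul, sub_zero, abs_mul, abs_norm]
    have := mul_le_mul_of_nonneg_left h1 (norm_nonneg x)
    simp only [RCLike.ofReal_real_eq_id, id_eq] at this
    nlinarith [norm_nonneg x, mul_nonneg hL0 (norm_nonneg x)]
  have hxn := norm_smul_inv_norm (𝕜 := ℝ) hx
  have hyn := norm_smul_inv_norm (𝕜 := ℝ) hy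
  simp only [RCLike.ofReal_real_eq_id, id_eq] at hxn hyn
  have hb := abs_le_of_lipschitzOn_sphere_of_odd hL hodd hyn
  have hL0 : 0 ≤ L := (abs_nonneg _).trans hb
  have hx0 : 0 < ‖x‖ := norm_pos_iff.2 hx
  have hy0 : 0 < ‖y‖ := norm_pos_iff.2 hy
  have hdir : ‖x‖ * ‖‖x‖⁻¹ • x - ‖y‖⁻¹ • y‖ ≤ 2 * ‖x - y‖ := by
    have e1 : ‖x‖ * ‖‖x‖⁻¹ • x - ‖y‖⁻¹ • y‖ = ‖(x - y) + ((‖y‖ - ‖x‖) * ‖y‖⁻¹) • y‖ := by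
      rw [← abs_norm x, ← Real.norm_eq_abs, ← norm_smul, smul_sub, smul_smul, smul_smul,
        Real.norm_eq_abs, abs_norm, mul_inv_cancel₀ hx0.ne', one_smul, sub_mul,
        mul_inv_cancel₀ hy0.ne', sub_smul, one_smul]
      congr 1
      abel
    rw [e1]
    refine (norm_add_le _ _).trans ?_
    rw [norm_smul, norm_mul, norm_inv, norm_norm, mul_assoc, inv_mul_cancel₀ hy0.ne', mul_one,
      Real.norm_eq_abs, abs_sub_comm]
    linarith [abs_norm_sub_norm_le x y]
  have e2 : radialExtension h x - radialExtension h y =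
      ‖x‖ * (h (‖x‖⁻¹ • x) - h (‖y‖⁻¹ • y)) + (‖x‖ - ‖y‖) * h (‖y‖⁻¹ • y) := by
    simp only [radialExtension]; ring
  rw [e2]
  calc _ ≤ |‖x‖ * (h (‖x‖⁻¹ • x) - h (‖y‖⁻¹ • y))| + |(‖x‖ - ‖y‖) * h (‖y‖⁻¹ • y)| :=
        abs_add_le _ _
    _ ≤ ‖x‖ * (L * ‖‖x‖⁻¹ • x - ‖y‖⁻¹ • y‖) + ‖x - y‖ * L := by
        rw [abs_mul, abs_mul, abs_norm]
        have h1 := hL _ _ hxn hyn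
        have h2 := abs_norm_sub_norm_le x y
        gcongr
    _ ≤ 3 * L * ‖x - y‖ := by nlinarith

end RadialExtension

/-! ### Concentration on the sphere -/

section SphereConcentration

variable {E : Type*} [NormedAddCommGroup E] [InnerProductSpace ℝ E] [FiniteDimensional ℝ E]
  [MeasurableSpace E] [BorelSpace E]

/-- Concentration on the sphere: the fourth moment of an odd function that is `L`-Lipschitz on the
unit sphere of a `d`-dimensional space is of order `L ^ 4 / d ^ 2`. -/
lemma lintegral_pow_four_unifSphere_le [Nontrivial E] {h : E → ℝ} {L : ℝ}
    (hL : ∀ x y, ‖x‖ = 1 → ‖y‖ = 1 → |h x - h y| ≤ L * ‖x - y‖)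
    (hodd : ∀ x, ‖x‖ = 1 → h (-x) = -h x) :
    ∫⁻ e, ENNReal.ofReal (h (e : E) ^ 4) ∂(unifSphere E) ≤
      ENNReal.ofReal (24300 * L ^ 4 / (finrank ℝ E : ℝ) ^ 2) := by
  have hd : (0 : ℝ) < finrank ℝ E := by exact_mod_cast finrank_pos
  have hL0 : 0 ≤ L := by
    obtain ⟨x, hx⟩ := exists_norm_eq E (zero_le_one' ℝ)
    exact (abs_nonneg _).trans (abs_le_of_lipschitzOn_sphere_of_odd hL hodd hx)
  have hlip : LipschitzWith (3 * L).toNNReal (radialExtension h) := by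
    refine LipschitzWith.of_dist_le_mul fun x y => ?_
    rw [Real.dist_eq, dist_eq_norm, Real.coe_toNNReal _ (by positivity)]
    exact abs_radialExtension_sub_le hL hodd x y
  have h1 := lintegral_pow_four_stdGaussian_le hlip (radialExtension_neg hodd)
  have hm : Measurable (radialExtension h) := hlip.continuous.measurable
  rw [lintegral_stdGaussian_of_homogeneous (by fun_prop) 4 (fun r hr x => by
    rw [radialExtension_smul h hr, mul_pow, ENNReal.ofReal_mul (by positivity)]),
    Real.coe_toNNReal _ (by positivity)] at h1
  have h2 : ∫⁻ e : Metric.sphere (0 : E) 1, ENNReal.ofReal (radialExtension h (e : E) ^ 4)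
      ∂(unifSphere E) = ∫⁻ e, ENNReal.ofReal (h (e : E) ^ 4) ∂(unifSphere E) :=
    lintegral_congr fun e => by rw [radialExtension_of_norm_eq_one h (norm_eq_of_mem_sphere e)]
  rw [h2] at h1
  -- The Gaussian moment factors as the fourth moment of the norm, at least `d ^ 2`, times the
  -- spherical mean; the constant is `300 * 3 ^ 4 = 24300`.
  have h3 := (mul_le_mul_left finrank_sq_le_lintegral_norm_pow_four
    (∫⁻ e, ENNReal.ofReal (h (e : E) ^ 4) ∂(unifSphere E))).trans h1
  rw [ENNReal.ofReal_div_of_pos (by positivity), ENNReal.le_div_iff_mul_le (Or.inl (by simpa using hd.ne'))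
    (by simp), mul_comm, ENNReal.ofReal_pow hd.le, ENNReal.ofReal_natCast]
  refine h3.trans (ENNReal.ofReal_le_ofReal (le_of_eq ?_))
  ring

end SphereConcentration

/-! ### The `ℓ_p`-norms -/

section EllNorm

variable {ι : Type*} [Fintype ι]

lemma ellNorm_nonneg (p : ℝ≥0∞) (z : EuclideanSpace ℝ ι) : 0 ≤ ellNorm p z := by
  rw [ellNorm]
  rcases p.trichotomy with rfl | rfl | hp
  · rw [PiLp.norm_eq_card]; positivity
  · rw [PiLp.norm_eq_ciSup]; exact Real.iSup_nonneg fun i => norm_nonneg _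
  · rw [PiLp.norm_eq_sum hp]; positivity

lemma ellNorm_eq_sum {p : ℝ≥0∞} (hp : 0 < p.toReal) (z : EuclideanSpace ℝ ι) :
    ellNorm p z = (∑ i, |z i| ^ p.toReal) ^ (1 / p.toReal) := by
  rw [ellNorm, PiLp.norm_eq_sum hp]
  rfl

lemma ellNorm_top_eq (z : EuclideanSpace ℝ ι) : ellNorm ∞ z = ⨆ i, |z i| := by
  rw [ellNorm, PiLp.norm_eq_ciSup]
  rfl

lemma ellNorm_two (z : EuclideanSpace ℝ ι) : ellNorm 2 z = ‖z‖ := rfl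

lemma continuous_ellNorm {p : ℝ≥0∞} (hp : 1 ≤ p) :
    Continuous (ellNorm p : EuclideanSpace ℝ ι → ℝ) := by
  have : Fact (1 ≤ p) := ⟨hp⟩
  unfold ellNorm
  exact ((PiLp.continuous_toLp p _).comp (PiLp.continuous_ofLp 2 _)).norm

lemma ellNorm_smul {p : ℝ≥0∞} (hp : 1 ≤ p) (r : ℝ) (z : EuclideanSpace ℝ ι) :
    ellNorm p (r • z) = |r| * ellNorm p z := by
  have : Fact (1 ≤ p) := ⟨hp⟩
  unfold ellNorm
  rw [WithLp.ofLp_smul, WithLp.toLp_smul, norm_smul, Real.norm_eq_abs]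

lemma abs_apply_le_ellNorm {p : ℝ≥0∞} (hp : 1 ≤ p) (z : EuclideanSpace ℝ ι) (i : ι) :
    |z i| ≤ ellNorm p z := by
  have : Fact (1 ≤ p) := ⟨hp⟩
  exact PiLp.norm_apply_le (WithLp.toLp p (WithLp.ofLp z) : PiLp p (fun _ : ι => ℝ)) i

/-- The `ℓ_p`-norms decrease in `p`. -/
lemma ellNorm_anti {p q : ℝ≥0∞} (hp : 1 ≤ p) (hpq : p ≤ q) (z : EuclideanSpace ℝ ι) :
    ellNorm q z ≤ ellNorm p z := by
  have hN := ellNorm_nonneg p z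
  rcases eq_or_ne q ∞ with rfl | hq
  · rw [ellNorm_top_eq]
    exact Real.iSup_le (fun i => abs_apply_le_ellNorm hp z i) hN
  have hptop : p ≠ ∞ := ne_top_of_le_ne_top hq hpq
  have hp1 : 1 ≤ p.toReal := by
    rw [← ENNReal.toReal_one]; exact ENNReal.toReal_mono hptop hp
  have hpq' : p.toReal ≤ q.toReal := ENNReal.toReal_mono hq hpq
  have hp0 : 0 < p.toReal := by linarith
  have hq0 : 0 < q.toReal := by linarith
  have hsum : ∑ i, |z i| ^ p.toReal = ellNorm p z ^ p.toReal := by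
    rw [ellNorm_eq_sum hp0, ← Real.rpow_mul (by positivity), one_div, inv_mul_cancel₀ hp0.ne',
      Real.rpow_one]
  have hle : ∑ i, |z i| ^ q.toReal ≤ ellNorm p z ^ q.toReal := by
    calc ∑ i, |z i| ^ q.toReal
        = ∑ i, |z i| ^ (q.toReal - p.toReal) * |z i| ^ p.toReal := by
          refine Finset.sum_congr rfl fun i _ => ?_
          rw [← Real.rpow_add' (abs_nonneg _) (by linarith)]
          congr 1; ring
      _ ≤ ∑ i, ellNorm p z ^ (q.toReal - p.toReal) * |z i| ^ p.toReal := by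
          gcongr with i
          exact abs_apply_le_ellNorm hp z i
      _ = ellNorm p z ^ q.toReal := by
          rw [← Finset.mul_sum, hsum, ← Real.rpow_add' hN (by linarith)]
          congr 1; ring
  rw [ellNorm_eq_sum hq0]
  calc (∑ i, |z i| ^ q.toReal) ^ (1 / q.toReal)
      ≤ (ellNorm p z ^ q.toReal) ^ (1 / q.toReal) := by gcongr
    _ = ellNorm p z := by
        rw [← Real.rpow_mul hN, one_div, mul_inv_cancel₀ hq0.ne', Real.rpow_one]

/-- Hölder's inequality between the `ℓ_s`-norm and the power sum of order `4 j`. -/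
lemma ellNorm_pow_le_sum_pow {s : ℝ} {j : ℕ} (hs : 0 < s) (hsj : s ≤ 4 * j)
    (z : EuclideanSpace ℝ ι) :
    (ellNorm (ENNReal.ofReal s) z ^ 4) ^ j ≤
      (Fintype.card ι : ℝ) ^ (4 * j / s - 1) * ∑ i, z i ^ (4 * j) := by
  have hp : (ENNReal.ofReal s).toReal = s := ENNReal.toReal_ofReal hs.le
  rw [ellNorm_eq_sum (by rw [hp]; exact hs), hp, ← pow_mul, ← Real.rpow_natCast,
    ← Real.rpow_mul (by positivity)]
  have h1 := Real.rpow_sum_le_const_mul_sum_rpow (s := (Finset.univ : Finset ι))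
    (f := fun i => |z i| ^ s) (p := 4 * j / s) (by rw [le_div_iff₀ hs]; linarith)
  have e1 : 1 / s * ((4 * j : ℕ) : ℝ) = 4 * j / s := by push_cast; ring
  rw [e1]
  refine (le_of_eq ?_).trans (h1.trans (le_of_eq ?_))
  · congr 1
    refine Finset.sum_congr rfl fun i _ => ?_
    rw [abs_of_nonneg (Real.rpow_nonneg (abs_nonneg (z i)) s)]
  · congr 1
    refine Finset.sum_congr rfl fun i _ => ?_
    rw [abs_of_nonneg (Real.rpow_nonneg (abs_nonneg (z i)) s), ← Real.rpow_mul (abs_nonneg _), mul_div_cancel₀ _ hs.ne',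
      show (4 * j : ℝ) = ((4 * j : ℕ) : ℝ) by push_cast; ring, Real.rpow_natCast,
      Even.pow_abs (by exact ⟨2 * j, by ring⟩)]

end EllNorm

/-! ### The order of the fourth moment of `‖e‖_q` -/

section SphereMoment

variable {ι : Type*} [Fintype ι]

/-- Jensen raises the fourth power to order `4 j`, and Hölder then replaces the norm by a sum over
coordinates, whose Gaussian moments are explicit. Since `(2 j)! ≤ (2 j) ^ (2 j)`, the `j`-th root
leaves only a factor of order `j ^ 2`. -/
lemma lintegral_ellNorm_pow_four_stdGaussian_le {s : ℝ} {j : ℕ} (hj : 0 < j) (hs : 1 ≤ s)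
    (hsj : s ≤ 4 * j) :
    ∫⁻ x, ENNReal.ofReal (ellNorm (ENNReal.ofReal s) x ^ 4) ∂(stdGaussian (EuclideanSpace ℝ ι)) ≤
      ENNReal.ofReal (100 * (j : ℝ) ^ 2 * (Fintype.card ι : ℝ) ^ (4 / s)) := by
  have hs0 : 0 < s := by linarith
  have hj0 : (0 : ℝ) < j := by exact_mod_cast hj
  have hs1 : (1 : ℝ≥0∞) ≤ ENNReal.ofReal s := by simpa using hs
  have hm : Measurable (ellNorm (ENNReal.ofReal s) : EuclideanSpace ℝ ι → ℝ) :=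
    (continuous_ellNorm hs1).measurable
  rcases isEmpty_or_nonempty ι with hι | hι
  · have h0 : ∀ x : EuclideanSpace ℝ ι, ellNorm (ENNReal.ofReal s) x = 0 := fun x => by
      rw [Subsingleton.elim x ((0 : ℝ) • x), ellNorm_smul hs1, abs_zero, zero_mul]
    simp [h0]
  have hd : (0 : ℝ) < Fintype.card ι := by exact_mod_cast Fintype.card_pos
  obtain ⟨k, rfl⟩ : ∃ k, j = k + 1 := ⟨j - 1, by omega⟩
  set f : EuclideanSpace ℝ ι → ℝ≥0∞ :=
    fun x => ENNReal.ofReal (ellNorm (ENNReal.ofReal s) x ^ 4) with hf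
  have hcoord : ∀ i : ι, ∫⁻ x : EuclideanSpace ℝ ι, ENNReal.ofReal (x i ^ (4 * (k + 1)))
      ∂(stdGaussian (EuclideanSpace ℝ ι)) ≤
      ENNReal.ofReal ((2 * (k + 1)).factorial * 4 ^ (2 * (k + 1)) * √2) := by
    intro i
    have h := lintegral_dual_pow_stdGaussian_le
      (EuclideanSpace.proj i : StrongDual ℝ (EuclideanSpace ℝ ι)) (2 * (k + 1))
    rw [← mul_assoc] at h
    refine h.trans (ENNReal.ofReal_le_ofReal ?_)
    have hn : ‖(EuclideanSpace.proj i : StrongDual ℝ (EuclideanSpace ℝ ι))‖ ≤ 1 :=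
      ContinuousLinearMap.opNorm_le_bound _ zero_le_one fun x => by
        rw [one_mul]; exact PiLp.norm_apply_le x i
    exact mul_le_of_le_one_left (by positivity) (pow_le_one₀ (norm_nonneg _) hn)
  set d : ℝ := (Fintype.card ι : ℝ) with hdd
  set J : ℝ := ((k + 1 : ℕ) : ℝ) with hJ
  have hpow : (∫⁻ x, f x ∂(stdGaussian (EuclideanSpace ℝ ι))) ^ (k + 1) ≤
      ENNReal.ofReal (100 * J ^ 2 * d ^ (4 / s)) ^ (k + 1) := by
    calc (∫⁻ x, f x ∂(stdGaussian (EuclideanSpace ℝ ι))) ^ (k + 1)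
        ≤ ∫⁻ x, f x ^ (k + 1) ∂(stdGaussian (EuclideanSpace ℝ ι)) := by
          have := lintegral_pow_le (stdGaussian (EuclideanSpace ℝ ι)) (f := f)
            (by fun_prop) k
          simpa using this
      _ ≤ ∫⁻ x : EuclideanSpace ℝ ι, ENNReal.ofReal (d ^ (4 * J / s - 1)) *
            ∑ i, ENNReal.ofReal (x i ^ (4 * (k + 1))) ∂(stdGaussian (EuclideanSpace ℝ ι)) := by
          refine lintegral_mono fun x => ?_
          rw [hf, ← ENNReal.ofReal_sum_of_nonneg
            (fun i _ => Even.pow_nonneg ⟨2 * (k + 1), by ring⟩ _),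
            ← ENNReal.ofReal_mul (by positivity), ← ENNReal.ofReal_pow (by positivity)]
          exact ENNReal.ofReal_le_ofReal (ellNorm_pow_le_sum_pow hs0 hsj x)
      _ = ENNReal.ofReal (d ^ (4 * J / s - 1)) * ∑ i, ∫⁻ x : EuclideanSpace ℝ ι,
            ENNReal.ofReal (x i ^ (4 * (k + 1))) ∂(stdGaussian (EuclideanSpace ℝ ι)) := by
          rw [lintegral_const_mul _ (by fun_prop), lintegral_finsetSum _ (fun i _ => by fun_prop)]
      _ ≤ ENNReal.ofReal (d ^ (4 * J / s - 1)) * ∑ i : ι,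
            ENNReal.ofReal ((2 * (k + 1)).factorial * 4 ^ (2 * (k + 1)) * √2) := by
          gcongr with i
          exact hcoord i
      _ = ENNReal.ofReal (d ^ (4 * J / s) *
            ((2 * (k + 1)).factorial * 4 ^ (2 * (k + 1)) * √2)) := by
          rw [Finset.sum_const, Finset.card_univ, nsmul_eq_mul, ← ENNReal.ofReal_natCast,
            ← ENNReal.ofReal_mul (by positivity), ← ENNReal.ofReal_mul (by positivity), ← mul_assoc,
            ← hdd, ← Real.rpow_add_one hd.ne', sub_add_cancel]
      _ ≤ ENNReal.ofReal ((100 * J ^ 2 * d ^ (4 / s)) ^ (k + 1)) := by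
          refine ENNReal.ofReal_le_ofReal ?_
          have h1 : ((2 * (k + 1)).factorial : ℝ) ≤ (2 * J) ^ (2 * (k + 1)) := by
            have := Nat.factorial_le_pow (2 * (k + 1))
            have h2 : ((2 * (k + 1)).factorial : ℝ) ≤ ((2 * (k + 1) : ℕ) : ℝ) ^ (2 * (k + 1)) := by
              exact_mod_cast this
            rw [hJ]
            push_cast at h2 ⊢
            exact h2
          have h2 : √2 ≤ 1.5 ^ (k + 1) := by
            have : √2 ≤ 1.5 := by rw [Real.sqrt_le_left (by norm_num)]; norm_num
            exact this.trans (le_self_pow₀ (by norm_num) (by omega))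
          have h3 : d ^ (4 * J / s) = (d ^ (4 / s)) ^ (k + 1) := by
            rw [← Real.rpow_natCast, ← Real.rpow_mul hd.le, ← hJ]
            congr 1; ring
          rw [h3]
          calc (d ^ (4 / s)) ^ (k + 1) * ((2 * (k + 1)).factorial * 4 ^ (2 * (k + 1)) * √2)
              ≤ (d ^ (4 / s)) ^ (k + 1) * ((2 * J) ^ (2 * (k + 1)) * 4 ^ (2 * (k + 1)) *
                1.5 ^ (k + 1)) := by gcongr
            -- `96 = 2 ^ 2 * 4 ^ 2 * 1.5`.
            _ = (96 * J ^ 2 * d ^ (4 / s)) ^ (k + 1) := by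
                rw [pow_mul, pow_mul, ← mul_pow, ← mul_pow, ← mul_pow]
                congr 1; ring
            _ ≤ _ := by gcongr; norm_num
      _ = _ := ENNReal.ofReal_pow (by positivity) _
  exact (ENNReal.pow_le_pow_left_iff (by omega)).1 hpow

lemma lintegral_ellNorm_pow_four_unifSphere_le [Nonempty ι] {s : ℝ} (hs : 2 ≤ s) :
    ∫⁻ e, ENNReal.ofReal (ellNorm (ENNReal.ofReal s) (e : EuclideanSpace ℝ ι) ^ 4)
        ∂(unifSphere (EuclideanSpace ℝ ι)) ≤
      ENNReal.ofReal ((10 * s * (Fintype.card ι : ℝ) ^ (2 / s - 1)) ^ 2) := by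
  have hs1 : (1 : ℝ≥0∞) ≤ ENNReal.ofReal s := by simp; linarith
  have hd : (0 : ℝ) < Fintype.card ι := by exact_mod_cast Fintype.card_pos
  have hm : Measurable (ellNorm (ENNReal.ofReal s) : EuclideanSpace ℝ ι → ℝ) :=
    (continuous_ellNorm hs1).measurable
  -- The least `j` admissible in the Gaussian bound; being at most `s`, it gives growth quadratic in
  -- `s`.
  have hj : 0 < ⌈s / 4⌉₊ := Nat.ceil_pos.2 (by linarith)
  have hj' : (⌈s / 4⌉₊ : ℝ) ≤ s := by
    have := Nat.ceil_lt_add_one (show 0 ≤ s / 4 by linarith)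
    linarith
  have h1 := lintegral_ellNorm_pow_four_stdGaussian_le (ι := ι) hj (by linarith : 1 ≤ s)
    (by have := Nat.le_ceil (s / 4); linarith)
  rw [lintegral_stdGaussian_of_homogeneous (by fun_prop) 4 (fun r hr x => by
    rw [ellNorm_smul hs1, abs_of_pos hr, mul_pow, ENNReal.ofReal_mul (by positivity)])] at h1
  have h3 := (mul_le_mul_left (finrank_sq_le_lintegral_norm_pow_four (E := EuclideanSpace ℝ ι))
    (∫⁻ e, ENNReal.ofReal (ellNorm (ENNReal.ofReal s) (e : EuclideanSpace ℝ ι) ^ 4)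
        ∂(unifSphere (EuclideanSpace ℝ ι)))).trans h1
  rw [finrank_euclideanSpace] at h3
  have h4 : ENNReal.ofReal ((10 * s * (Fintype.card ι : ℝ) ^ (2 / s - 1)) ^ 2) =
      ENNReal.ofReal (100 * s ^ 2 * (Fintype.card ι : ℝ) ^ (4 / s)) /
        (Fintype.card ι : ℝ≥0∞) ^ 2 := by
    rw [← ENNReal.ofReal_natCast, ← ENNReal.ofReal_pow hd.le,
      ← ENNReal.ofReal_div_of_pos (by positivity)]
    congr 1
    rw [Real.rpow_sub_one hd.ne', mul_pow, div_pow, ← Real.rpow_natCast (_ ^ (2 / s)),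
      ← Real.rpow_mul hd.le]
    push_cast
    rw [show 2 / s * 2 = 4 / s by ring]
    ring
  rw [h4, ENNReal.le_div_iff_mul_le (Or.inl (by simp)) (Or.inl (by simp)), mul_comm]
  refine h3.trans (ENNReal.ofReal_le_ofReal ?_)
  gcongr

lemma sphereMoment_le_of_lintegral_le {dx dy : ℕ} {q : ℝ≥0∞} {b : ℝ} (hb : 0 ≤ b)
    (h : ∫⁻ e, ENNReal.ofReal (ellNorm q (e : Vec dx dy) ^ 4) ∂(unifSphere (Vec dx dy)) ≤
      ENNReal.ofReal (b ^ 2)) (hq : 1 ≤ q) :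
    sphereMoment dx dy q ≤ b := by
  refine Real.sqrt_le_iff.2 ⟨hb, ?_⟩
  have hm : Measurable (ellNorm q : Vec dx dy → ℝ) := (continuous_ellNorm hq).measurable
  rw [integral_eq_lintegral_of_nonneg_ae (ae_of_all _ fun e => by positivity)
    (Measurable.aestronglyMeasurable (by fun_prop))]
  exact ENNReal.toReal_le_of_le_ofReal (by positivity) h

/-- A bound linear in the exponent is wasteful for `q` beyond `log d`. There monotonicity of the
norms lowers the exponent to about `log d`, at which the power of `d` changes by a bounded factor
only. -/
lemma sphereMoment_le {dx dy : ℕ} (hx : 0 < dx) (hy : 0 < dy) {q : ℝ≥0∞} (hq : 2 ≤ q) :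
    sphereMoment dx dy q ≤
      300 * (min q (ENNReal.ofReal (Real.log ((dx + dy : ℕ) : ℝ)))).toReal *
          ((dx + dy : ℕ) : ℝ) ^ ((2 / q).toReal - 1) := by
  have : Nonempty (Fin dx ⊕ Fin dy) := ⟨Sum.inl ⟨0, hx⟩⟩
  set d : ℝ := ((dx + dy : ℕ) : ℝ) with hd
  have hcard : (Fintype.card (Fin dx ⊕ Fin dy) : ℝ) = d := by simp [hd]
  have hd2 : 2 ≤ d := by rw [hd]; exact_mod_cast (by omega : 2 ≤ dx + dy)
  have hd0 : 0 < d := by linarith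
  have hlog : 0.69 < Real.log d :=
    (by have := Real.log_two_gt_d9; linarith : 0.69 < Real.log 2).trans_le
      (Real.log_le_log (by norm_num) hd2)
  have hq1 : 1 ≤ q := le_trans (by norm_num) hq
  rcases le_total q (ENNReal.ofReal (Real.log d)) with hle | hle
  · have hqtop : q ≠ ∞ := ne_top_of_le_ne_top ENNReal.ofReal_ne_top hle
    have h2 : 2 ≤ q.toReal := by
      rw [← ENNReal.toReal_ofNat]; exact ENNReal.toReal_mono hqtop hq
    rw [min_eq_left hle, ENNReal.toReal_div, ENNReal.toReal_ofNat]
    have h := lintegral_ellNorm_pow_four_unifSphere_le (ι := Fin dx ⊕ Fin dy) h2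
    rw [ENNReal.ofReal_toReal hqtop, hcard] at h
    refine (sphereMoment_le_of_lintegral_le (by positivity) h hq1).trans ?_
    gcongr
    norm_num
  · rw [min_eq_right hle, ENNReal.toReal_ofReal (by linarith)]
    -- The maximum keeps the exponent at least 2 in small dimensions. As `log d ≥ log 2 > 0.69`, it
    -- is still at most `3 * log d`.
    set s : ℝ := max 2 (Real.log d) with hs
    have h2 : 2 ≤ s := le_max_left _ _
    have hsq : ENNReal.ofReal s ≤ q := by
      rcases max_cases 2 (Real.log d) with ⟨h, -⟩ | ⟨h, -⟩
      · rw [hs, h]; simpa using hq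
      · rw [hs, h]; exact hle
    have h := lintegral_ellNorm_pow_four_unifSphere_le (ι := Fin dx ⊕ Fin dy) h2
    have hmono : ∫⁻ e, ENNReal.ofReal (ellNorm q (e : Vec dx dy) ^ 4) ∂(unifSphere (Vec dx dy)) ≤
        ∫⁻ e, ENNReal.ofReal (ellNorm (ENNReal.ofReal s) (e : Vec dx dy) ^ 4)
          ∂(unifSphere (Vec dx dy)) := by
      refine lintegral_mono fun e => ENNReal.ofReal_le_ofReal ?_
      have h1 := ellNorm_nonneg q (e : Vec dx dy)
      gcongr
      exact ellNorm_anti (by simp; linarith) hsq _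
    rw [hcard] at h
    refine (sphereMoment_le_of_lintegral_le (by positivity) (hmono.trans h) hq1).trans ?_
    have hs3 : s ≤ 3 * Real.log d := max_le (by linarith) (by linarith)
    have hexp : d ^ (2 / s - 1) ≤ 8 * d ^ ((2 / q).toReal - 1) := by
      -- `d ^ (2 / log d) = e ^ 2 < 8`; with the other factors this gives `10 * 3 * 8 = 240 ≤ 300`.
      have e1 : d ^ (2 / s) ≤ 8 := by
        calc d ^ (2 / s) ≤ d ^ (2 / Real.log d) := by
              gcongr
              · linarith
              · exact le_max_right _ _
          _ = Real.exp 2 := by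
              rw [Real.rpow_def_of_pos hd0, mul_div_cancel₀ _ (by linarith)]
          _ ≤ 8 := by
              rw [show (2 : ℝ) = 1 + 1 by norm_num, Real.exp_add]
              have := Real.exp_one_lt_d9
              have := Real.exp_pos 1
              nlinarith
      have e2 : 1 ≤ d ^ ((2 / q).toReal) :=
        Real.one_le_rpow (by linarith) ENNReal.toReal_nonneg
      rw [Real.rpow_sub_one hd0.ne', Real.rpow_sub_one hd0.ne', ← mul_div_assoc]
      gcongr
      linarith
    calc 10 * s * d ^ (2 / s - 1) ≤ 10 * (3 * Real.log d) * (8 * d ^ ((2 / q).toReal - 1)) := by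
          gcongr
      _ ≤ _ := by
          have : 0 ≤ Real.log d * d ^ ((2 / q).toReal - 1) := by positivity
          nlinarith

end SphereMoment

/-! ### Symmetry and second moments of the uniform law on the sphere -/

section SphereSymmetry

variable {E : Type*} [NormedAddCommGroup E] [InnerProductSpace ℝ E] [FiniteDimensional ℝ E]
  [MeasurableSpace E] [BorelSpace E] [Nontrivial E]

/-- Homogeneity of degree zero: the direction of a Gaussian vector is uniform. Symmetries of the
Gaussian law thus pass to the sphere. -/
lemma lintegral_unifSphere_eq_stdGaussian {K : E → ℝ≥0∞} (hK : Measurable K) :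
    ∫⁻ e, K (e : E) ∂(unifSphere E) = ∫⁻ x, K (‖x‖⁻¹ • x) ∂(stdGaussian E) := by
  have h := lintegral_stdGaussian_of_homogeneous (H := fun x : E => K (‖x‖⁻¹ • x))
    (hK.comp (by fun_prop)) 0 (fun r hr x => by
      rw [pow_zero, ENNReal.ofReal_one, one_mul, norm_smul, Real.norm_of_nonneg hr.le, smul_smul]
      congr 2
      field_simp)
  simp only [pow_zero, ENNReal.ofReal_one, lintegral_const, measure_univ, mul_one, one_mul] at h
  rw [h]
  exact lintegral_congr fun e => by simp

/-- The uniform distribution on the sphere is symmetric. -/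
lemma measurePreserving_neg_unifSphere :
    MeasurePreserving (fun e : Metric.sphere (0 : E) 1 => -e) (unifSphere E) (unifSphere E) := by
  have hneg : Measurable (fun e : Metric.sphere (0 : E) 1 => -e) := continuous_neg.measurable
  refine ⟨hneg, ?_⟩
  ext s hs
  rw [Measure.map_apply hneg hs, ← lintegral_indicator_one hs,
    ← lintegral_indicator_one (hneg hs)]
  set t : Set E := (fun e : Metric.sphere (0 : E) 1 => (e : E)) '' s with ht
  have htm : MeasurableSet t := MeasurableSet.subtype_image Metric.isClosed_sphere.measurableSet hs
  set K : E → ℝ≥0∞ := t.indicator 1 with hK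
  have hKm : Measurable K := measurable_one.indicator htm
  have e1 : ∀ e : Metric.sphere (0 : E) 1, s.indicator 1 e = K e := by
    intro e
    by_cases he : e ∈ s
    · rw [indicator_of_mem he, hK, indicator_of_mem (mem_image_of_mem _ he)]; rfl
    · rw [indicator_of_notMem he, hK, indicator_of_notMem]
      rintro ⟨e', he', h⟩
      exact he (Subtype.ext h ▸ he')
  have e2 : ∀ e : Metric.sphere (0 : E) 1,
      ((fun e : Metric.sphere (0 : E) 1 => -e) ⁻¹' s).indicator 1 e = K (-(e : E)) := by
    intro e
    rw [← coe_neg_sphere, ← e1]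
    rfl
  simp_rw [e1, e2]
  rw [lintegral_unifSphere_eq_stdGaussian hKm,
    lintegral_unifSphere_eq_stdGaussian (K := fun x => K (-x)) (hKm.comp measurable_neg)]
  conv_rhs => rw [← stdGaussian_map (LinearIsometryEquiv.neg ℝ (E := E))]
  have hKn : Measurable fun x : E => K (‖x‖⁻¹ • x) := hKm.comp (by fun_prop)
  rw [lintegral_map hKn (by fun_prop)]
  simp

/-- A quotient of two Gaussian second moments: `‖v‖ ^ 2` for the functional and `d` for the norm. -/
lemma integral_inner_sq_unifSphere (v : E) :
    ∫⁻ e, ENNReal.ofReal (inner ℝ (e : E) v ^ 2) ∂(unifSphere E) =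
      ENNReal.ofReal (‖v‖ ^ 2 / finrank ℝ E) := by
  have hd : (0 : ℝ) < finrank ℝ E := by exact_mod_cast finrank_pos
  have h := lintegral_stdGaussian_of_homogeneous
    (H := fun x : E => ENNReal.ofReal (innerSL ℝ v x ^ 2)) (by fun_prop) 2
    (fun r hr x => by
      rw [map_smul, smul_eq_mul, mul_pow, ENNReal.ofReal_mul (by positivity)])
  rw [lintegral_dual_sq_stdGaussian, lintegral_norm_sq_stdGaussian, innerSL_apply_norm] at h
  rw [ENNReal.ofReal_div_of_pos hd, h, ENNReal.ofReal_natCast, mul_comm, mul_div_assoc,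
    ENNReal.div_self (by exact_mod_cast finrank_pos.ne') (by simp), mul_one]
  exact lintegral_congr fun e => by rw [innerSL_apply_apply, real_inner_comm]

/-- The mean of `|⟨e, v⟩|` over the sphere is at most `‖v‖ / √d`. -/
lemma integral_abs_inner_unifSphere_le (v : E) :
    ∫ e, |inner ℝ (e : E) v| ∂(unifSphere E) ≤ ‖v‖ / √(finrank ℝ E) := by
  have hd : (0 : ℝ) < finrank ℝ E := by exact_mod_cast finrank_pos
  have hm : Measurable fun e : Metric.sphere (0 : E) 1 => inner ℝ (e : E) v := by fun_prop
  rw [integral_eq_lintegral_of_nonneg_ae (ae_of_all _ fun e => abs_nonneg _)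
    (Measurable.aestronglyMeasurable (by fun_prop))]
  refine ENNReal.toReal_le_of_le_ofReal (by positivity) ?_
  have h := lintegral_pow_le (unifSphere E)
    (f := fun e => ENNReal.ofReal |inner ℝ (e : E) v|) (by fun_prop) 1
  simp only [← ENNReal.ofReal_pow (abs_nonneg _), measure_univ, one_pow, one_mul,
    Nat.reduceAdd, sq_abs] at h
  rw [integral_inner_sq_unifSphere] at h
  refine (ENNReal.pow_le_pow_left_iff two_ne_zero).1 (h.trans (le_of_eq ?_))
  rw [← ENNReal.ofReal_pow (by positivity), div_pow, Real.sq_sqrt hd.le]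

end SphereSymmetry

/-! ### Divergence theorem on a ball for Lipschitz functions -/

section Divergence

/-- The cone of height `R` over the ball of radius `R`. -/
noncomputable def cone {E : Type*} [NormedAddCommGroup E] (R : ℝ) (x : E) : ℝ := max 0 (R - ‖x‖)

lemma lipschitzWith_cone {E : Type*} [NormedAddCommGroup E] (R : ℝ) : LipschitzWith 1 (cone R : E → ℝ) := by
  refine LipschitzWith.const_max ?_ 0
  refine LipschitzWith.of_dist_le_mul fun x y => ?_
  rw [Real.dist_eq, dist_eq_norm, NNReal.coe_one, one_mul, sub_sub_sub_cancel_left, abs_sub_comm]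
  exact abs_norm_sub_norm_le x y

lemma cone_of_le {E : Type*} [NormedAddCommGroup E] {R : ℝ} {x : E} (h : R ≤ ‖x‖) : cone R x = 0 := max_eq_left (by linarith)

variable {E : Type*} [NormedAddCommGroup E] [InnerProductSpace ℝ E]

lemma hasCompactSupport_cone [FiniteDimensional ℝ E] (R : ℝ) :
    HasCompactSupport (cone R : E → ℝ) := by
  refine HasCompactSupport.intro (isCompact_closedBall (0 : E) R) fun x hx => cone_of_le ?_
  rw [Metric.mem_closedBall, dist_zero_right, not_le] at hx
  exact hx.le

lemma lineDeriv_cone_of_gt {R : ℝ} {x : E} (h : R < ‖x‖) (v : E) :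
    lineDeriv ℝ (cone R) x v = 0 := by
  have hev : (fun t : ℝ => cone R (x + t • v)) =ᶠ[𝓝 0] fun _ => (0 : ℝ) := by
    have hc : Continuous fun t : ℝ => ‖x + t • v‖ := by fun_prop
    have : ∀ᶠ t in 𝓝 (0 : ℝ), R < ‖x + t • v‖ :=
      (continuous_const.tendsto _).eventually_lt (hc.tendsto 0) (by simpa using h)
    exact this.mono fun t ht => cone_of_le ht.le
  rw [lineDeriv, hev.deriv_eq, deriv_const]

/-- Inside the ball the cone has gradient `-x / ‖x‖`. The direction is `-v` because integration by
parts puts the derivative on the cone with that sign. -/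
lemma lineDeriv_cone_of_lt {R : ℝ} {x : E} (h0 : x ≠ 0) (h : ‖x‖ < R) (v : E) :
    lineDeriv ℝ (cone R) x (-v) = ‖x‖⁻¹ * inner ℝ x v := by
  have hev : (fun t : ℝ => cone R (x + t • (-v))) =ᶠ[𝓝 0] fun t => R - √(‖x + t • (-v)‖ ^ 2) := by
    have hc : Continuous fun t : ℝ => ‖x + t • (-v)‖ := by fun_prop
    have : ∀ᶠ t in 𝓝 (0 : ℝ), ‖x + t • (-v)‖ < R :=
      (hc.tendsto 0).eventually_lt (continuous_const.tendsto _) (by simpa using h)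
    refine this.mono fun t ht => ?_
    simp only [cone]
    rw [Real.sqrt_sq (norm_nonneg _), max_eq_right (by linarith)]
  have hline : HasDerivAt (fun t : ℝ => x + t • (-v)) (-v) 0 := by
    simpa using ((hasDerivAt_id (0 : ℝ)).smul_const (-v)).const_add x
  have hx : ‖x‖ ≠ 0 := norm_ne_zero_iff.2 h0
  have hd := ((hline.norm_sq).sqrt (by simpa using h0)).const_sub R
  rw [lineDeriv, hev.deriv_eq, hd.deriv]
  simp only [zero_smul, add_zero, inner_neg_right]
  rw [Real.sqrt_sq (norm_nonneg _)]
  field_simp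

variable [FiniteDimensional ℝ E] [MeasurableSpace E] [BorelSpace E] [Nontrivial E]

/-- The cone is a compactly supported Lipschitz stand-in for the indicator of the ball. Integration
by parts moves the derivative onto it, where it becomes the radial unit field, and polar coordinates
finish. Differentiating in `R` recovers the indicator. -/
lemma integral_lineDeriv_mul_cone {K : ℝ≥0} {G : E → ℝ} (hG : LipschitzWith K G) (v : E) {R : ℝ}
    (hR : 0 ≤ R) :
    ∫ x, lineDeriv ℝ G x v * cone R x = ∫ r in (0 : ℝ)..R, r ^ (finrank ℝ E - 1) *
      ∫ e : Metric.sphere (0 : E) 1, G (r • (e : E)) * inner ℝ (e : E) v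
        ∂(volume : Measure E).toSphere := by
  set f : E → ℝ := (Metric.ball (0 : E) R).indicator (fun x => ‖x‖⁻¹ * inner ℝ x v * G x) with hf
  rw [hG.integral_lineDeriv_mul_eq (lipschitzWith_cone R) (hasCompactSupport_cone R)]
  have hae : ∀ᵐ x : E, lineDeriv ℝ (cone R) x (-v) * G x = f x := by
    have h1 : ∀ᵐ x : E, x ≠ 0 := by
      simp [ae_iff]
    have h2 : ∀ᵐ x : E, ‖x‖ ≠ R := by
      have := Measure.addHaar_sphere (volume : Measure E) 0 R
      rw [ae_iff]
      convert this using 2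
      ext x; simp
    filter_upwards [h1, h2] with x hx0 hxR
    rcases lt_or_gt_of_ne hxR with h | h
    · rw [lineDeriv_cone_of_lt hx0 h, hf, indicator_of_mem (by simpa using h)]
    · rw [lineDeriv_cone_of_gt h, hf, indicator_of_notMem (by simpa using h.le), zero_mul]
  rw [integral_congr_ae hae]
  have hGc := hG.continuous
  have hfm : Measurable f := by
    refine Measurable.indicator ?_ measurableSet_ball
    have := hGc.measurable
    fun_prop
  have hfint : Integrable f := by
    rw [hf, integrable_indicator_iff measurableSet_ball]
    obtain ⟨B, hB⟩ := (isCompact_closedBall (0 : E) R).exists_bound_of_continuousOn hGc.continuousOn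
    refine Measure.integrableOn_of_bounded (M := ‖v‖ * B) measure_ball_lt_top.ne ?_ ?_
    · have := hGc.measurable
      exact Measurable.aestronglyMeasurable (by fun_prop)
    · refine (ae_restrict_iff' measurableSet_ball).2 (ae_of_all _ fun x hx => ?_)
      rw [norm_mul, norm_mul, norm_inv, norm_norm]
      have h1 : ‖x‖⁻¹ * ‖inner ℝ x v‖ ≤ ‖v‖ := by
        rcases eq_or_ne x 0 with rfl | h0
        · simp
        · rw [inv_mul_le_iff₀ (norm_pos_iff.2 h0)]
          exact norm_inner_le_norm x v
      have h2 := hB x (Metric.ball_subset_closedBall hx)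
      gcongr
  rw [integral_polar _ hfint, intervalIntegral.integral_of_le hR, integral_Ioc_eq_integral_Ioo,
    ← Ioi_inter_Iio, ← setIntegral_indicator measurableSet_Iio]
  refine setIntegral_congr_fun measurableSet_Ioi fun r hr => ?_
  have hr : 0 < r := hr
  have hmem : ∀ e : Metric.sphere (0 : E) 1, r • (e : E) ∈ Metric.ball (0 : E) R ↔ r < R := by
    intro e
    rw [mem_ball_zero_iff, norm_smul, norm_eq_of_mem_sphere, mul_one, Real.norm_of_nonneg hr.le]
  by_cases hrR : r < R
  · rw [indicator_of_mem (show r ∈ Iio R from hrR)]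
    congr 1
    refine integral_congr_ae (ae_of_all _ fun e => ?_)
    simp only [hf]
    rw [indicator_of_mem ((hmem e).2 hrR), norm_smul, norm_eq_of_mem_sphere, mul_one,
      Real.norm_of_nonneg hr.le, real_inner_smul_left, inv_mul_cancel_left₀ hr.ne', mul_comm]
  · rw [indicator_of_notMem (show r ∉ Iio R from hrR)]
    have h0 : ∀ e : Metric.sphere (0 : E) 1, f (r • (e : E)) = 0 := fun e => by
      rw [hf, indicator_of_notMem (mt (hmem e).1 hrR)]
    simp [h0]

/-- The divergence theorem for a Lipschitz function on a ball. -/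
lemma setIntegral_ball_lineDeriv {K : ℝ≥0} {G : E → ℝ} (hG : LipschitzWith K G) (v : E) {R : ℝ}
    (hR : 0 < R) :
    ∫ x in Metric.ball (0 : E) R, lineDeriv ℝ G x v = R ^ (finrank ℝ E - 1) *
      ∫ e : Metric.sphere (0 : E) 1, G (R • (e : E)) * inner ℝ (e : E) v
        ∂(volume : Measure E).toSphere := by
  have hGc := hG.continuous
  set Φ : ℝ → ℝ := fun r => r ^ (finrank ℝ E - 1) *
      ∫ e : Metric.sphere (0 : E) 1, G (r • (e : E)) * inner ℝ (e : E) v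
        ∂(volume : Measure E).toSphere with hΦ
  have hΦc : Continuous Φ := by
    have h1 : Continuous fun r : ℝ => ∫ e : Metric.sphere (0 : E) 1 in univ,
        G (r • (e : E)) * inner ℝ (e : E) v ∂(volume : Measure E).toSphere :=
      continuous_parametric_integral_of_continuous
        (f := fun (r : ℝ) (e : Metric.sphere (0 : E) 1) => G (r • (e : E)) * inner ℝ (e : E) v)
        (by simp only [Function.uncurry_def]; fun_prop) isCompact_univ
    simp only [setIntegral_univ] at h1
    exact (continuous_pow _).mul h1
  -- The cone integral is differentiated in its radius twice: here by the fundamental theorem of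
  -- calculus, below under the integral sign. Uniqueness of the derivative is the divergence
  -- theorem.
  have hderiv1 : HasDerivAt (fun r => ∫ x, lineDeriv ℝ G x v * cone r x) (Φ R) R := by
    have h1 : HasDerivAt (fun u => ∫ r in (0 : ℝ)..u, Φ r) (Φ R) R :=
      intervalIntegral.integral_hasDerivAt_right (hΦc.intervalIntegrable _ _)
        (hΦc.stronglyMeasurableAtFilter _ _) hΦc.continuousAt
    refine h1.congr_of_eventuallyEq ?_
    filter_upwards [lt_mem_nhds hR] with r hr
    exact integral_lineDeriv_mul_cone hG v hr.le
  have hmeas : Measurable fun x => lineDeriv ℝ G x v := measurable_lineDeriv hGc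
  have hbd : ∀ x, ‖lineDeriv ℝ G x v‖ ≤ K * ‖v‖ := fun x =>
    norm_lineDeriv_le_of_lipschitz ℝ hG
  have hconem : ∀ r : ℝ, Measurable (cone r : E → ℝ) := fun r =>
    (lipschitzWith_cone r).continuous.measurable
  have hderiv2 : HasDerivAt (fun r => ∫ x, lineDeriv ℝ G x v * cone r x)
      (∫ x, lineDeriv ℝ G x v * (Metric.ball (0 : E) R).indicator 1 x) R := by
    refine (hasDerivAt_integral_of_dominated_loc_of_lip (s := Metric.ball R 1)
      -- For radii within 1 of `R` all the cones vanish outside this ball.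
      (bound := (Metric.ball (0 : E) (R + 1)).indicator fun _ => K * ‖v‖)
      (Metric.ball_mem_nhds R one_pos) (Eventually.of_forall fun r =>
        (hmeas.mul (hconem r)).aestronglyMeasurable) ?_
      (hmeas.mul (measurable_one.indicator measurableSet_ball)).aestronglyMeasurable ?_ ?_ ?_).2
    · refine Integrable.bdd_mul (c := K * ‖v‖) ?_ hmeas.aestronglyMeasurable (ae_of_all _ hbd)
      exact (lipschitzWith_cone R).continuous.integrable_of_hasCompactSupport
        (hasCompactSupport_cone R)
    · refine ae_of_all _ fun x => LipschitzOnWith.of_dist_le_mul fun r hr r' hr' => ?_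
      rw [Real.dist_eq, Real.dist_eq, Pi.mul_apply, Pi.mul_apply, ← mul_sub, abs_mul, Real.coe_nnabs]
      by_cases hx : x ∈ Metric.ball (0 : E) (R + 1)
      · rw [indicator_of_mem hx, abs_of_nonneg (by positivity : 0 ≤ (K : ℝ) * ‖v‖)]
        refine mul_le_mul (hbd x) ?_ (abs_nonneg _) (by positivity)
        have := abs_max_sub_max_le_abs (r - ‖x‖) (r' - ‖x‖) 0
        rw [sub_sub_sub_cancel_right] at this
        simpa only [cone, max_comm] using this
      · have hx' : R + 1 ≤ ‖x‖ := by simpa using hx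
        rw [Metric.mem_ball, Real.dist_eq, abs_lt] at hr hr'
        rw [cone_of_le (by linarith), cone_of_le (by linarith)]
        simp only [sub_zero, abs_zero, mul_zero]
        positivity
    · exact (integrable_indicator_iff measurableSet_ball).2
        (integrableOn_const measure_ball_lt_top.ne)
    · have h2 : ∀ᵐ x : E, ‖x‖ ≠ R := by
        have := Measure.addHaar_sphere (volume : Measure E) 0 R
        rw [ae_iff]
        convert this using 2
        ext x; simp
      filter_upwards [h2] with x hx
      refine HasDerivAt.const_mul _ ?_
      rcases lt_or_gt_of_ne hx with h | h
      · rw [indicator_of_mem (by simpa using h)]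
        have : HasDerivAt (fun r : ℝ => r - ‖x‖) 1 R := (hasDerivAt_id R).sub_const _
        refine this.congr_of_eventuallyEq ?_
        filter_upwards [lt_mem_nhds h] with r hr
        exact max_eq_right (by linarith)
      · rw [indicator_of_notMem (by simpa using h.le)]
        refine (hasDerivAt_const R (0 : ℝ)).congr_of_eventuallyEq ?_
        filter_upwards [gt_mem_nhds h] with r hr
        exact cone_of_le (le_of_lt hr)
  have := hderiv2.unique hderiv1
  refine Eq.trans ?_ this
  rw [← integral_indicator measurableSet_ball]
  refine integral_congr_ae (ae_of_all _ fun x => ?_)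
  by_cases hx : x ∈ Metric.ball (0 : E) R <;> simp [hx]

/-- The mean over a sphere of a Lipschitz function against the direction is the mean over the ball
of its directional derivative. -/
lemma integral_unifSphere_mul_inner {K : ℝ≥0} {G : E → ℝ} (hG : LipschitzWith K G) (v : E) {R : ℝ}
    (hR : 0 < R) :
    (finrank ℝ E : ℝ) / R * ∫ e, G (R • (e : E)) * inner ℝ (e : E) v ∂(unifSphere E) =
      ⨍ x in Metric.ball (0 : E) R, lineDeriv ℝ G x v := by
  have hd : (0 : ℝ) < finrank ℝ E := by exact_mod_cast finrank_pos
  have hvol : (volume : Measure E).real (Metric.ball 0 R) =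
      R ^ finrank ℝ E * (volume : Measure E).real (Metric.ball 0 1) := by
    have := Measure.addHaar_ball_mul (volume : Measure E) 0 hR.le 1
    rw [mul_one] at this
    rw [measureReal_def, this, ENNReal.toReal_mul, ENNReal.toReal_ofReal (by positivity),
      measureReal_def]
  have hvol1 : 0 < (volume : Measure E).real (Metric.ball 0 1) :=
    ENNReal.toReal_pos (Metric.measure_ball_pos _ _ one_pos).ne' measure_ball_lt_top.ne
  have hpow : R ^ finrank ℝ E = R ^ (finrank ℝ E - 1) * R := by
    rw [← pow_succ, Nat.sub_add_cancel finrank_pos]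
  -- The surface mass is `d` times the volume of the unit ball, which produces the factor `d / R`.
  rw [setAverage_eq, setIntegral_ball_lineDeriv hG v hR, hvol, unifSphere, integral_smul_measure,
    ENNReal.toReal_inv, ← measureReal_def, Measure.toSphere_real_apply_univ, smul_eq_mul,
    smul_eq_mul, hpow]
  field_simp

/-- One-sided version: along a direction in which `G` is convex, the mean increment over the ball
dominates the mean over the sphere. -/
lemma integral_unifSphere_mul_inner_le {K : ℝ≥0} {G : E → ℝ} (hG : LipschitzWith K G) (v : E)
    {R : ℝ} (hR : 0 < R)
    (hconv : ∀ x ∈ Metric.ball (0 : E) R, ConvexOn ℝ (Icc 0 1) fun t : ℝ => G (x + t • v)) :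
    (finrank ℝ E : ℝ) / R * ∫ e, G (R • (e : E)) * inner ℝ (e : E) v ∂(unifSphere E) ≤
      ⨍ x in Metric.ball (0 : E) R, (G (x + v) - G x) := by
  rw [integral_unifSphere_mul_inner hG v hR, setAverage_eq, setAverage_eq]
  refine smul_le_smul_of_nonneg_left ?_ (by positivity)
  have hGc := hG.continuous
  refine setIntegral_mono_on_ae ?_ ?_ measurableSet_ball ?_
  · refine Measure.integrableOn_of_bounded (M := K * ‖v‖) measure_ball_lt_top.ne
      (measurable_lineDeriv hGc).aestronglyMeasurable
      (ae_of_all _ fun x => norm_lineDeriv_le_of_lipschitz ℝ hG)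
  · exact (Continuous.locallyIntegrable (by fun_prop)).integrableOn_isCompact
      (isCompact_closedBall (0 : E) R) |>.mono_set Metric.ball_subset_closedBall
  · filter_upwards [hG.ae_lineDifferentiableAt v] with x hx hxR
    -- The derivative at 0 of a convex function lies below its slope over `[0, 1]`.
    have := (hconv x hxR).le_slope_of_hasDerivAt (left_mem_Icc.2 zero_le_one)
      (right_mem_Icc.2 zero_le_one) zero_lt_one hx.hasLineDerivAt
    simpa [slope_def_field] using this

end Divergence

/-! ### The block structure of the product space -/

section Blocks

variable {dx dy : ℕ}

@[simp] lemma pair_inl (x : EuclideanSpace ℝ (Fin dx)) (y : EuclideanSpace ℝ (Fin dy))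
    (i : Fin dx) : pair x y (Sum.inl i) = x i := rfl

@[simp] lemma pair_inr (x : EuclideanSpace ℝ (Fin dx)) (y : EuclideanSpace ℝ (Fin dy))
    (j : Fin dy) : pair x y (Sum.inr j) = y j := rfl

@[simp] lemma xPart_apply (z : Vec dx dy) (i : Fin dx) : xPart z i = z (Sum.inl i) := rfl

@[simp] lemma yPart_apply (z : Vec dx dy) (j : Fin dy) : yPart z j = z (Sum.inr j) := rfl

@[simp] lemma flipY_inl (z : Vec dx dy) (i : Fin dx) : flipY z (Sum.inl i) = z (Sum.inl i) := rfl

@[simp] lemma flipY_inr (z : Vec dx dy) (j : Fin dy) : flipY z (Sum.inr j) = -z (Sum.inr j) := rfl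

@[simp] lemma xPart_pair (x : EuclideanSpace ℝ (Fin dx)) (y : EuclideanSpace ℝ (Fin dy)) :
    xPart (pair x y) = x := rfl

@[simp] lemma yPart_pair (x : EuclideanSpace ℝ (Fin dx)) (y : EuclideanSpace ℝ (Fin dy)) :
    yPart (pair x y) = y := rfl

lemma vec_ext {z w : Vec dx dy} (hx : xPart z = xPart w) (hy : yPart z = yPart w) : z = w := by
  ext i
  rcases i with i | j
  · exact congrArg (fun v : EuclideanSpace ℝ (Fin dx) => v i) hx
  · exact congrArg (fun v : EuclideanSpace ℝ (Fin dy) => v j) hy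

lemma pair_xPart_yPart (z : Vec dx dy) : pair (xPart z) (yPart z) = z := vec_ext rfl rfl

@[simp] lemma xPart_add (z w : Vec dx dy) : xPart (z + w) = xPart z + xPart w := rfl

@[simp] lemma yPart_add (z w : Vec dx dy) : yPart (z + w) = yPart z + yPart w := rfl

@[simp] lemma xPart_sub (z w : Vec dx dy) : xPart (z - w) = xPart z - xPart w := rfl

@[simp] lemma yPart_sub (z w : Vec dx dy) : yPart (z - w) = yPart z - yPart w := rfl

@[simp] lemma xPart_smul (r : ℝ) (z : Vec dx dy) : xPart (r • z) = r • xPart z := rfl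

@[simp] lemma yPart_smul (r : ℝ) (z : Vec dx dy) : yPart (r • z) = r • yPart z := rfl

lemma flipY_eq_pair_sub_pair (h : Vec dx dy) :
    flipY h = pair 0 (-yPart h) - pair (-xPart h) 0 := by
  ext i; rcases i with i | j <;> simp

lemma inner_flipY_left (e h : Vec dx dy) : inner ℝ (flipY e) h = inner ℝ e (flipY h) := by
  simp [PiLp.inner_apply]

lemma norm_flipY (h : Vec dx dy) : ‖flipY h‖ = ‖h‖ := by
  simp [EuclideanSpace.norm_eq]

lemma ellNorm_flipY (q : ℝ≥0∞) (hq : 1 ≤ q) (h : Vec dx dy) : ellNorm q (flipY h) = ellNorm q h := by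
  rcases eq_or_ne q ∞ with rfl | hqt
  · rw [ellNorm_top_eq, ellNorm_top_eq]
    congr 1
    funext i
    rcases i with i | j <;> simp
  · have : 0 < q.toReal := ENNReal.toReal_pos (by positivity) hqt
    rw [ellNorm_eq_sum this, ellNorm_eq_sum this]
    simp

lemma continuous_xPart : Continuous (xPart : Vec dx dy → _) := by
  unfold xPart; fun_prop

lemma continuous_yPart : Continuous (yPart : Vec dx dy → _) := by
  unfold yPart; fun_prop

lemma continuous_pair : Continuous fun w : EuclideanSpace ℝ (Fin dx) × EuclideanSpace ℝ (Fin dy) =>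
    (pair w.1 w.2 : Vec dx dy) := by
  unfold pair
  refine (PiLp.continuous_toLp 2 _).comp (continuous_pi fun i => ?_)
  rcases i with i | j <;> simp only [Sum.elim_inl, Sum.elim_inr] <;> fun_prop

lemma continuous_flipY : Continuous (flipY : Vec dx dy → Vec dx dy) :=
  continuous_pair.comp (continuous_xPart.prodMk continuous_yPart.neg)

variable {X : Set (EuclideanSpace ℝ (Fin dx))} {Y : Set (EuclideanSpace ℝ (Fin dy))}

lemma pair_mem_prodSet {x : EuclideanSpace ℝ (Fin dx)} {y : EuclideanSpace ℝ (Fin dy)} (hx : x ∈ X)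
    (hy : y ∈ Y) : pair x y ∈ prodSet X Y := ⟨hx, hy⟩

lemma convex_prodSet (hX : Convex ℝ X) (hY : Convex ℝ Y) : Convex ℝ (prodSet X Y) :=
  fun _ hz _ hw _ _ ha hb hab => ⟨hX hz.1 hw.1 ha hb hab, hY hz.2 hw.2 ha hb hab⟩

lemma isCompact_prodSet (hX : IsCompact X) (hY : IsCompact Y) : IsCompact (prodSet X Y) := by
  have h := (hX.prod hY).image continuous_pair
  convert h using 1
  ext z
  constructor
  · exact fun hz => ⟨(xPart z, yPart z), hz, pair_xPart_yPart z⟩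
  · rintro ⟨w, hw, rfl⟩
    exact hw

end Blocks

/-! ### Hölder's inequality -/

section Holder

variable {ι : Type*} [Fintype ι]

/-- Hölder's inequality for the `ℓ_p`-norms. -/
lemma inner_le_ellNorm_mul_ellNorm {p q : ℝ≥0∞} (hpq : ENNReal.HolderConjugate p q) (hp : p ≠ ∞)
    (s h : EuclideanSpace ℝ ι) : inner ℝ s h ≤ ellNorm q s * ellNorm p h := by
  have h1p : 1 ≤ p := ENNReal.HolderConjugate.one_le p q
  rw [PiLp.inner_apply]
  simp only [RCLike.inner_apply, conj_trivial]
  rcases eq_or_lt_of_le h1p with rfl | h1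
  · have hq : q = ∞ := by
      have := ENNReal.HolderConjugate.inv_add_inv_eq_one 1 q
      rw [inv_one] at this
      have : q⁻¹ = 0 := by
        by_contra hne
        exact (ENNReal.lt_add_right ENNReal.one_ne_top hne).ne' this
      simpa using this
    subst hq
    rw [ellNorm_eq_sum (by simp) h]
    simp only [ENNReal.toReal_one, Real.rpow_one, div_one]
    rw [Finset.mul_sum]
    refine Finset.sum_le_sum fun i _ => ?_
    calc h i * s i ≤ |h i * s i| := le_abs_self _
      _ = |s i| * |h i| := by rw [abs_mul, mul_comm]
      _ ≤ _ := by
        gcongr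
        exact abs_apply_le_ellNorm (by simp) s i
  · have hp1 : 1 < p.toReal := by
      rw [← ENNReal.toReal_one]; exact (ENNReal.toReal_lt_toReal ENNReal.one_ne_top hp).2 h1
    have hr := ENNReal.HolderConjugate.toReal (q := q) hp1
    rw [ellNorm_eq_sum hr.symm.pos, ellNorm_eq_sum hr.pos, mul_comm]
    exact Real.inner_le_Lp_mul_Lq Finset.univ (fun i => h i) (fun i => s i) hr

end Holder

/-! ### Bregman divergence and the prox-operator -/

section Prox

variable {dx dy : ℕ} {Z : Set (Vec dx dy)} {ω : Vec dx dy → ℝ}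

/-- First-order optimality for the minimization of `ω` plus a linear function. -/
lemma fderivWithin_add_nonneg_of_isMinOn (hZ : Convex ℝ Z) (hω : DifferentiableOn ℝ ω Z)
    (ℓ : StrongDual ℝ (Vec dx dy)) {v : Vec dx dy} (hv : v ∈ Z)
    (hmin : IsMinOn (fun w => ω w + ℓ w) Z v) {u : Vec dx dy} (hu : u ∈ Z) :
    0 ≤ fderivWithin ℝ ω Z v (u - v) + ℓ (u - v) := by
  have h1 : HasFDerivWithinAt (fun w => ω w + ℓ w) (fderivWithin ℝ ω Z v + ℓ) Z v :=
    (hω v hv).hasFDerivWithinAt.add ℓ.hasFDerivWithinAt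
  have h2 : u - v ∈ posTangentConeAt Z v :=
    mem_posTangentConeAt_of_segment_subset (by
      rw [add_sub_cancel]; exact hZ.segment_subset hv hu)
  exact (hmin.localize).hasFDerivWithinAt_nonneg h1 h2

/-- The three-point inequality of the prox-operator. -/
lemma IsProx.inner_sub_le (hZ : Convex ℝ Z) (hω : DifferentiableOn ℝ ω Z) {z s v u : Vec dx dy}
    (hv : IsProx Z ω z s v) (hu : u ∈ Z) :
    inner ℝ s (v - u) ≤ bregman Z ω z u - bregman Z ω v u - bregman Z ω z v := by
  have hmin : IsMinOn (fun w => ω w + (innerSL ℝ s - fderivWithin ℝ ω Z z) w) Z v := by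
    intro w hw
    have h := hv.2 hw
    simp only [mem_ofPred_eq, bregman, map_sub] at h
    simp only [mem_ofPred_eq, sub_apply, innerSL_apply_apply]
    linarith
  have h := fderivWithin_add_nonneg_of_isMinOn hZ hω _ hv.1 hmin hu
  simp only [sub_apply, innerSL_apply_apply, map_sub] at h
  simp only [bregman, map_sub, inner_sub_right]
  linarith

variable {p q : ℝ≥0∞}

/-- One step of mirror descent. -/
lemma IsProx.inner_le (hZ : Convex ℝ Z) (hω : IsProxFunction p Z ω)
    (hpq : ENNReal.HolderConjugate p q) (hp : p ≠ ∞) {z s v u : Vec dx dy} (hz : z ∈ Z)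
    (hv : IsProx Z ω z s v) (hu : u ∈ Z) :
    inner ℝ s (z - u) ≤ bregman Z ω z u - bregman Z ω v u + ellNorm q s ^ 2 / 2 := by
  have h1 := hv.inner_sub_le hZ hω.differentiableOn hu
  have h2 := hω.half_sq_le z hz v hv.1
  have h3 := inner_le_ellNorm_mul_ellNorm hpq hp s (z - v)
  have h4 : inner ℝ s (z - u) = inner ℝ s (z - v) + inner ℝ s (v - u) := by
    rw [← inner_add_right, sub_add_sub_cancel]
  -- Young's inequality splits the product of dual norms; the half-square of `z - v` is absorbed by
  -- the divergence from `z` to `v`.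
  nlinarith [sq_nonneg (ellNorm q s - ellNorm p (z - v))]

/-- Quadratic growth of the prox-objective at its minimizer. -/
lemma IsProx.add_le (hZ : Convex ℝ Z) (hω : IsProxFunction p Z ω) {z s v u : Vec dx dy}
    (hv : IsProx Z ω z s v) (hu : u ∈ Z) :
    bregman Z ω z v + inner ℝ s v + ellNorm p (v - u) ^ 2 / 2 ≤
      bregman Z ω z u + inner ℝ s u := by
  have h1 := hv.inner_sub_le hZ hω.differentiableOn hu
  have h2 := hω.half_sq_le v hv.1 u hu
  rw [inner_sub_right] at h1
  linarith

lemma norm_le_ellNorm (h1 : 1 ≤ p) (hp : p ≤ 2) (h : Vec dx dy) : ‖h‖ ≤ ellNorm p h := by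
  rw [← ellNorm_two]; exact ellNorm_anti h1 hp h

/-- The minimizer of a prox-function is unique. -/
lemma IsProxFunction.eq_of_isMinOn (hZ : Convex ℝ Z) (hω : IsProxFunction p Z ω) (h1 : 1 ≤ p)
    (hp : p ≤ 2) {v w : Vec dx dy} (hv : v ∈ Z) (hw : w ∈ Z) (hvm : IsMinOn ω Z v)
    (hwm : IsMinOn ω Z w) : v = w := by
  -- By first-order optimality the divergence from `v` to `w` is at most `ω w - ω v`, which is
  -- nonpositive.
  have h := fderivWithin_add_nonneg_of_isMinOn hZ hω.differentiableOn 0 hv (by simpa using hvm) hw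
  simp only [zero_apply, add_zero] at h
  have h2 := hω.half_sq_le v hv w hw
  have h3 : ω w ≤ ω v := hwm hv
  have h4 := norm_le_ellNorm h1 hp (v - w)
  simp only [bregman] at h2
  have h5 : ellNorm p (v - w) ^ 2 ≤ 0 := by linarith
  have h6 : ‖v - w‖ ≤ 0 := by nlinarith [norm_nonneg (v - w)]
  exact sub_eq_zero.1 (norm_le_zero_iff.1 h6)

variable {D : ℝ}

lemma IsOmegaDiameter.nonneg (hD : IsOmegaDiameter Z ω D) (hne : Z.Nonempty) : 0 ≤ D := by
  obtain ⟨z, hz⟩ := hne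
  exact (Real.sqrt_nonneg _).trans (hD.1 ⟨z, hz, z, hz, rfl⟩)

lemma IsOmegaDiameter.bregman_le (hD : IsOmegaDiameter Z ω D) {z v : Vec dx dy} (hz : z ∈ Z)
    (hv : v ∈ Z) : bregman Z ω z v ≤ D ^ 2 / 2 := by
  have h : √(2 * bregman Z ω z v) ≤ D := hD.1 ⟨z, hz, v, hv, rfl⟩
  have := (Real.sqrt_le_iff.1 h).2
  linarith

lemma IsOmegaDiameter.ellNorm_sub_le (hD : IsOmegaDiameter Z ω D) (hω : IsProxFunction p Z ω)
    {z v : Vec dx dy} (hz : z ∈ Z) (hv : v ∈ Z) : ellNorm p (z - v) ≤ D := by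
  have h1 := hD.bregman_le hz hv
  have h2 := hω.half_sq_le z hz v hv
  exact abs_le_of_sq_le_sq' (by linarith) (hD.nonneg ⟨z, hz⟩) |>.2

lemma IsOmegaDiameter.pos (hD : IsOmegaDiameter Z ω D) (hω : IsProxFunction p Z ω) (h1 : 1 ≤ p)
    (hp : p ≤ 2) (hne : Z.Nontrivial) : 0 < D := by
  obtain ⟨z, hz, v, hv, hzv⟩ := hne
  calc 0 < ‖z - v‖ := norm_pos_iff.2 (sub_ne_zero.2 hzv)
    _ ≤ ellNorm p (z - v) := norm_le_ellNorm h1 hp _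
    _ ≤ D := hD.ellNorm_sub_le hω hz hv

end Prox

/-! ### Measurable dependence of minimizers -/

section MeasurableArgmin

/-- Minimizers with quadratic growth of a measurable family of continuous functions depend
measurably on the parameter. -/
lemma measurable_of_quadratic_growth {Ω E : Type*} [MeasurableSpace Ω] [NormedAddCommGroup E]
    [MeasurableSpace E] [BorelSpace E] [SecondCountableTopology E] {Z : Set E} {Ψ : Ω → E → ℝ}
    {v : Ω → E} (hv : ∀ θ, v θ ∈ Z) (hcont : ∀ θ, ContinuousOn (Ψ θ) Z)
    (hmeas : ∀ w ∈ Z, Measurable fun θ => Ψ θ w) {c : ℝ} (hc : 0 < c)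
    (hgrow : ∀ θ, ∀ w ∈ Z, Ψ θ (v θ) + c * ‖w - v θ‖ ^ 2 ≤ Ψ θ w) : Measurable v := by
  rcases isEmpty_or_nonempty Ω with hΩ | ⟨⟨θ₀⟩⟩
  · exact measurable_of_empty v
  have : Nonempty Z := ⟨⟨v θ₀, hv θ₀⟩⟩
  set u : ℕ → Z := TopologicalSpace.denseSeq Z with hu
  have happrox : ∀ θ, ∀ ε > 0, ∃ n, Ψ θ (u n) < Ψ θ (v θ) + ε := by
    intro θ ε hε
    have hcr := continuousOn_iff_continuous_domRestrict.1 (hcont θ)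
    have hopen : IsOpen {w : Z | Ψ θ w < Ψ θ (v θ) + ε} :=
      isOpen_lt hcr continuous_const
    obtain ⟨n, hn⟩ := (TopologicalSpace.denseRange_denseSeq Z).exists_mem_open hopen
      ⟨⟨v θ, hv θ⟩, by simpa using hε⟩
    exact ⟨n, hn⟩
  have hlow : ∀ θ n, Ψ θ (v θ) ≤ Ψ θ (u n) := fun θ n =>
    le_trans (by have : 0 ≤ c * ‖(u n : E) - v θ‖ ^ 2 := by positivity
                 linarith) (hgrow θ (u n) (u n).2)
  have hinf : ∀ θ, Ψ θ (v θ) = ⨅ n, Ψ θ (u n) := by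
    intro θ
    refine le_antisymm (le_ciInf (hlow θ)) (le_of_forall_pos_le_add fun ε hε => ?_)
    obtain ⟨n, hn⟩ := happrox θ ε hε
    exact (ciInf_le ⟨_, by rintro _ ⟨k, rfl⟩; exact hlow θ k⟩ n).trans hn.le
  have hmin : Measurable fun θ => Ψ θ (v θ) := by
    simp_rw [hinf]
    exact Measurable.iInf fun n => hmeas _ (u n).2
  have hex : ∀ (m : ℕ) (θ : Ω), ∃ n, Ψ θ (u n) < Ψ θ (v θ) + 1 / ((m : ℝ) + 1) := fun m θ =>
    happrox θ _ (by positivity)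
  classical
  -- The first point of a countable dense sequence that is `1 / (m + 1)`-optimal is a measurable
  -- choice; quadratic growth forces these choices to converge to the minimizer.
  have hW : ∀ m : ℕ, Measurable fun θ => (u (Nat.find (hex m θ)) : E) := fun m =>
    Measurable.find (f := fun n _ => (u n : E))
      (p := fun n θ => Ψ θ (u n) < Ψ θ (v θ) + 1 / ((m : ℝ) + 1)) (fun n => measurable_const)
      (fun n => measurableSet_lt (hmeas _ (u n).2) (hmin.add_const _)) (hex m)
  refine measurable_of_tendsto_metrizable hW (tendsto_pi_nhds.2 fun θ => ?_)
  rw [tendsto_iff_norm_sub_tendsto_zero]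
  have hbound : ∀ m : ℕ, ‖(u (Nat.find (hex m θ)) : E) - v θ‖ ≤ √(1 / ((m : ℝ) + 1) / c) := by
    intro m
    have h1 := Nat.find_spec (hex m θ)
    have h2 := hgrow θ _ (u (Nat.find (hex m θ))).2
    refine Real.le_sqrt_of_sq_le ?_
    rw [le_div_iff₀ hc]
    linarith
  refine squeeze_zero (fun m => norm_nonneg _) hbound ?_
  have := (((tendsto_one_div_add_atTop_nhds_zero_nat (𝕜 := ℝ)).div_const c).sqrt)
  simpa using this

/-- The Bregman divergence is measurable in its base point. -/
lemma measurable_bregman {Ω : Type*} [MeasurableSpace Ω] {dx dy : ℕ} {Z : Set (Vec dx dy)}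
    {ω : Vec dx dy → ℝ} (hZ : Convex ℝ Z) (hω : DifferentiableOn ℝ ω Z) {z : Ω → Vec dx dy}
    (hz : Measurable z) (hzZ : ∀ θ, z θ ∈ Z) {w : Vec dx dy} (hw : w ∈ Z) :
    Measurable fun θ => bregman Z ω (z θ) w := by
  have hcomp : ∀ g : Ω → Vec dx dy, Measurable g → (∀ θ, g θ ∈ Z) → Measurable fun θ => ω (g θ) := by
    intro g hg hgZ
    have h1 := (continuousOn_iff_continuous_domRestrict.1 hω.continuousOn).measurable
    exact h1.comp (hg.subtype_mk (h := hgZ))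
  have hmem : ∀ (n : ℕ) (θ : Ω), z θ + (1 / ((n : ℝ) + 1)) • (w - z θ) ∈ Z := by
    intro n θ
    refine hZ.add_smul_sub_mem (hzZ θ) hw ⟨by positivity, ?_⟩
    rw [div_le_one (by positivity)]
    linarith [n.cast_nonneg (α := ℝ)]
  -- The derivative is a limit of difference quotients along the segment towards `w`, which stays in
  -- `Z`, so only values of `ω` on `Z` are used.
  have hlim : ∀ θ, Tendsto (fun n : ℕ => ((n : ℝ) + 1) •
      (ω (z θ + (1 / ((n : ℝ) + 1)) • (w - z θ)) - ω (z θ))) atTop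
      (𝓝 (fderivWithin ℝ ω Z (z θ) (w - z θ))) := by
    intro θ
    refine (hω (z θ) (hzZ θ)).hasFDerivWithinAt.lim ?_ (Eventually.of_forall fun n => hmem n θ) ?_
    · simpa using (tendsto_one_div_add_atTop_nhds_zero_nat (𝕜 := ℝ)).smul_const (w - z θ)
    · refine tendsto_const_nhds.congr fun n => ?_
      have : (n : ℝ) + 1 ≠ 0 := by positivity
      rw [smul_smul, mul_one_div_cancel this, one_smul]
  have hder : Measurable fun θ => fderivWithin ℝ ω Z (z θ) (w - z θ) := by
    refine measurable_of_tendsto_metrizable (fun n => ?_) (tendsto_pi_nhds.2 hlim)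
    exact ((hcomp _ (by fun_prop) (hmem n)).sub (hcomp _ hz hzZ)).const_smul ((n : ℝ) + 1)
  exact ((measurable_const.sub (hcomp _ hz hzZ))).sub hder

end MeasurableArgmin

/-! ### Spherical averages and convex-concave increments -/

section SphereGradient

variable {E : Type*} [NormedAddCommGroup E] [InnerProductSpace ℝ E] [FiniteDimensional ℝ E]
  [MeasurableSpace E] [BorelSpace E] [Nontrivial E]

lemma integrable_unifSphere_of_continuous {g : Metric.sphere (0 : E) 1 → ℝ} (hg : Continuous g) :
    Integrable g (unifSphere E) := by
  obtain ⟨B, hB⟩ := isCompact_univ.exists_bound_of_continuousOn hg.continuousOn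
  exact Integrable.of_bound hg.measurable.aestronglyMeasurable B (ae_of_all _ fun e => hB e (mem_univ e))

/-- If `G` is convex in the direction `v` and concave in the direction `w` near the origin, then
its gradient averaged over a sphere, tested against `w - v`, controls `G w - G v`. -/
lemma sub_le_integral_unifSphere_mul_inner {K : ℝ≥0} {G : E → ℝ} (hG : LipschitzWith K G)
    (v w : E) {R : ℝ} (hR : 0 < R)
    (hv : ∀ x ∈ Metric.ball (0 : E) R, ConvexOn ℝ (Icc 0 1) fun t : ℝ => G (x + t • v))
    (hw : ∀ x ∈ Metric.ball (0 : E) R, ConcaveOn ℝ (Icc 0 1) fun t : ℝ => G (x + t • w)) :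
    G w - G v - 2 * R * K ≤
      (finrank ℝ E : ℝ) / R * ∫ e, G (R • (e : E)) * inner ℝ (e : E) (w - v) ∂(unifSphere E) := by
  have hGc := hG.continuous
  have h1 := integral_unifSphere_mul_inner_le hG v hR hv
  have h2 := integral_unifSphere_mul_inner_le (G := fun x => -G x) hG.neg w hR
    (fun x hx => (hw x hx).neg)
  have hvol : 0 < (volume : Measure E).real (Metric.ball 0 R) :=
    ENNReal.toReal_pos (Metric.measure_ball_pos _ _ hR).ne' measure_ball_lt_top.ne
  have hint : ∀ {g : E → ℝ}, Continuous g → IntegrableOn g (Metric.ball (0 : E) R) := fun hg =>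
    (hg.locallyIntegrable.integrableOn_isCompact (isCompact_closedBall (0 : E) R)).mono_set
      Metric.ball_subset_closedBall
  -- The terms `G x` cancel between the two increments, so only the shifts at `v` and at `w` are
  -- paid for, each at most `R * K`.
  have h3 : (⨍ x in Metric.ball (0 : E) R, (G (x + v) - G x)) +
      (⨍ x in Metric.ball (0 : E) R, (-G (x + w) - -G x)) ≤ G v - G w + 2 * R * K := by
    rw [setAverage_eq, setAverage_eq, ← smul_add,
      ← integral_add (hint (by fun_prop)) (hint (by fun_prop)), smul_eq_mul, inv_mul_le_iff₀ hvol]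
    have hb : ∀ x ∈ Metric.ball (0 : E) R,
        (G (x + v) - G x) + (-G (x + w) - -G x) ≤ G v - G w + 2 * R * K := by
      intro x hx
      have hx' : ‖x‖ ≤ R := (mem_ball_zero_iff.1 hx).le
      have a1 := hG.dist_le_mul (x + v) v
      have a2 := hG.dist_le_mul (x + w) w
      rw [Real.dist_eq, dist_eq_norm, add_sub_cancel_right] at a1 a2
      have a3 := (abs_le.1 a1).2
      have a4 := (abs_le.1 a2).1
      have a5 : (K : ℝ) * ‖x‖ ≤ K * R := by gcongr
      linarith
    calc ∫ x in Metric.ball (0 : E) R, ((G (x + v) - G x) + (-G (x + w) - -G x))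
        ≤ ∫ _ in Metric.ball (0 : E) R, (G v - G w + 2 * R * K) :=
          setIntegral_mono_on (hint (by fun_prop)) (hint (by fun_prop)) measurableSet_ball hb
      _ = _ := by rw [setIntegral_const, smul_eq_mul]
  have h4 : ∫ e, G (R • (e : E)) * inner ℝ (e : E) (w - v) ∂(unifSphere E) =
      ∫ e, G (R • (e : E)) * inner ℝ (e : E) w ∂(unifSphere E) -
        ∫ e, G (R • (e : E)) * inner ℝ (e : E) v ∂(unifSphere E) := by
    rw [← integral_sub (integrable_unifSphere_of_continuous (by fun_prop))
      (integrable_unifSphere_of_continuous (by fun_prop))]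
    simp only [inner_sub_right, mul_sub]
  simp only [neg_mul, integral_neg, mul_neg] at h2
  rw [h4, mul_sub]
  linarith

/-- The two-point form of the mean of a function against the direction. -/
lemma integral_unifSphere_two_point {G : E → ℝ} (hG : Continuous G) (v : E) (R : ℝ) :
    ∫ e, (G (R • (e : E)) - G (-(R • (e : E)))) * inner ℝ (e : E) v ∂(unifSphere E) =
      2 * ∫ e, G (R • (e : E)) * inner ℝ (e : E) v ∂(unifSphere E) := by
  have h := (measurePreserving_neg_unifSphere (E := E)).integral_comp
    (Homeomorph.neg (Metric.sphere (0 : E) 1)).measurableEmbedding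
    (fun e => G (R • (e : E)) * inner ℝ (e : E) v)
  simp only [coe_neg_sphere, smul_neg, inner_neg_left, mul_neg, integral_neg] at h
  simp only [sub_mul]
  rw [integral_sub (integrable_unifSphere_of_continuous (by fun_prop))
    (integrable_unifSphere_of_continuous (by fun_prop)), two_mul, sub_eq_add_neg, h]

end SphereGradient

/-! ### Two-point differences: second moment and measurability -/

section Oracle

variable {dx dy : ℕ} {Z : Set (Vec dx dy)} {τ : ℝ}

lemma add_smul_mem_cthickening {z e : Vec dx dy} (hz : z ∈ Z) (hτ : 0 ≤ τ) (he : ‖e‖ ≤ 1) :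
    z + τ • e ∈ Metric.cthickening τ Z := by
  refine Metric.mem_cthickening_of_dist_le _ z _ _ hz ?_
  rw [dist_eq_norm, add_sub_cancel_left, norm_smul, Real.norm_of_nonneg hτ]
  exact mul_le_of_le_one_right hτ he

lemma sub_smul_mem_cthickening {z e : Vec dx dy} (hz : z ∈ Z) (hτ : 0 ≤ τ) (he : ‖e‖ ≤ 1) :
    z - τ • e ∈ Metric.cthickening τ Z := by
  have := add_smul_mem_cthickening (e := -e) hz hτ (by rwa [norm_neg])
  rwa [smul_neg, ← sub_eq_add_neg] at this

/-- The second moment of the two-point difference of an `ℓ`-Lipschitz function, weighted by the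
`ℓ_q`-norm of the direction. -/
lemma lintegral_two_point_sq_le [Nontrivial (Vec dx dy)] {q : ℝ≥0∞} (hq : 1 ≤ q) {a : ℝ}
    (ha : sphereMoment dx dy q ≤ a ^ 2) (hτ : 0 < τ) {z : Vec dx dy} (hz : z ∈ Z)
    {h : Vec dx dy → ℝ} {l : ℝ}
    (hl : ∀ x ∈ Metric.cthickening τ Z, ∀ y ∈ Metric.cthickening τ Z, |h x - h y| ≤ l * ‖x - y‖) :
    ∫⁻ e : USphere dx dy, ENNReal.ofReal ((h (z + τ • (e : Vec dx dy)) - h (z - τ • (e : Vec dx dy))) ^ 2 *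
        ellNorm q (e : Vec dx dy) ^ 2) ∂(sphereUniform dx dy) ≤
      ENNReal.ofReal (624 * τ ^ 2 * l ^ 2 / ((dx + dy : ℕ) : ℝ) * a ^ 2) := by
  have hd : (0 : ℝ) < ((dx + dy : ℕ) : ℝ) := by
    have : 0 < finrank ℝ (Vec dx dy) := finrank_pos
    simp only [finrank_euclideanSpace, Fintype.card_sum, Fintype.card_fin] at this
    exact_mod_cast this
  have hfr : (finrank ℝ (Vec dx dy) : ℝ) = ((dx + dy : ℕ) : ℝ) := by simp
  set k : Vec dx dy → ℝ := fun e => h (z + τ • e) - h (z - τ • e) with hk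
  have hkL : ∀ x y, ‖x‖ = 1 → ‖y‖ = 1 → |k x - k y| ≤ 2 * τ * l * ‖x - y‖ := by
    intro x y hx hy
    have h1 := hl _ (add_smul_mem_cthickening hz hτ.le hx.le) _
      (add_smul_mem_cthickening hz hτ.le hy.le)
    have h2 := hl _ (sub_smul_mem_cthickening hz hτ.le hx.le) _
      (sub_smul_mem_cthickening hz hτ.le hy.le)
    rw [add_sub_add_left_eq_sub, ← smul_sub, norm_smul, Real.norm_of_nonneg hτ.le] at h1
    rw [sub_sub_sub_cancel_left, ← smul_sub, norm_smul, Real.norm_of_nonneg hτ.le,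
      norm_sub_rev] at h2
    have h3 : k x - k y = (h (z + τ • x) - h (z + τ • y)) - (h (z - τ • x) - h (z - τ • y)) := by
      simp only [hk]; ring
    rw [h3]
    refine (abs_sub _ _).trans ?_
    linarith
  have hkodd : ∀ x, ‖x‖ = 1 → k (-x) = -k x := by
    intro x _
    simp only [hk, smul_neg, sub_neg_eq_add, ← sub_eq_add_neg, neg_sub]
  have h4 := lintegral_pow_four_unifSphere_le hkL hkodd
  have hkc : Continuous fun e : USphere dx dy => k (e : Vec dx dy) := by
    refine LipschitzWith.continuous (K := (2 * τ * l).toNNReal) (LipschitzWith.of_dist_le_mul ?_)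
    intro x y
    rw [Real.dist_eq, Subtype.dist_eq, dist_eq_norm]
    refine (hkL x y (norm_eq_of_mem_sphere x) (norm_eq_of_mem_sphere y)).trans ?_
    gcongr
    exact Real.le_coe_toNNReal _
  have hNc : Continuous fun e : USphere dx dy => ellNorm q (e : Vec dx dy) :=
    (continuous_ellNorm hq).comp continuous_subtype_val
  have hkm := hkc.measurable
  have hNm := hNc.measurable
  have hN4 : ∫⁻ e : USphere dx dy, ENNReal.ofReal (ellNorm q (e : Vec dx dy) ^ 4)
      ∂(unifSphere (Vec dx dy)) ≤ ENNReal.ofReal (a ^ 4) := by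
    have hNi : Integrable (fun e : USphere dx dy => ellNorm q (e : Vec dx dy) ^ 4)
        (unifSphere (Vec dx dy)) := integrable_unifSphere_of_continuous (hNc.pow 4)
    rw [← ofReal_integral_eq_lintegral_ofReal hNi
      (ae_of_all _ fun e => pow_nonneg (ellNorm_nonneg _ _) 4)]
    refine ENNReal.ofReal_le_ofReal ?_
    have := (Real.sqrt_le_iff.1 ha).2
    rw [← pow_mul] at this
    exact this
  -- Cauchy–Schwarz separates the difference from the norm of the direction. The constant 624 is
  -- fixed by `24300 * 2 ^ 4 = 388800 ≤ 624 ^ 2`.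
  have hCS := ENNReal.lintegral_mul_le_Lp_mul_Lq (unifSphere (Vec dx dy))
    Real.HolderConjugate.two_two
    (f := fun e => ENNReal.ofReal (k e ^ 2)) (g := fun e => ENNReal.ofReal (ellNorm q (e : Vec dx dy) ^ 2))
    (hkm.pow_const 2).ennreal_ofReal.aemeasurable (hNm.pow_const 2).ennreal_ofReal.aemeasurable
  have hpow : ∀ b : ℝ, ENNReal.ofReal (b ^ 2) ^ (2 : ℝ) = ENNReal.ofReal (b ^ 4) := by
    intro b
    rw [show (2 : ℝ) = ((2 : ℕ) : ℝ) by norm_num, ENNReal.rpow_natCast,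
      ← ENNReal.ofReal_pow (by positivity), ← pow_mul]
  simp only [Pi.mul_apply, hpow, ← ENNReal.ofReal_mul (sq_nonneg _)] at hCS
  rw [hfr] at h4
  refine hCS.trans ?_
  rw [← ENNReal.mul_rpow_of_nonneg _ _ (by norm_num)]
  calc _ ≤ (ENNReal.ofReal (24300 * (2 * τ * l) ^ 4 / ((dx + dy : ℕ) : ℝ) ^ 2) *
        ENNReal.ofReal (a ^ 4)) ^ (1 / 2 : ℝ) := by gcongr
    _ ≤ (ENNReal.ofReal (624 * τ ^ 2 * l ^ 2 / ((dx + dy : ℕ) : ℝ) * a ^ 2) ^ (2 : ℕ)) ^ (1 / 2 : ℝ) := by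
        rw [← ENNReal.ofReal_mul (by positivity), ← ENNReal.ofReal_pow (by positivity)]
        gcongr ?_ ^ _
        refine ENNReal.ofReal_le_ofReal ?_
        have e1 : 24300 * (2 * τ * l) ^ 4 / ((dx + dy : ℕ) : ℝ) ^ 2 * a ^ 4 =
            388800 * (τ ^ 2 * l ^ 2 / ((dx + dy : ℕ) : ℝ) * a ^ 2) ^ 2 := by ring
        have e2 : (624 * τ ^ 2 * l ^ 2 / ((dx + dy : ℕ) : ℝ) * a ^ 2) ^ 2 =
            389376 * (τ ^ 2 * l ^ 2 / ((dx + dy : ℕ) : ℝ) * a ^ 2) ^ 2 := by ring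
        rw [e1, e2]
        gcongr
        norm_num
    _ = _ := by
        rw [← ENNReal.rpow_natCast, ← ENNReal.rpow_mul]
        norm_num

/-- A Carathéodory function on a closed set, extended by zero, is jointly measurable. -/
lemma measurable_indicator_of_continuousOn {E Ξ : Type*} [MeasurableSpace Ξ] [NormedAddCommGroup E]
    [MeasurableSpace E] [BorelSpace E] [SecondCountableTopology E] {U : Set E} (hU : IsClosed U)
    {f : E → Ξ → ℝ} (hc : ∀ s, ContinuousOn (fun w => f w s) U) (hm : ∀ w ∈ U, Measurable (f w)) :
    Measurable fun x : E × Ξ => U.indicator (fun w => f w x.2) x.1 := by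
  classical
  have h1 : Measurable (Function.uncurry fun (w : U) (s : Ξ) => f w s) :=
    measurable_uncurry_of_continuous_of_measurable
      (fun s => continuousOn_iff_continuous_domRestrict.1 (hc s)) (fun w => hm w w.2)
  set S : Set (E × Ξ) := Prod.fst ⁻¹' U with hS
  have hSm : MeasurableSet S := measurable_fst hU.measurableSet
  have h2 : Measurable fun x : S => f (x : E × Ξ).1 (x : E × Ξ).2 :=
    h1.comp (((measurable_fst.comp measurable_subtype_coe).subtype_mk (h := fun x : S => x.2)).prodMk
      (measurable_snd.comp measurable_subtype_coe))
  have h3 := Measurable.dite (s := S) h2 (g := fun _ => (0 : ℝ)) measurable_const hSm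
  convert h3 using 2 with x
  by_cases hx : x.1 ∈ U
  · rw [indicator_of_mem hx, dif_pos (show x ∈ S from hx)]
  · rw [indicator_of_notMem hx, dif_neg (show x ∉ S from hx)]

/-- Supplies the measurability of a Lipschitz noise, which is then not assumed separately. -/
lemma measurable_indicator_of_lipschitz {E : Type*} [NormedAddCommGroup E]
    [MeasurableSpace E] [BorelSpace E] [SecondCountableTopology E] {U : Set E} (hU : IsClosed U)
    {h : E → ℝ} {l : ℝ} (hl : ∀ x ∈ U, ∀ y ∈ U, |h x - h y| ≤ l * ‖x - y‖) :
    Measurable (U.indicator h) := by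
  have hc : ContinuousOn h U := by
    refine LipschitzOnWith.continuousOn (K := l.toNNReal) (LipschitzOnWith.of_dist_le_mul ?_)
    intro x hx y hy
    rw [Real.dist_eq, dist_eq_norm]
    refine (hl x hx y hy).trans ?_
    gcongr
    exact Real.le_coe_toNNReal _
  have := measurable_indicator_of_continuousOn (Ξ := Unit) hU (f := fun w _ => h w) (fun _ => hc)
    (fun w _ => measurable_const)
  exact this.comp (measurable_id.prodMk measurable_const : Measurable fun x : E => (x, ()))

end Oracle

/-! ### The saddle gap at a fixed point -/

section Gap

variable {dx dy : ℕ} {X : Set (EuclideanSpace ℝ (Fin dx))} {Y : Set (EuclideanSpace ℝ (Fin dy))}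
  {τ M : ℝ} {F : Vec dx dy → ℝ}

lemma add_mem_cthickening {z x : Vec dx dy} {Z : Set (Vec dx dy)} (hz : z ∈ Z)
    (hx : x ∈ Metric.ball (0 : Vec dx dy) τ) : z + x ∈ Metric.cthickening τ Z := by
  refine Metric.mem_cthickening_of_dist_le _ z _ _ hz ?_
  rw [dist_eq_norm, add_sub_cancel_left]
  exact (mem_ball_zero_iff.1 hx).le

/-- The gap between a point and a competitor is controlled by the mean of the two-point gradient
estimator. -/
lemma gap_le_integral_two_point [Nontrivial (Vec dx dy)] (hX : Convex ℝ X) (hY : Convex ℝ Y)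
    (hτ : 0 < τ) (hM : 0 ≤ M)
    (hF : ∀ x ∈ Metric.cthickening τ (prodSet X Y), ∀ y ∈ Metric.cthickening τ (prodSet X Y),
      |F x - F y| ≤ M * ‖x - y‖)
    (hcc : ConvexConcaveOn (Metric.cthickening τ (prodSet X Y)) F) {z u : Vec dx dy}
    (hz : z ∈ prodSet X Y) (hu : u ∈ prodSet X Y) :
    F (pair (xPart z) (yPart u)) - F (pair (xPart u) (yPart z)) - 2 * τ * M ≤
      ((dx + dy : ℕ) : ℝ) / (2 * τ) * ∫ e : USphere dx dy,
        (F (z + τ • (e : Vec dx dy)) - F (z - τ • (e : Vec dx dy))) *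
          inner ℝ (e : Vec dx dy) (flipY (z - u)) ∂(sphereUniform dx dy) := by
  set Z := prodSet X Y with hZ
  set U := Metric.cthickening τ Z with hU
  have hLip : LipschitzOnWith M.toNNReal F U := LipschitzOnWith.of_dist_le_mul fun x hx y hy => by
    rw [Real.dist_eq, dist_eq_norm, Real.coe_toNNReal _ hM]
    exact hF x hx y hy
  -- The divergence theorem was proved for globally Lipschitz functions. The extension agrees with
  -- `F` at every point that is evaluated below.
  obtain ⟨F', hF', hEq⟩ := hLip.extend_real
  set G : Vec dx dy → ℝ := fun x => F' (z + x) with hG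
  have hGL : LipschitzWith M.toNNReal G :=
    LipschitzWith.of_dist_le_mul fun x y => by
      simpa using hF'.dist_le_mul (z + x) (z + y)
  -- `z + v` takes its `x`-block from `u`, and `z + w` its `y`-block; `w - v` is exactly `flipY (z -
  -- u)`, which explains the sign in the estimator.
  set v : Vec dx dy := pair (-xPart (z - u)) 0 with hv
  set w : Vec dx dy := pair 0 (-yPart (z - u)) with hw
  have hmemv : ∀ t ∈ Icc (0 : ℝ) 1, z + t • v ∈ Z := by
    intro t ht
    refine ⟨?_, ?_⟩
    · have := hX.add_smul_sub_mem hz.1 hu.1 ht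
      simpa [hv] using this
    · simpa [hv] using hz.2
  have hmemw : ∀ t ∈ Icc (0 : ℝ) 1, z + t • w ∈ Z := by
    intro t ht
    refine ⟨?_, ?_⟩
    · simpa [hw] using hz.1
    · have := hY.add_smul_sub_mem hz.2 hu.2 ht
      simpa [hw] using this
  have hconv : ∀ x ∈ Metric.ball (0 : Vec dx dy) τ,
      ConvexOn ℝ (Icc 0 1) fun t : ℝ => G (x + t • v) := by
    intro x hx
    have hrepr : ∀ t : ℝ, z + (x + t • v) =
        pair (AffineMap.lineMap (xPart (z + x)) (xPart (z + x + v)) t) (yPart (z + x)) := by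
      intro t
      refine vec_ext ?_ ?_
      · simp [hv, AffineMap.lineMap_apply]; abel
      · simp [hv]
    have hmem : ∀ t ∈ Icc (0 : ℝ) 1, z + (x + t • v) ∈ U := by
      intro t ht
      have := add_mem_cthickening (hmemv t ht) hx
      rwa [add_assoc, add_comm (t • v)] at this
    have h1 := ((hcc.1 (yPart (z + x))).comp_affineMap
      (AffineMap.lineMap (xPart (z + x)) (xPart (z + x + v)))).subset
        (fun t ht => show pair (AffineMap.lineMap (xPart (z + x)) (xPart (z + x + v)) t)
          (yPart (z + x)) ∈ U by rw [← hrepr]; exact hmem t ht) (convex_Icc 0 1)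
    refine h1.congr fun t ht => ?_
    simp only [Function.comp_apply, hG]
    rw [← hrepr, hEq (hmem t ht)]
  have hconc : ∀ x ∈ Metric.ball (0 : Vec dx dy) τ,
      ConcaveOn ℝ (Icc 0 1) fun t : ℝ => G (x + t • w) := by
    intro x hx
    have hrepr : ∀ t : ℝ, z + (x + t • w) =
        pair (xPart (z + x)) (AffineMap.lineMap (yPart (z + x)) (yPart (z + x + w)) t) := by
      intro t
      refine vec_ext ?_ ?_
      · simp [hw]
      · simp [hw, AffineMap.lineMap_apply]; abel
    have hmem : ∀ t ∈ Icc (0 : ℝ) 1, z + (x + t • w) ∈ U := by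
      intro t ht
      have := add_mem_cthickening (hmemw t ht) hx
      rwa [add_assoc, add_comm (t • w)] at this
    have h1 := ((hcc.2 (xPart (z + x))).comp_affineMap
      (AffineMap.lineMap (yPart (z + x)) (yPart (z + x + w)))).subset
        (fun t ht => show pair (xPart (z + x)) (AffineMap.lineMap (yPart (z + x))
          (yPart (z + x + w)) t) ∈ U by rw [← hrepr]; exact hmem t ht) (convex_Icc 0 1)
    refine h1.congr fun t ht => ?_
    simp only [Function.comp_apply, hG]
    rw [← hrepr, hEq (hmem t ht)]
  have hmain := sub_le_integral_unifSphere_mul_inner hGL v w hτ hconv hconc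
  have htwo := integral_unifSphere_two_point hGL.continuous (w - v) τ
  have hsphere : ∫ e : USphere dx dy,
        (F (z + τ • (e : Vec dx dy)) - F (z - τ • (e : Vec dx dy))) *
          inner ℝ (e : Vec dx dy) (flipY (z - u)) ∂(sphereUniform dx dy) =
      2 * ∫ e, G (τ • (e : Vec dx dy)) * inner ℝ (e : Vec dx dy) (w - v)
        ∂(unifSphere (Vec dx dy)) := by
    rw [← htwo]
    refine integral_congr_ae (ae_of_all _ fun e => ?_)
    have he : ‖(e : Vec dx dy)‖ ≤ 1 := (norm_eq_of_mem_sphere e).le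
    simp only [hG, ← sub_eq_add_neg]
    rw [hEq (add_smul_mem_cthickening hz hτ.le he), hEq (sub_smul_mem_cthickening hz hτ.le he),
      flipY_eq_pair_sub_pair]
  have hw1 : G w = F (pair (xPart z) (yPart u)) := by
    have h1 := hmemw 1 (by simp)
    rw [one_smul] at h1
    have h2 : z + w = pair (xPart z) (yPart u) := vec_ext (by simp [hw]) (by simp [hw])
    rw [← h2]
    exact (hEq (Metric.self_subset_cthickening _ h1)).symm
  have hv1 : G v = F (pair (xPart u) (yPart z)) := by
    have h1 := hmemv 1 (by simp)
    rw [one_smul] at h1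
    have h2 : z + v = pair (xPart u) (yPart z) := vec_ext (by simp [hv]) (by simp [hv])
    rw [← h2]
    exact (hEq (Metric.self_subset_cthickening _ h1)).symm
  have hfr : (finrank ℝ (Vec dx dy) : ℝ) = ((dx + dy : ℕ) : ℝ) := by simp
  rw [hw1, hv1, Real.coe_toNNReal _ hM, hfr] at hmain
  rw [hsphere]
  refine hmain.trans (le_of_eq ?_)
  field_simp

end Gap

/-! ### Lipschitz modulus of the oracle and of the objective -/

section Oracle

variable {dx dy : ℕ} {Ξ : Type*} [MeasurableSpace Ξ] {Pξ : Measure Ξ}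
  {U : Set (Vec dx dy)} {f : Vec dx dy → Ξ → ℝ} {M₂ : ℝ}

lemma IsLipschitzOracle.measurable_indicator (hf : IsLipschitzOracle Pξ U f M₂) (hU : IsClosed U) :
    Measurable fun x : Vec dx dy × Ξ => U.indicator (fun w => f w x.2) x.1 := by
  obtain ⟨L, -, -, hlip⟩ := hf.lipschitz
  refine measurable_indicator_of_continuousOn hU (fun s => ?_) hf.measurable
  refine LipschitzOnWith.continuousOn (K := (L s).toNNReal) (LipschitzOnWith.of_dist_le_mul ?_)
  intro x hx y hy
  rw [Real.dist_eq, dist_eq_norm]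
  refine (hlip s x hx y hy).trans ?_
  gcongr
  exact Real.le_coe_toNNReal _

variable [IsProbabilityMeasure Pξ]

/-- A Lipschitz modulus of the oracle, with its moments. -/
lemma IsLipschitzOracle.exists_modulus (hf : IsLipschitzOracle Pξ U f M₂) (hU : U.Nontrivial)
    (hM : 0 ≤ M₂) : ∃ L : Ξ → ℝ, (∀ s, 0 ≤ L s) ∧ Integrable L Pξ ∧ ∫ s, L s ∂Pξ ≤ M₂ ∧
      Integrable (fun s => L s ^ 2) Pξ ∧ ∫ s, L s ^ 2 ∂Pξ ≤ M₂ ^ 2 ∧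
      ∀ s, ∀ z ∈ U, ∀ w ∈ U, |f z s - f w s| ≤ L s * ‖z - w‖ := by
  obtain ⟨L, hL, hL2, hlip⟩ := hf.lipschitz
  obtain ⟨z, hz, w, hw, hzw⟩ := hU
  have hpos : 0 < ‖z - w‖ := norm_pos_iff.2 (sub_ne_zero.2 hzw)
  refine ⟨L, fun s => ?_, hL.integrable (by norm_num), ?_, hL.integrable_sq, hL2, hlip⟩
  · exact nonneg_of_mul_nonneg_left ((abs_nonneg _).trans (hlip s z hz w hw)) hpos
  · have h1 := variance_eq_sub hL
    have h2 := variance_nonneg L Pξ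
    simp only [Pi.pow_apply] at h1
    exact abs_le_of_sq_le_sq' (by linarith) hM |>.2

lemma IsLipschitzOracle.abs_objective_sub_le (hf : IsLipschitzOracle Pξ U f M₂)
    (hU : U.Nontrivial) (hM : 0 ≤ M₂) {z w : Vec dx dy} (hz : z ∈ U) (hw : w ∈ U) :
    |objective Pξ f z - objective Pξ f w| ≤ M₂ * ‖z - w‖ := by
  obtain ⟨L, -, hLi, hL1, -, -, hlip⟩ := hf.exists_modulus hU hM
  rw [objective, objective, ← integral_sub (hf.integrable z hz) (hf.integrable w hw)]
  calc |∫ s, (f z s - f w s) ∂Pξ| ≤ ∫ s, |f z s - f w s| ∂Pξ := abs_integral_le_integral_abs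
    _ ≤ ∫ s, L s * ‖z - w‖ ∂Pξ :=
        integral_mono ((hf.integrable z hz).sub (hf.integrable w hw)).abs (hLi.mul_const _)
          fun s => hlip s z hz w hw
    _ ≤ M₂ * ‖z - w‖ := by
        rw [integral_mul_const]
        gcongr

end Oracle

/-! ### Mean and second moment of the gradient estimator -/

section GradEst

variable {dx dy : ℕ} {Ξ : Type*} {Z : Set (Vec dx dy)} {f : Vec dx dy → Ξ → ℝ} {δ : Vec dx dy → ℝ} {M₂ τ : ℝ}

lemma nontrivial_vec (hdx : 0 < dx) : Nontrivial (Vec dx dy) :=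
  have : Nonempty (Fin dx ⊕ Fin dy) := ⟨Sum.inl ⟨0, hdx⟩⟩
  inferInstance

/-- From a point of `Z` the estimator queries only the `τ`-neighbourhood, so the oracle may be set
to zero elsewhere; this makes it jointly measurable on the whole space. -/
lemma gradEst_congr {φ ψ : Vec dx dy → Ξ → ℝ} {z e : Vec dx dy} {s : Ξ}
    (h : ∀ w ∈ Metric.cthickening τ Z, φ w s = ψ w s) (hz : z ∈ Z) (hτ : 0 ≤ τ) (he : ‖e‖ ≤ 1) :
    gradEst φ τ z s e = gradEst ψ τ z s e := by
  rw [gradEst, gradEst, h _ (add_smul_mem_cthickening hz hτ he),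
    h _ (sub_smul_mem_cthickening hz hτ he)]

/-- The noisy oracle, set to zero away from the set `U`. -/
noncomputable def truncOracle (U : Set (Vec dx dy)) (f : Vec dx dy → Ξ → ℝ) (δ : Vec dx dy → ℝ)
    (w : Vec dx dy) (s : Ξ) : ℝ :=
  U.indicator (fun w => f w s) w + U.indicator δ w

lemma truncOracle_of_mem {U : Set (Vec dx dy)} {w : Vec dx dy} (hw : w ∈ U) (s : Ξ) :
    truncOracle U f δ w s = f w s + δ w := by
  rw [truncOracle, indicator_of_mem hw, indicator_of_mem hw]

/-- The estimator of the truncated oracle as a function of the iterate and of the sample. -/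
noncomputable def stepGrad (U : Set (Vec dx dy)) (f : Vec dx dy → Ξ → ℝ) (δ : Vec dx dy → ℝ)
    (τ : ℝ) (z : Vec dx dy) (x : USphere dx dy × Ξ) : Vec dx dy :=
  gradEst (truncOracle U f δ) τ z x.2 (x.1 : Vec dx dy)

lemma stepGrad_eq (hτ : 0 ≤ τ) {z : Vec dx dy} (hz : z ∈ Z) (x : USphere dx dy × Ξ) :
    stepGrad (Metric.cthickening τ Z) f δ τ z x =
      gradEst (fun w s => f w s + δ w) τ z x.2 (x.1 : Vec dx dy) :=
  gradEst_congr (fun _ hw => truncOracle_of_mem hw _) hz hτ (norm_eq_of_mem_sphere x.1).le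

variable [MeasurableSpace Ξ] {Pξ : Measure Ξ}

lemma measurable_stepGrad
    (hf : IsLipschitzOracle Pξ (Metric.cthickening τ Z) f M₂)
    (hδ : Measurable ((Metric.cthickening τ Z).indicator δ)) :
    Measurable fun y : Vec dx dy × (USphere dx dy × Ξ) =>
      stepGrad (Metric.cthickening τ Z) f δ τ y.1 y.2 := by
  have h1 := hf.measurable_indicator Metric.isClosed_cthickening
  have h2 : Measurable fun x : Vec dx dy × Ξ => truncOracle (Metric.cthickening τ Z) f δ x.1 x.2 :=
    h1.add (hδ.comp measurable_fst)
  unfold stepGrad gradEst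
  have hp : Measurable fun y : Vec dx dy × (USphere dx dy × Ξ) =>
      (y.1 + τ • (y.2.1 : Vec dx dy), y.2.2) := by fun_prop
  have hm : Measurable fun y : Vec dx dy × (USphere dx dy × Ξ) =>
      (y.1 - τ • (y.2.1 : Vec dx dy), y.2.2) := by fun_prop
  have hfl : Measurable fun y : Vec dx dy × (USphere dx dy × Ξ) => flipY (y.2.1 : Vec dx dy) :=
    continuous_flipY.measurable.comp (by fun_prop)
  exact (((h2.comp hp).sub (h2.comp hm)).const_mul _).smul hfl

variable {q : ℝ≥0∞} [IsProbabilityMeasure Pξ]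

/-- The second moment of the gradient estimator. -/
lemma lintegral_ellNorm_stepGrad_sq_le [Nontrivial (Vec dx dy)] (hq : 1 ≤ q) {a : ℝ}
    (ha : sphereMoment dx dy q ≤ a ^ 2) (hτ : 0 < τ) (hM : 0 ≤ M₂) (hZ : Z.Nontrivial)
    (hf : IsLipschitzOracle Pξ (Metric.cthickening τ Z) f M₂) {σ : ℝ} (hσ : 0 ≤ σ) {z : Vec dx dy}
    (hz : z ∈ Z)
    (hδσ : ∫⁻ e : USphere dx dy, ENNReal.ofReal
      ((δ (z + τ • (e : Vec dx dy)) - δ (z - τ • (e : Vec dx dy))) ^ 2 *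
        ellNorm q (e : Vec dx dy) ^ 2) ∂(sphereUniform dx dy) ≤ ENNReal.ofReal σ) :
    ∫⁻ x, ENNReal.ofReal (ellNorm q (stepGrad (Metric.cthickening τ Z) f δ τ z x) ^ 2)
        ∂((sphereUniform dx dy).prod Pξ) ≤
      ENNReal.ofReal (((dx + dy : ℕ) : ℝ) ^ 2 / (2 * τ ^ 2) *
        (624 * τ ^ 2 * M₂ ^ 2 / ((dx + dy : ℕ) : ℝ) * a ^ 2 + σ)) := by
  have : IsProbabilityMeasure (sphereUniform dx dy) :=
    inferInstanceAs (IsProbabilityMeasure (unifSphere (Vec dx dy)))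
  set U := Metric.cthickening τ Z with hU
  set d : ℝ := ((dx + dy : ℕ) : ℝ) with hd
  obtain ⟨L, hL0, -, -, hL2i, hL2, hlip⟩ :=
    hf.exists_modulus (hZ.mono (Metric.self_subset_cthickening Z)) hM
  have hind := hf.measurable_indicator Metric.isClosed_cthickening
  set A : USphere dx dy × Ξ → ℝ := fun x =>
    (U.indicator (fun w => f w x.2) (z + τ • (x.1 : Vec dx dy)) -
      U.indicator (fun w => f w x.2) (z - τ • (x.1 : Vec dx dy))) ^ 2 *
        ellNorm q (x.1 : Vec dx dy) ^ 2 with hA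
  set B : USphere dx dy × Ξ → ℝ := fun x =>
    (δ (z + τ • (x.1 : Vec dx dy)) - δ (z - τ • (x.1 : Vec dx dy))) ^ 2 *
        ellNorm q (x.1 : Vec dx dy) ^ 2 with hB
  have hellm : Measurable fun x : USphere dx dy × Ξ => ellNorm q (x.1 : Vec dx dy) :=
    (continuous_ellNorm hq).measurable.comp (by fun_prop)
  have hAm : Measurable A := by
    have h1 : Measurable fun x : USphere dx dy × Ξ => (z + τ • (x.1 : Vec dx dy), x.2) := by fun_prop
    have h2 : Measurable fun x : USphere dx dy × Ξ => (z - τ • (x.1 : Vec dx dy), x.2) := by fun_prop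
    exact (((hind.comp h1).sub (hind.comp h2)).pow_const 2).mul (hellm.pow_const 2)
  have hpoint : ∀ x : USphere dx dy × Ξ, ellNorm q (stepGrad U f δ τ z x) ^ 2 ≤
      d ^ 2 / (2 * τ ^ 2) * (A x + B x) := by
    intro x
    have hp := add_smul_mem_cthickening hz hτ.le (norm_eq_of_mem_sphere x.1).le
    have hm := sub_smul_mem_cthickening hz hτ.le (norm_eq_of_mem_sphere x.1).le
    rw [stepGrad_eq hτ.le hz, gradEst, ellNorm_smul hq, ellNorm_flipY q hq, mul_pow, sq_abs, hA, hB]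
    simp only
    rw [indicator_of_mem hp, indicator_of_mem hm]
    have h2 : ∀ s t : ℝ, (s + t) ^ 2 ≤ 2 * (s ^ 2 + t ^ 2) := fun s t => by
      nlinarith [sq_nonneg (s - t)]
    set s := f (z + τ • (x.1 : Vec dx dy)) x.2 - f (z - τ • (x.1 : Vec dx dy)) x.2 with hs
    set t := δ (z + τ • (x.1 : Vec dx dy)) - δ (z - τ • (x.1 : Vec dx dy)) with ht
    have e1 : f (z + τ • (x.1 : Vec dx dy)) x.2 + δ (z + τ • (x.1 : Vec dx dy)) -
        (f (z - τ • (x.1 : Vec dx dy)) x.2 + δ (z - τ • (x.1 : Vec dx dy))) = s + t := by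
      rw [hs, ht]; ring
    rw [e1]
    calc (d / (2 * τ) * (s + t)) ^ 2 * ellNorm q (x.1 : Vec dx dy) ^ 2
        = d ^ 2 / (4 * τ ^ 2) * (s + t) ^ 2 * ellNorm q (x.1 : Vec dx dy) ^ 2 := by ring
      _ ≤ d ^ 2 / (4 * τ ^ 2) * (2 * (s ^ 2 + t ^ 2)) * ellNorm q (x.1 : Vec dx dy) ^ 2 := by
          gcongr
          exact h2 s t
      _ = _ := by ring
  have hAint : ∫⁻ x, ENNReal.ofReal (A x) ∂((sphereUniform dx dy).prod Pξ) ≤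
      ENNReal.ofReal (624 * τ ^ 2 * M₂ ^ 2 / d * a ^ 2) := by
    -- The direction is integrated first: for a frozen sample the oracle is Lipschitz with a fixed
    -- constant, and the random constant is averaged afterwards.
    rw [lintegral_prod_symm' _ hAm.ennreal_ofReal]
    calc ∫⁻ s, ∫⁻ e, ENNReal.ofReal (A (e, s)) ∂(sphereUniform dx dy) ∂Pξ
        ≤ ∫⁻ s, ENNReal.ofReal (624 * τ ^ 2 * L s ^ 2 / d * a ^ 2) ∂Pξ := by
          refine lintegral_mono fun s => ?_
          refine le_trans (le_of_eq ?_)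
            (lintegral_two_point_sq_le hq ha hτ hz (h := fun w => f w s) (hlip s))
          refine lintegral_congr fun e => ?_
          simp only [hA]
          rw [indicator_of_mem (add_smul_mem_cthickening hz hτ.le (norm_eq_of_mem_sphere e).le),
            indicator_of_mem (sub_smul_mem_cthickening hz hτ.le (norm_eq_of_mem_sphere e).le)]
      _ = ENNReal.ofReal (∫ s, 624 * τ ^ 2 * L s ^ 2 / d * a ^ 2 ∂Pξ) := by
          refine (ofReal_integral_eq_lintegral_ofReal ?_ (ae_of_all _ fun s => by positivity)).symm
          exact ((hL2i.const_mul (624 * τ ^ 2)).div_const d).mul_const (a ^ 2)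
      _ ≤ _ := by
          refine ENNReal.ofReal_le_ofReal ?_
          rw [integral_mul_const, integral_div, integral_const_mul]
          gcongr
  have hBint : ∫⁻ x, ENNReal.ofReal (B x) ∂((sphereUniform dx dy).prod Pξ) ≤ ENNReal.ofReal σ := by
    have h : ∫⁻ x, ENNReal.ofReal (B x) ∂((sphereUniform dx dy).prod Pξ) ≤
        ∫⁻ e, ∫⁻ _, ENNReal.ofReal ((δ (z + τ • (e : Vec dx dy)) - δ (z - τ • (e : Vec dx dy))) ^ 2 *
        ellNorm q (e : Vec dx dy) ^ 2) ∂Pξ ∂(sphereUniform dx dy) := lintegral_prod_le _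
    refine h.trans ?_
    simpa using hδσ
  calc ∫⁻ x, ENNReal.ofReal (ellNorm q (stepGrad U f δ τ z x) ^ 2) ∂((sphereUniform dx dy).prod Pξ)
      ≤ ∫⁻ x, ENNReal.ofReal (d ^ 2 / (2 * τ ^ 2)) * (ENNReal.ofReal (A x) + ENNReal.ofReal (B x))
          ∂((sphereUniform dx dy).prod Pξ) := by
        refine lintegral_mono fun x => ?_
        rw [← ENNReal.ofReal_add (by positivity) (by positivity),
          ← ENNReal.ofReal_mul (by positivity)]
        exact ENNReal.ofReal_le_ofReal (hpoint x)
    _ = ENNReal.ofReal (d ^ 2 / (2 * τ ^ 2)) *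
          (∫⁻ x, ENNReal.ofReal (A x) ∂((sphereUniform dx dy).prod Pξ) +
            ∫⁻ x, ENNReal.ofReal (B x) ∂((sphereUniform dx dy).prod Pξ)) := by
        rw [lintegral_const_mul' _ _ (by simp), lintegral_add_left hAm.ennreal_ofReal]
    _ ≤ ENNReal.ofReal (d ^ 2 / (2 * τ ^ 2)) *
          (ENNReal.ofReal (624 * τ ^ 2 * M₂ ^ 2 / d * a ^ 2) + ENNReal.ofReal σ) := by gcongr
    _ = _ := by
        rw [← ENNReal.ofReal_add (by positivity) hσ, ← ENNReal.ofReal_mul (by positivity)]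

variable {X : Set (EuclideanSpace ℝ (Fin dx))} {Y : Set (EuclideanSpace ℝ (Fin dy))}

/-- The mean of the gradient estimator, tested against the direction to a competitor. -/
lemma gap_le_integral_inner_stepGrad [Nontrivial (Vec dx dy)] (hX : Convex ℝ X) (hY : Convex ℝ Y)
    (hne : (prodSet X Y).Nontrivial) (hτ : 0 < τ) (hM : 0 ≤ M₂)
    (hf : IsLipschitzOracle Pξ (Metric.cthickening τ (prodSet X Y)) f M₂)
    (hcc : ConvexConcaveOn (Metric.cthickening τ (prodSet X Y)) (objective Pξ f))
    (hδ : Measurable ((Metric.cthickening τ (prodSet X Y)).indicator δ)) {κ : ℝ}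
    {z u : Vec dx dy} (hz : z ∈ prodSet X Y) (hu : u ∈ prodSet X Y)
    (hκ : ∀ e : USphere dx dy, |δ (z + τ • (e : Vec dx dy)) - δ (z - τ • (e : Vec dx dy))| ≤ κ) :
    objective Pξ f (pair (xPart z) (yPart u)) - objective Pξ f (pair (xPart u) (yPart z)) -
        2 * τ * M₂ - √((dx + dy : ℕ) : ℝ) * κ / (2 * τ) * ‖z - u‖ ≤
      ∫ x, inner ℝ (stepGrad (Metric.cthickening τ (prodSet X Y)) f δ τ z x) (z - u)
        ∂((sphereUniform dx dy).prod Pξ) := by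
  have : IsProbabilityMeasure (sphereUniform dx dy) :=
    inferInstanceAs (IsProbabilityMeasure (unifSphere (Vec dx dy)))
  set U := Metric.cthickening τ (prodSet X Y) with hU
  set d : ℝ := ((dx + dy : ℕ) : ℝ) with hd
  have hfr : (finrank ℝ (Vec dx dy) : ℝ) = d := by simp [hd]
  have hd0 : 0 < d := by
    rw [← hfr]; exact_mod_cast finrank_pos
  have hUne : U.Nontrivial := hne.mono (Metric.self_subset_cthickening _)
  obtain ⟨L, hL0, hLi, hL1, -, -, hlip⟩ := hf.exists_modulus hUne hM
  have hind := hf.measurable_indicator Metric.isClosed_cthickening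
  have hp := fun e : USphere dx dy =>
    add_smul_mem_cthickening hz hτ.le (norm_eq_of_mem_sphere e).le
  have hm := fun e : USphere dx dy =>
    sub_smul_mem_cthickening hz hτ.le (norm_eq_of_mem_sphere e).le
  set v := flipY (z - u) with hv
  have hvn : ‖v‖ = ‖z - u‖ := norm_flipY _
  have hinner : ∀ e : USphere dx dy, |inner ℝ (e : Vec dx dy) v| ≤ ‖v‖ := fun e => by
    have := abs_real_inner_le_norm (e : Vec dx dy) v
    rwa [norm_eq_of_mem_sphere e, one_mul] at this
  have hκ0 : 0 ≤ κ := by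
    obtain ⟨e, he⟩ := exists_norm_eq (Vec dx dy) (zero_le_one' ℝ)
    exact (abs_nonneg _).trans (hκ ⟨e, mem_sphere_zero_iff_norm.2 he⟩)
  set A : USphere dx dy × Ξ → ℝ := fun x =>
    (f (z + τ • (x.1 : Vec dx dy)) x.2 - f (z - τ • (x.1 : Vec dx dy)) x.2) *
      inner ℝ (x.1 : Vec dx dy) v with hA
  set B : USphere dx dy → ℝ := fun e =>
    (δ (z + τ • (e : Vec dx dy)) - δ (z - τ • (e : Vec dx dy))) *
      inner ℝ (e : Vec dx dy) v with hB
  have hAm : Measurable A := by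
    have h1 : Measurable fun x : USphere dx dy × Ξ => (z + τ • (x.1 : Vec dx dy), x.2) := by fun_prop
    have h2 : Measurable fun x : USphere dx dy × Ξ => (z - τ • (x.1 : Vec dx dy), x.2) := by fun_prop
    have h3 : Measurable fun x : USphere dx dy × Ξ => inner ℝ (x.1 : Vec dx dy) v := by fun_prop
    convert ((hind.comp h1).sub (hind.comp h2)).mul h3 using 1
    funext x
    simp only [hA, Pi.mul_apply, Pi.sub_apply, Function.comp_apply]
    rw [indicator_of_mem (hp x.1), indicator_of_mem (hm x.1)]
  have hBm : Measurable B := by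
    have h1 : Measurable fun e : USphere dx dy => z + τ • (e : Vec dx dy) := by fun_prop
    have h2 : Measurable fun e : USphere dx dy => z - τ • (e : Vec dx dy) := by fun_prop
    have h3 : Measurable fun e : USphere dx dy => inner ℝ (e : Vec dx dy) v := by fun_prop
    convert ((hδ.comp h1).sub (hδ.comp h2)).mul h3 using 1
    funext e
    simp only [hB, Pi.mul_apply, Pi.sub_apply, Function.comp_apply]
    rw [indicator_of_mem (hp e), indicator_of_mem (hm e)]
  have hAi : Integrable A ((sphereUniform dx dy).prod Pξ) := by
    have hLi' : Integrable (fun x : USphere dx dy × Ξ => L x.2 * (2 * τ) * ‖v‖)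
        ((sphereUniform dx dy).prod Pξ) :=
      ((hLi.comp_snd (sphereUniform dx dy)).mul_const (2 * τ)).mul_const ‖v‖
    refine hLi'.mono' hAm.aestronglyMeasurable (ae_of_all _ fun x => ?_)
    rw [Real.norm_eq_abs, hA]
    simp only [abs_mul]
    have h1 := hlip x.2 _ (hp x.1) _ (hm x.1)
    have h2 : ‖z + τ • (x.1 : Vec dx dy) - (z - τ • (x.1 : Vec dx dy))‖ = 2 * τ := by
      rw [add_sub_sub_cancel, ← two_smul ℝ, smul_smul, norm_smul, norm_eq_of_mem_sphere, mul_one,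
        Real.norm_of_nonneg (by positivity)]
    rw [h2] at h1
    have := hL0 x.2
    gcongr
    exact hinner x.1
  have hBb : ∀ e, |B e| ≤ κ * |inner ℝ (e : Vec dx dy) v| := fun e => by
    rw [hB]
    simp only [abs_mul]
    gcongr
    exact hκ e
  have hBi : Integrable B (sphereUniform dx dy) := by
    refine Integrable.of_bound hBm.aestronglyMeasurable (κ * ‖v‖) (ae_of_all _ fun e => ?_)
    exact (hBb e).trans (by gcongr; exact hinner e)
  have hABi : Integrable (fun x : USphere dx dy × Ξ => B x.1) ((sphereUniform dx dy).prod Pξ) :=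
    hBi.comp_fst Pξ
  have hsplit : ∫ x, inner ℝ (stepGrad U f δ τ z x) (z - u) ∂((sphereUniform dx dy).prod Pξ) =
      d / (2 * τ) * (∫ x, A x ∂((sphereUniform dx dy).prod Pξ) +
        ∫ e, B e ∂(sphereUniform dx dy)) := by
    have h1 : ∫ x : USphere dx dy × Ξ, B x.1 ∂((sphereUniform dx dy).prod Pξ) =
        ∫ e, B e ∂(sphereUniform dx dy) := by
      rw [integral_fun_fst]
      simp
    rw [← h1, ← integral_add hAi hABi, ← integral_const_mul]
    refine integral_congr_ae (ae_of_all _ fun x => ?_)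
    simp only
    rw [stepGrad_eq hτ.le hz, gradEst, real_inner_smul_left, inner_flipY_left]
    simp only [hA, hB]
    ring
  have hAint : ∫ x, A x ∂((sphereUniform dx dy).prod Pξ) =
      ∫ e : USphere dx dy, (objective Pξ f (z + τ • (e : Vec dx dy)) -
        objective Pξ f (z - τ • (e : Vec dx dy))) * inner ℝ (e : Vec dx dy) v
          ∂(sphereUniform dx dy) := by
    rw [integral_prod _ hAi]
    refine integral_congr_ae (ae_of_all _ fun e => ?_)
    simp only [hA]
    rw [integral_mul_const, integral_sub (hf.integrable _ (hp e)) (hf.integrable _ (hm e))]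
    rfl
  -- Keeping the mean of `|⟨e, v⟩|` instead of its maximum turns the prefactor `d` of the bias into
  -- `√d`.
  have hBint : -(κ * (‖v‖ / √d)) ≤ ∫ e, B e ∂(sphereUniform dx dy) := by
    have h1 : ∫ e, |inner ℝ (e : Vec dx dy) v| ∂(sphereUniform dx dy) ≤ ‖v‖ / √d := by
      rw [← hfr]
      exact integral_abs_inner_unifSphere_le v
    have h2 : Integrable (fun e : USphere dx dy => κ * |inner ℝ (e : Vec dx dy) v|)
        (sphereUniform dx dy) :=
      integrable_unifSphere_of_continuous (by fun_prop)
    have h3 : |∫ e, B e ∂(sphereUniform dx dy)| ≤ κ * (‖v‖ / √d) := by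
      refine abs_integral_le_integral_abs.trans ((integral_mono hBi.abs h2 hBb).trans ?_)
      rw [integral_const_mul]
      gcongr
    exact (abs_le.1 h3).1
  have hgap := gap_le_integral_two_point hX hY hτ hM
    (fun x hx y hy => hf.abs_objective_sub_le hUne hM hx hy) hcc hz hu
  rw [hsplit, mul_add, hAint]
  have hlast : -(√d * κ / (2 * τ) * ‖z - u‖) ≤ d / (2 * τ) * ∫ e, B e ∂(sphereUniform dx dy) := by
    have h1 : -(√d * κ / (2 * τ) * ‖z - u‖) = d / (2 * τ) * (-(κ * (‖v‖ / √d))) := by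
      rw [hvn]
      have hs0 : √d ≠ 0 := (Real.sqrt_pos.2 hd0).ne'
      field_simp
      rw [Real.sq_sqrt hd0.le]
      ring
    rw [h1]
    gcongr
  linarith

end GradEst

/-! ### Integrating out an independent sample -/

section Independence

variable {Ω α β : Type*} [MeasurableSpace Ω] [MeasurableSpace α] [MeasurableSpace β]
  {μ : Measure Ω} [IsProbabilityMeasure μ] {a : Ω → α} {b : Ω → β} {π : Measure β}

lemma map_prodMk_of_indepFun (ha : Measurable a) (hb : Measurable b) (h : IndepFun a b μ)
    (hπ : μ.map b = π) : μ.map (fun θ => (a θ, b θ)) = (μ.map a).prod π := by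
  rw [(indepFun_iff_map_prod_eq_prod_map_map ha.aemeasurable hb.aemeasurable).1 h, hπ]

variable [IsProbabilityMeasure π]

/-- Freezing: it replaces conditioning on the past, so that pointwise estimates at a deterministic
iterate can be used. -/
lemma lintegral_comp_of_indepFun (ha : Measurable a) (hb : Measurable b) (h : IndepFun a b μ)
    (hπ : μ.map b = π) {g : α × β → ℝ≥0∞} (hg : Measurable g) :
    ∫⁻ θ, g (a θ, b θ) ∂μ = ∫⁻ θ, ∫⁻ y, g (a θ, y) ∂π ∂μ := by
  rw [← lintegral_map hg (ha.prodMk hb), map_prodMk_of_indepFun ha hb h hπ,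
    lintegral_prod _ hg.aemeasurable, lintegral_map hg.lintegral_prod_right' ha]

lemma integral_comp_of_indepFun (ha : Measurable a) (hb : Measurable b) (h : IndepFun a b μ)
    (hπ : μ.map b = π) {g : α × β → ℝ} (hg : Measurable g)
    (hi : Integrable (fun θ => g (a θ, b θ)) μ) :
    Integrable (fun θ => ∫ y, g (a θ, y) ∂π) μ ∧
      ∫ θ, g (a θ, b θ) ∂μ = ∫ θ, ∫ y, g (a θ, y) ∂π ∂μ := by
  have hi' : Integrable g ((μ.map a).prod π) := by
    rw [← map_prodMk_of_indepFun ha hb h hπ]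
    exact (integrable_map_measure hg.aestronglyMeasurable (ha.prodMk hb).aemeasurable).2 hi
  have h1 := hi'.integral_prod_left
  refine ⟨(integrable_map_measure h1.aestronglyMeasurable ha.aemeasurable).1 h1, ?_⟩
  rw [← integral_map (φ := fun θ => (a θ, b θ)) (f := g) (ha.prodMk hb).aemeasurable
    hg.aestronglyMeasurable, map_prodMk_of_indepFun ha hb h hπ, integral_prod _ hi',
    integral_map ha.aemeasurable h1.aestronglyMeasurable]

end Independence

/-! ### Regret and measurability of the trajectory -/

section Run

variable {dx dy : ℕ} {Ξ Ω : Type*} {Z : Set (Vec dx dy)} {ω : Vec dx dy → ℝ}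
  {f : Vec dx dy → Ξ → ℝ} {δ : Vec dx dy → ℝ} {M₂ τ D : ℝ} {γ : ℕ → ℝ} {N : ℕ} {p q : ℝ≥0∞}

lemma IsRun.mem {φ : Vec dx dy → Ξ → ℝ} {e : ℕ → USphere dx dy} {ξ : ℕ → Ξ} {z : ℕ → Vec dx dy}
    (h : IsRun Z ω φ τ γ N e ξ z) {k : ℕ} (hk : k ≤ N) : z k ∈ Z := by
  rcases k with _ | k
  · exact h.init_mem
  · exact (h.step k hk).1

/-- The regret bound of mirror descent along a trajectory. -/
lemma IsRun.sum_inner_le {φ : Vec dx dy → Ξ → ℝ} {e : ℕ → USphere dx dy} {ξ : ℕ → Ξ}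
    {z : ℕ → Vec dx dy} (h : IsRun Z ω φ τ γ N e ξ z) (hZ : Convex ℝ Z)
    (hω : IsProxFunction p Z ω) (hpq : ENNReal.HolderConjugate p q) (hp : p ≠ ∞)
    (hD : IsOmegaDiameter Z ω D) {u : Vec dx dy} (hu : u ∈ Z) :
    ∑ k ∈ Finset.range N, inner ℝ (γ k • gradEst φ τ (z k) (ξ k) (e k)) (z k - u) ≤
      D ^ 2 / 2 +
        ∑ k ∈ Finset.range N, ellNorm q (γ k • gradEst φ τ (z k) (ξ k) (e k)) ^ 2 / 2 := by
  -- The one-step inequalities telescope in the divergence to `u`; the final divergence is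
  -- nonnegative and is dropped at the end.
  have key : ∀ n ≤ N,
      ∑ k ∈ Finset.range n, inner ℝ (γ k • gradEst φ τ (z k) (ξ k) (e k)) (z k - u) ≤
      bregman Z ω (z 0) u - bregman Z ω (z n) u +
        ∑ k ∈ Finset.range n, ellNorm q (γ k • gradEst φ τ (z k) (ξ k) (e k)) ^ 2 / 2 := by
    intro n hn
    induction n with
    | zero => simp
    | succ n ih =>
      rw [Finset.sum_range_succ, Finset.sum_range_succ]
      have h1 := ih (by omega)
      have h2 := (h.step n hn).inner_le hZ hω hpq hp (h.mem (by omega)) hu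
      linarith
  have h1 := key N le_rfl
  have h2 := hD.bregman_le h.init_mem hu
  have h3 := hω.half_sq_le _ (h.mem le_rfl) u hu
  have h4 : 0 ≤ ellNorm p (z N - u) ^ 2 / 2 := by positivity
  linarith

variable [MeasurableSpace Ξ] {Pξ : Measure Ξ}
  {e : ℕ → Ω → USphere dx dy} {ξ : ℕ → Ω → Ξ} {z : ℕ → Ω → Vec dx dy}

/-- One step of the method is measurable in the current point and in the sample. -/
lemma measurable_prox_stepGrad [MeasurableSpace Ω] (hZ : Convex ℝ Z) (hω : IsProxFunction p Z ω)
    (h1 : 1 ≤ p) (h2 : p ≤ 2) (hf : IsLipschitzOracle Pξ (Metric.cthickening τ Z) f M₂)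
    (hδ : Measurable ((Metric.cthickening τ Z).indicator δ)) {v w : Ω → Vec dx dy}
    {x : Ω → USphere dx dy × Ξ} {r : ℝ} (hv : Measurable v) (hx : Measurable x)
    (hvZ : ∀ θ, v θ ∈ Z)
    (hprox : ∀ θ, IsProx Z ω (v θ)
      (r • stepGrad (Metric.cthickening τ Z) f δ τ (v θ) (x θ)) (w θ)) : Measurable w := by
  have hgrad : Measurable fun θ => stepGrad (Metric.cthickening τ Z) f δ τ (v θ) (x θ) := by
    have h := (measurable_stepGrad hf hδ).comp (hv.prodMk hx)
    exact h
  refine measurable_of_quadratic_growth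
    (Ψ := fun θ w => bregman Z ω (v θ) w +
      inner ℝ (r • stepGrad (Metric.cthickening τ Z) f δ τ (v θ) (x θ)) w)
    (Z := Z) (fun θ => (hprox θ).1) (fun θ => ?_) (fun w hw => ?_) (c := 1 / 2) (by norm_num)
    (fun θ u hu => ?_)
  · have := hω.differentiableOn.continuousOn
    unfold bregman
    fun_prop
  · exact (measurable_bregman hZ hω.differentiableOn hv hvZ hw).add
      ((hgrad.const_smul r).inner measurable_const)
  · have h3 := (hprox θ).add_le hZ hω hu
    have h4 := norm_le_ellNorm h1 h2 (w θ - u)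
    rw [norm_sub_rev] at h4
    have h5 : ‖u - w θ‖ ^ 2 ≤ ellNorm p (w θ - u) ^ 2 := by gcongr
    linarith

/-- The information carried by the first `k` samples. -/
abbrev pastSamples (e : ℕ → Ω → USphere dx dy) (ξ : ℕ → Ω → Ξ) (k : ℕ) : MeasurableSpace Ω :=
  ⨆ j ∈ Iio k, MeasurableSpace.comap (fun θ => (e j θ, ξ j θ)) inferInstance

lemma pastSamples_mono : Monotone (pastSamples e ξ) := fun _ _ h =>
  biSup_mono fun _ hj => lt_of_lt_of_le hj h

lemma measurable_sample_pastSamples (k : ℕ) :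
    Measurable[pastSamples e ξ (k + 1)] fun θ => (e k θ, ξ k θ) := by
  refine Measurable.of_comap_le ?_
  exact le_iSup₂_of_le k (Nat.lt_succ_self k) le_rfl

/-- Every iterate is a measurable function of the previous samples. -/
lemma measurable_iterate (hZ : Convex ℝ Z) (hω : IsProxFunction p Z ω) (h1 : 1 ≤ p) (h2 : p ≤ 2)
    (hτ : 0 ≤ τ) (hf : IsLipschitzOracle Pξ (Metric.cthickening τ Z) f M₂)
    (hδ : Measurable ((Metric.cthickening τ Z).indicator δ))
    (hrun : ∀ θ, IsRun Z ω (fun w s => f w s + δ w) τ γ N (fun k => e k θ) (fun k => ξ k θ)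
      (fun k => z k θ)) {k : ℕ} (hk : k ≤ N) :
    Measurable[pastSamples e ξ k] (z k) := by
  induction k with
  | zero =>
    have hm : ∀ θ, z 0 θ ∈ Z := fun θ => (hrun θ).init_mem
    have hi : ∀ θ, IsMinOn ω Z (z 0 θ) := fun θ => (hrun θ).init_min
    -- No samples precede the initial point, so it must be constant; uniqueness of the minimizer of
    -- `ω` gives this.
    have hconst : ∀ θ θ', z 0 θ = z 0 θ' := fun θ θ' =>
      hω.eq_of_isMinOn hZ h1 h2 (hm θ) (hm θ') (hi θ) (hi θ')
    exact @measurable_const' (Vec dx dy) Ω _ (pastSamples e ξ 0) (z 0) hconst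
  | succ k ih =>
    have hzk : Measurable[pastSamples e ξ (k + 1)] (z k) :=
      (ih (by omega)).mono (pastSamples_mono (Nat.le_succ k)) le_rfl
    have hXk := measurable_sample_pastSamples (e := e) (ξ := ξ) k
    have hmem : ∀ θ, z k θ ∈ Z := fun θ => (hrun θ).mem (by omega)
    have hprox : ∀ θ, IsProx Z ω (z k θ)
        (γ k • stepGrad (Metric.cthickening τ Z) f δ τ (z k θ) (e k θ, ξ k θ)) (z (k + 1) θ) := by
      intro θ
      rw [stepGrad_eq hτ (hmem θ)]
      exact (hrun θ).step k (by omega)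
    exact @measurable_prox_stepGrad dx dy Ξ Ω Z ω f δ M₂ τ p _ Pξ (pastSamples e ξ (k + 1))
      hZ hω h1 h2 hf hδ (z k) (z (k + 1)) _ (γ k) hzk hXk hmem hprox

variable [MeasurableSpace Ω] {P : Measure Ω}

lemma pastSamples_le (hs : IsSampling P Pξ e ξ) (k : ℕ) :
    pastSamples e ξ k ≤ ‹MeasurableSpace Ω› :=
  iSup₂_le fun j _ => ((hs.measurable_e j).prodMk (hs.measurable_ξ j)).comap_le

/-- A function of the past samples is independent of the next sample. -/
lemma indepFun_of_measurable_pastSamples (hs : IsSampling P Pξ e ξ) {k : ℕ} {v : Ω → Vec dx dy}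
    (hv : Measurable[pastSamples e ξ k] v) : IndepFun v (fun θ => (e k θ, ξ k θ)) P := by
  have h1 := indep_iSup_of_disjoint
    (fun j => ((hs.measurable_e j).prodMk (hs.measurable_ξ j)).comap_le) hs.indep
    (S := Iio k) (T := {k}) (by simp)
  simp only [mem_singleton_iff, iSup_iSup_eq_left] at h1
  exact indep_of_indep_of_le_left h1 hv.comap_le

lemma map_sample (hs : IsSampling P Pξ e ξ) [IsProbabilityMeasure P] (k : ℕ) :
    P.map (fun θ => (e k θ, ξ k θ)) = (sphereUniform dx dy).prod Pξ := by
  rw [(indepFun_iff_map_prod_eq_prod_map_map (hs.measurable_e k).aemeasurable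
    (hs.measurable_ξ k).aemeasurable).1 (hs.indep_pair k), hs.law_e, hs.law_ξ]

end Run

/-! ### The saddle gap as a convex function -/

section SaddleGap

variable {dx dy : ℕ} {X : Set (EuclideanSpace ℝ (Fin dx))} {Y : Set (EuclideanSpace ℝ (Fin dy))}
  {F : Vec dx dy → ℝ} {xs : EuclideanSpace ℝ (Fin dx)} {ys : EuclideanSpace ℝ (Fin dy)}

/-- The gap of the convex-concave function `F` at `w`, relative to the point `(xs, ys)`. -/
def saddleGap (F : Vec dx dy → ℝ) (xs : EuclideanSpace ℝ (Fin dx)) (ys : EuclideanSpace ℝ (Fin dy))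
    (w : Vec dx dy) : ℝ :=
  F (pair (xPart w) ys) - F (pair xs (yPart w))

/-- A convex function of the `x`-block minus a concave function of the `y`-block; this is what lets
Jensen's inequality pass to the averaged output. -/
lemma convexOn_saddleGap {U : Set (Vec dx dy)} (hU : prodSet X Y ⊆ U) (hX : Convex ℝ X)
    (hY : Convex ℝ Y) (hcc : ConvexConcaveOn U F) (hxs : xs ∈ X) (hys : ys ∈ Y) :
    ConvexOn ℝ (prodSet X Y) (saddleGap F xs ys) := by
  refine ⟨convex_prodSet hX hY, fun z hz w hw s t hs ht hst => ?_⟩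
  have h1 := (hcc.1 ys).2 (hU (pair_mem_prodSet hz.1 hys) : pair (xPart z) ys ∈ U)
    (hU (pair_mem_prodSet hw.1 hys) : pair (xPart w) ys ∈ U) hs ht hst
  have h2 := (hcc.2 xs).2 (hU (pair_mem_prodSet hxs hz.2) : pair xs (yPart z) ∈ U)
    (hU (pair_mem_prodSet hxs hw.2) : pair xs (yPart w) ∈ U) hs ht hst
  simp only [smul_eq_mul] at h1 h2
  simp only [saddleGap, xPart_add, xPart_smul, yPart_add, yPart_smul, smul_eq_mul]
  linarith

/-- A Lipschitz extension makes the gap continuous everywhere: measurability of the composition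
follows, and compactness bounds it. -/
lemma integrable_saddleGap_comp {U : Set (Vec dx dy)} {M : ℝ} (hU : prodSet X Y ⊆ U)
    (hX : IsCompact X) (hY : IsCompact Y)
    (hF : ∀ x ∈ U, ∀ y ∈ U, |F x - F y| ≤ M * ‖x - y‖) (hxs : xs ∈ X) (hys : ys ∈ Y)
    {Ω : Type*} [MeasurableSpace Ω] {P : Measure Ω} [IsFiniteMeasure P] {v : Ω → Vec dx dy}
    (hv : Measurable v) (hvZ : ∀ θ, v θ ∈ prodSet X Y) :
    Integrable (fun θ => saddleGap F xs ys (v θ)) P := by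
  have hLip : LipschitzOnWith M.toNNReal F U := LipschitzOnWith.of_dist_le_mul fun x hx y hy => by
    rw [Real.dist_eq, dist_eq_norm]
    refine (hF x hx y hy).trans ?_
    gcongr
    exact Real.le_coe_toNNReal _
  obtain ⟨F', hF', hEq⟩ := hLip.extend_real
  have hc : Continuous (saddleGap F' xs ys) := by
    have h1 : Continuous fun w : Vec dx dy => pair (xPart w) ys :=
      continuous_pair.comp (continuous_xPart.prodMk continuous_const)
    have h2 : Continuous fun w : Vec dx dy => pair xs (yPart w) :=
      continuous_pair.comp (continuous_const.prodMk continuous_yPart)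
    exact (hF'.continuous.comp h1).sub (hF'.continuous.comp h2)
  have hval : ∀ θ, saddleGap F xs ys (v θ) = saddleGap F' xs ys (v θ) := fun θ => by
    rw [saddleGap, saddleGap, hEq (hU (pair_mem_prodSet (hvZ θ).1 hys)),
      hEq (hU (pair_mem_prodSet hxs (hvZ θ).2))]
  simp_rw [hval]
  obtain ⟨C, hC⟩ := (isCompact_prodSet hX hY).exists_bound_of_continuousOn hc.continuousOn
  exact Integrable.of_bound (hc.measurable.comp hv).aestronglyMeasurable C
    (ae_of_all _ fun θ => hC _ (hvZ θ))

end SaddleGap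

/-! ### Convergence in expectation -/

section Convergence

variable {dx dy : ℕ} {Ξ Ω : Type*} [MeasurableSpace Ξ] {Pξ : Measure Ξ} [IsProbabilityMeasure Pξ]
  [MeasurableSpace Ω] {P : Measure Ω} [IsProbabilityMeasure P]
  {f : Vec dx dy → Ξ → ℝ} {δ : Vec dx dy → ℝ} {M₂ M τ D a κ σ : ℝ} {γ : ℕ → ℝ} {N : ℕ}
  {p q : ℝ≥0∞} {ω : Vec dx dy → ℝ}
  {e : ℕ → Ω → USphere dx dy} {ξ : ℕ → Ω → Ξ} {z : ℕ → Ω → Vec dx dy}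

/-- The second-moment bound at a fixed point is uniform over `Z`, so it survives averaging over an
iterate independent of the current sample. -/
lemma integral_sq_ellNorm_stepGrad_le [Nontrivial (Vec dx dy)] {Z : Set (Vec dx dy)}
    (hs : IsSampling P Pξ e ξ) (hq : 1 ≤ q) (ha : sphereMoment dx dy q ≤ a ^ 2) (hτ : 0 < τ)
    (hM₂ : 0 ≤ M₂) (hZ : Z.Nontrivial)
    (hf : IsLipschitzOracle Pξ (Metric.cthickening τ Z) f M₂)
    (hδ : Measurable ((Metric.cthickening τ Z).indicator δ)) (hσ : 0 ≤ σ)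
    (hδσ : ∀ v ∈ Z, ∫⁻ e : USphere dx dy, ENNReal.ofReal
      ((δ (v + τ • (e : Vec dx dy)) - δ (v - τ • (e : Vec dx dy))) ^ 2 *
        ellNorm q (e : Vec dx dy) ^ 2) ∂(sphereUniform dx dy) ≤ ENNReal.ofReal σ)
    (hM : ((dx + dy : ℕ) : ℝ) ^ 2 / (2 * τ ^ 2) *
      (624 * τ ^ 2 * M₂ ^ 2 / ((dx + dy : ℕ) : ℝ) * a ^ 2 + σ) ≤ M ^ 2) {k : ℕ}
    {v : Ω → Vec dx dy} (hv : Measurable v) (hvZ : ∀ θ, v θ ∈ Z)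
    (hind : IndepFun v (fun θ => (e k θ, ξ k θ)) P) :
    Integrable (fun θ => ellNorm q
        (stepGrad (Metric.cthickening τ Z) f δ τ (v θ) (e k θ, ξ k θ)) ^ 2) P ∧
      ∫ θ, ellNorm q (stepGrad (Metric.cthickening τ Z) f δ τ (v θ) (e k θ, ξ k θ)) ^ 2 ∂P
        ≤ M ^ 2 := by
  have : IsProbabilityMeasure (sphereUniform dx dy) :=
    inferInstanceAs (IsProbabilityMeasure (unifSphere (Vec dx dy)))
  set U := Metric.cthickening τ Z with hU
  have hXm : Measurable fun θ => (e k θ, ξ k θ) := (hs.measurable_e k).prodMk (hs.measurable_ξ k)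
  have hg : Measurable fun y : Vec dx dy × (USphere dx dy × Ξ) =>
      ellNorm q (stepGrad U f δ τ y.1 y.2) ^ 2 :=
    ((continuous_ellNorm hq).measurable.comp (measurable_stepGrad hf hδ)).pow_const 2
  have hgm : Measurable fun θ => ellNorm q (stepGrad U f δ τ (v θ) (e k θ, ξ k θ)) ^ 2 := by
    have h := hg.comp (hv.prodMk hXm)
    exact h
  have hle : ∫⁻ θ, ENNReal.ofReal (ellNorm q (stepGrad U f δ τ (v θ) (e k θ, ξ k θ)) ^ 2) ∂P ≤
      ENNReal.ofReal (M ^ 2) := by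
    have h1 := lintegral_comp_of_indepFun hv hXm hind (map_sample hs k) hg.ennreal_ofReal
    rw [h1]
    calc _ ≤ ∫⁻ _, ENNReal.ofReal (M ^ 2) ∂P := by
          refine lintegral_mono fun θ => ?_
          refine (lintegral_ellNorm_stepGrad_sq_le hq ha hτ hM₂ hZ hf hσ (hvZ θ)
            (hδσ _ (hvZ θ))).trans (ENNReal.ofReal_le_ofReal hM)
      _ = _ := by simp
  have hint : Integrable (fun θ => ellNorm q (stepGrad U f δ τ (v θ) (e k θ, ξ k θ)) ^ 2) P := by
    refine ⟨hgm.aestronglyMeasurable, ?_⟩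
    rw [hasFiniteIntegral_iff_ofReal (ae_of_all _ fun θ => by positivity)]
    exact hle.trans_lt ENNReal.ofReal_lt_top
  refine ⟨hint, ?_⟩
  rw [integral_eq_lintegral_of_nonneg_ae (ae_of_all _ fun θ => by positivity)
    hgm.aestronglyMeasurable]
  exact ENNReal.toReal_le_of_le_ofReal (by positivity) hle

variable {X : Set (EuclideanSpace ℝ (Fin dx))} {Y : Set (EuclideanSpace ℝ (Fin dy))}
  {xs : EuclideanSpace ℝ (Fin dx)} {ys : EuclideanSpace ℝ (Fin dy)}

/-- Convergence of zeroth-order stochastic mirror descent under a noise that enters the gradient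
estimator with a bias of size `κ` and a second moment `σ`. -/
theorem integral_saddleGap_output_le [Nontrivial (Vec dx dy)] (hp : p ≤ 2)
    (hpq : ENNReal.HolderConjugate p q) (hX : Convex ℝ X) (hXc : IsCompact X) (hY : Convex ℝ Y)
    (hYc : IsCompact Y) (hne : (prodSet X Y).Nontrivial) (hω : IsProxFunction p (prodSet X Y) ω)
    (hD : IsOmegaDiameter (prodSet X Y) ω D) (hτ : 0 < τ) (hM₂ : 0 < M₂)
    (hf : IsLipschitzOracle Pξ (Metric.cthickening τ (prodSet X Y)) f M₂)
    (hcc : ConvexConcaveOn (Metric.cthickening τ (prodSet X Y)) (objective Pξ f))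
    (hxs : xs ∈ X) (hys : ys ∈ Y) (ha : sphereMoment dx dy q ≤ a ^ 2)
    (hs : IsSampling P Pξ e ξ) (hN : 0 < N)
    (hδ : Measurable ((Metric.cthickening τ (prodSet X Y)).indicator δ)) (hκ0 : 0 ≤ κ)
    (hκ : ∀ v ∈ prodSet X Y, ∀ e : USphere dx dy,
      |δ (v + τ • (e : Vec dx dy)) - δ (v - τ • (e : Vec dx dy))| ≤ κ) (hσ : 0 ≤ σ)
    (hδσ : ∀ v ∈ prodSet X Y, ∫⁻ e : USphere dx dy, ENNReal.ofReal
      ((δ (v + τ • (e : Vec dx dy)) - δ (v - τ • (e : Vec dx dy))) ^ 2 *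
        ellNorm q (e : Vec dx dy) ^ 2) ∂(sphereUniform dx dy) ≤ ENNReal.ofReal σ)
    (hM0 : 0 < M)
    (hM : ((dx + dy : ℕ) : ℝ) ^ 2 / (2 * τ ^ 2) *
      (624 * τ ^ 2 * M₂ ^ 2 / ((dx + dy : ℕ) : ℝ) * a ^ 2 + σ) ≤ M ^ 2)
    (hγ : ∀ k, γ k = D / M * √(2 / (N : ℝ)))
    (hrun : ∀ θ, IsRun (prodSet X Y) ω (fun w s => f w s + δ w) τ γ N
      (fun k => e k θ) (fun k => ξ k θ) (fun k => z k θ)) :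
    Integrable (fun θ => saddleGap (objective Pξ f) xs ys (output γ N (fun k => z k θ))) P ∧
      ∫ θ, saddleGap (objective Pξ f) xs ys (output γ N (fun k => z k θ)) ∂P ≤
        M * D * √(2 / (N : ℝ)) + √((dx + dy : ℕ) : ℝ) * κ / (2 * τ) * D + 2 * τ * M₂ := by
  have : IsProbabilityMeasure (sphereUniform dx dy) :=
    inferInstanceAs (IsProbabilityMeasure (unifSphere (Vec dx dy)))
  have h1p : 1 ≤ p := ENNReal.HolderConjugate.one_le p q
  have h1q : 1 ≤ q := by
    have := hpq.symm
    exact ENNReal.HolderConjugate.one_le q p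
  have hpt : p ≠ ∞ := (hp.trans_lt (by simp)).ne
  set Z := prodSet X Y with hZ
  set U := Metric.cthickening τ Z with hU
  set u : Vec dx dy := pair xs ys with hu
  have hZU : Z ⊆ U := Metric.self_subset_cthickening _
  have hZc : Convex ℝ Z := convex_prodSet hX hY
  have huZ : u ∈ Z := pair_mem_prodSet hxs hys
  have hD0 : 0 < D := hD.pos hω h1p hp hne
  have hN0 : (0 : ℝ) < N := by exact_mod_cast hN
  set s := √(2 / (N : ℝ)) with hsdef
  have hs0 : 0 < s := by positivity
  have hs2 : s ^ 2 = 2 / N := Real.sq_sqrt (by positivity)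
  set g := D / M * s with hg
  have hg0 : 0 < g := by positivity
  set gap := saddleGap (objective Pξ f) xs ys with hgap
  set bias := 2 * τ * M₂ + √((dx + dy : ℕ) : ℝ) * κ / (2 * τ) * D with hbias
  have hmem : ∀ k ≤ N, ∀ θ, z k θ ∈ Z := fun k hk θ => (hrun θ).mem hk
  have hzp : ∀ k ≤ N, Measurable[pastSamples e ξ k] (z k) := fun k hk =>
    measurable_iterate hZc hω h1p hp hτ.le hf hδ hrun hk
  have hzm : ∀ k ≤ N, Measurable (z k) := fun k hk =>
    (hzp k hk).mono (pastSamples_le hs k) le_rfl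
  have hFL : ∀ x ∈ U, ∀ y ∈ U, |objective Pξ f x - objective Pξ f y| ≤ M₂ * ‖x - y‖ :=
    fun x hx y hy => hf.abs_objective_sub_le (hne.mono hZU) hM₂.le hx hy
  have hconv : ConvexOn ℝ Z gap := convexOn_saddleGap hZU hX hY hcc hxs hys
  have hgi : ∀ k ≤ N, Integrable (fun θ => gap (z k θ)) P := fun k hk =>
    integrable_saddleGap_comp hZU hXc hYc hFL hxs hys (hzm k hk) (hmem k hk)
  have hsum : ∑ k ∈ Finset.range N, γ k = N * g := by simp [hγ]
  have hout : ∀ θ, output γ N (fun k => z k θ) ∈ Z := fun θ =>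
    hZc.centerMass_mem (fun k _ => by rw [hγ]; exact hg0.le) (by rw [hsum]; positivity)
      (fun k hk => hmem k (Finset.mem_range.1 hk).le θ)
  have houtm : Measurable fun θ => output γ N (fun k => z k θ) := by
    have h : Measurable fun θ => ∑ k ∈ Finset.range N, γ k • z k θ :=
      Finset.measurable_fun_sum _ fun k hk =>
        (hzm k (Finset.mem_range.1 hk).le).const_smul (γ k)
    exact h.const_smul (∑ k ∈ Finset.range N, γ k)⁻¹
  have houti : Integrable (fun θ => gap (output γ N (fun k => z k θ))) P :=
    integrable_saddleGap_comp hZU hXc hYc hFL hxs hys houtm hout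
  refine ⟨houti, ?_⟩
  have hjensen : ∀ θ, gap (output γ N (fun k => z k θ)) ≤
      (N : ℝ)⁻¹ * ∑ k ∈ Finset.range N, gap (z k θ) := by
    intro θ
    have h := hconv.map_centerMass_le (t := Finset.range N) (w := γ) (p := fun k => z k θ)
      (fun k _ => by rw [hγ]; exact hg0.le) (by rw [hsum]; positivity)
      (fun k hk => hmem k (Finset.mem_range.1 hk).le θ)
    refine h.trans (le_of_eq ?_)
    rw [Finset.centerMass, hsum]
    simp only [hγ, smul_eq_mul, Function.comp_apply]
    rw [← Finset.mul_sum]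
    field_simp
  set G : ℕ → Ω → Vec dx dy := fun k θ => stepGrad U f δ τ (z k θ) (e k θ, ξ k θ) with hG
  have hsq : ∀ k < N, Integrable (fun θ => ellNorm q (G k θ) ^ 2) P ∧
      ∫ θ, ellNorm q (G k θ) ^ 2 ∂P ≤ M ^ 2 := fun k hk =>
    integral_sq_ellNorm_stepGrad_le hs h1q ha hτ hM₂.le hne hf hδ hσ hδσ hM (hzm k hk.le)
      (hmem k hk.le) (indepFun_of_measurable_pastSamples hs (hzp k hk.le))
  have hinn : ∀ k < N, Integrable (fun θ => inner ℝ (G k θ) (z k θ - u)) P ∧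
      ∫ θ, gap (z k θ) ∂P - bias ≤ ∫ θ, inner ℝ (G k θ) (z k θ - u) ∂P := by
    intro k hk
    have hXm : Measurable fun θ => (e k θ, ξ k θ) :=
      (hs.measurable_e k).prodMk (hs.measurable_ξ k)
    have hm : Measurable fun y : Vec dx dy × (USphere dx dy × Ξ) =>
        (inner ℝ (stepGrad U f δ τ y.1 y.2) (y.1 - u) : ℝ) :=
      (measurable_stepGrad hf hδ).inner (by fun_prop)
    have hm' : Measurable fun θ => inner ℝ (G k θ) (z k θ - u) := by
      have h := hm.comp ((hzm k hk.le).prodMk hXm)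
      exact h
    have hi : Integrable (fun θ => inner ℝ (G k θ) (z k θ - u)) P := by
      -- Hölder, the `ℓ_p`-diameter bound `D` and Young dominate the inner product by half of `‖G‖_q
      -- ^ 2 + D ^ 2`.
      refine (((hsq k hk).1.add (integrable_const (D ^ 2))).div_const 2).mono'
        hm'.aestronglyMeasurable (ae_of_all _ fun θ => ?_)
      have h1 := inner_le_ellNorm_mul_ellNorm hpq hpt (G k θ) (z k θ - u)
      have h2 := inner_le_ellNorm_mul_ellNorm hpq hpt (G k θ) (u - z k θ)
      have h3 := hD.ellNorm_sub_le hω (hmem k hk.le θ) huZ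
      have h4 := hD.ellNorm_sub_le hω huZ (hmem k hk.le θ)
      have h5 := ellNorm_nonneg q (G k θ)
      have h6 : inner ℝ (G k θ) (u - z k θ) = -inner ℝ (G k θ) (z k θ - u) := by
        rw [← inner_neg_right, neg_sub]
      have h7 := mul_le_mul_of_nonneg_left h3 h5
      have h8 := mul_le_mul_of_nonneg_left h4 h5
      rw [Real.norm_eq_abs, abs_le]
      simp only [Pi.add_apply]
      constructor <;> nlinarith [sq_nonneg (ellNorm q (G k θ) - D)]
    refine ⟨hi, ?_⟩
    obtain ⟨hi2, heq⟩ := integral_comp_of_indepFun (hzm k hk.le) hXm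
      (indepFun_of_measurable_pastSamples hs (hzp k hk.le)) (map_sample hs k) hm hi
    calc ∫ θ, gap (z k θ) ∂P - bias = ∫ θ, (gap (z k θ) - bias) ∂P := by
          rw [integral_sub (hgi k hk.le) (integrable_const _)]
          simp
      _ ≤ ∫ θ, ∫ x, inner ℝ (stepGrad U f δ τ (z k θ) x) (z k θ - u)
            ∂((sphereUniform dx dy).prod Pξ) ∂P := by
          refine integral_mono ((hgi k hk.le).sub (integrable_const _)) hi2 fun θ => ?_
          have h1 := gap_le_integral_inner_stepGrad hX hY hne hτ hM₂.le hf hcc hδ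
            (hmem k hk.le θ) huZ (hκ _ (hmem k hk.le θ))
          have h2 : ‖z k θ - u‖ ≤ D :=
            (norm_le_ellNorm h1p hp _).trans (hD.ellNorm_sub_le hω (hmem k hk.le θ) huZ)
          have h3 : √((dx + dy : ℕ) : ℝ) * κ / (2 * τ) * ‖z k θ - u‖ ≤
            √((dx + dy : ℕ) : ℝ) * κ / (2 * τ) * D := by gcongr
          have h4 : gap (z k θ) = objective Pξ f (pair (xPart (z k θ)) (yPart u)) -
              objective Pξ f (pair (xPart u) (yPart (z k θ))) := by
            simp [hgap, saddleGap, hu]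
          simp only
          linarith
      _ = _ := heq.symm
  have hregret : ∀ θ, ∑ k ∈ Finset.range N, inner ℝ (G k θ) (z k θ - u) ≤
      D ^ 2 / (2 * g) + g / 2 * ∑ k ∈ Finset.range N, ellNorm q (G k θ) ^ 2 := by
    intro θ
    have h := (hrun θ).sum_inner_le hZc hω hpq hpt hD huZ
    have hGk : ∀ k ∈ Finset.range N,
        gradEst (fun w s => f w s + δ w) τ (z k θ) (ξ k θ) (e k θ) = G k θ := fun k hk =>
      (stepGrad_eq (f := f) (δ := δ) hτ.le (hmem k (Finset.mem_range.1 hk).le θ)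
        (e k θ, ξ k θ)).symm
    have h1 : ∑ k ∈ Finset.range N, inner ℝ
        (γ k • gradEst (fun w s => f w s + δ w) τ (z k θ) (ξ k θ) (e k θ)) (z k θ - u) =
          g * ∑ k ∈ Finset.range N, inner ℝ (G k θ) (z k θ - u) := by
      rw [Finset.mul_sum]
      refine Finset.sum_congr rfl fun k hk => ?_
      rw [hGk k hk, hγ k, real_inner_smul_left]
    have h2 : ∑ k ∈ Finset.range N, ellNorm q
        (γ k • gradEst (fun w s => f w s + δ w) τ (z k θ) (ξ k θ) (e k θ)) ^ 2 / 2 =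
          g ^ 2 / 2 * ∑ k ∈ Finset.range N, ellNorm q (G k θ) ^ 2 := by
      rw [Finset.mul_sum]
      refine Finset.sum_congr rfl fun k hk => ?_
      rw [hGk k hk, hγ k, ellNorm_smul h1q, mul_pow, sq_abs]
      ring
    rw [h1, h2] at h
    refine le_of_mul_le_mul_left (h.trans (le_of_eq ?_)) hg0
    field_simp
  have hmean : ∑ k ∈ Finset.range N, ∫ θ, inner ℝ (G k θ) (z k θ - u) ∂P ≤
      D ^ 2 / (2 * g) + g / 2 * (N * M ^ 2) := by
    have hi2 : Integrable (fun θ => ∑ k ∈ Finset.range N, ellNorm q (G k θ) ^ 2) P :=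
      integrable_finsetSum _ fun k hk => (hsq k (Finset.mem_range.1 hk)).1
    rw [← integral_finsetSum _ fun k hk => (hinn k (Finset.mem_range.1 hk)).1]
    refine (integral_mono
      (integrable_finsetSum _ fun k hk => (hinn k (Finset.mem_range.1 hk)).1)
      ((integrable_const (D ^ 2 / (2 * g))).add (hi2.const_mul (g / 2))) hregret).trans ?_
    simp only [Pi.add_apply]
    rw [integral_add (integrable_const _) (hi2.const_mul _), integral_const_mul,
      integral_finsetSum _ fun k hk => (hsq k (Finset.mem_range.1 hk)).1]
    have h1 : ∑ k ∈ Finset.range N, ∫ θ, ellNorm q (G k θ) ^ 2 ∂P ≤ N * M ^ 2 := by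
      refine (Finset.sum_le_sum fun k hk => (hsq k (Finset.mem_range.1 hk)).2).trans ?_
      simp
    simp only [integral_const, probReal_univ, one_smul]
    gcongr
  have hgapsum : ∑ k ∈ Finset.range N, ∫ θ, gap (z k θ) ∂P ≤
      D ^ 2 / (2 * g) + g / 2 * (N * M ^ 2) + N * bias := by
    have h1 := Finset.sum_le_sum fun k (hk : k ∈ Finset.range N) =>
      (hinn k (Finset.mem_range.1 hk)).2
    rw [Finset.sum_sub_distrib] at h1
    simp only [Finset.sum_const, Finset.card_range, nsmul_eq_mul] at h1
    linarith
  have hfin : ∫ θ, gap (output γ N (fun k => z k θ)) ∂P ≤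
      (N : ℝ)⁻¹ * (D ^ 2 / (2 * g) + g / 2 * (N * M ^ 2) + N * bias) := by
    refine (integral_mono houti ((integrable_finsetSum _ fun k hk =>
      hgi k (Finset.mem_range.1 hk).le).const_mul _) hjensen).trans ?_
    rw [integral_const_mul, integral_finsetSum _ fun k hk => hgi k (Finset.mem_range.1 hk).le]
    gcongr
  -- With `s ^ 2 = 2 / N` the two regret terms are `1/4` and `1/2` of `M * D * s`, so the claimed
  -- bound holds with room to spare.
  have harith : (N : ℝ)⁻¹ * (D ^ 2 / (2 * g) + g / 2 * (N * M ^ 2) + N * bias) =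
      3 / 4 * (M * D * s) + bias := by
    have h1 : (N : ℝ) = 2 / s ^ 2 := by rw [hs2]; field_simp
    rw [hg, h1]
    field_simp
    ring
  have hpos : 0 < M * D * s := by positivity
  rw [harith] at hfin
  linarith

end Convergence

/-! ### Positivity and second moment of `‖e‖_q` -/

section Moments

variable {dx dy : ℕ} [Nontrivial (Vec dx dy)] {p q : ℝ≥0∞}

lemma integrable_ellNorm_pow (hq : 1 ≤ q) (n : ℕ) :
    Integrable (fun e : USphere dx dy => ellNorm q (e : Vec dx dy) ^ n) (sphereUniform dx dy) :=
  integrable_unifSphere_of_continuous (((continuous_ellNorm hq).comp continuous_subtype_val).pow n)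

/-- By Hölder a unit vector cannot have zero `ℓ_q`-norm. Positivity forces `a ^ 2 > 0`, hence `M >
0`, and the step sizes are genuine quotients. -/
lemma sphereMoment_pos (hpq : ENNReal.HolderConjugate p q) (hp : p ≠ ∞) (hq : 1 ≤ q) :
    0 < sphereMoment dx dy q := by
  have : IsProbabilityMeasure (sphereUniform dx dy) :=
    inferInstanceAs (IsProbabilityMeasure (unifSphere (Vec dx dy)))
  have hne : ∀ e : USphere dx dy, ellNorm q (e : Vec dx dy) ≠ 0 := fun e h => by
    have h1 := inner_le_ellNorm_mul_ellNorm hpq hp (e : Vec dx dy) (e : Vec dx dy)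
    rw [h, zero_mul, real_inner_self_eq_norm_sq, norm_eq_of_mem_sphere] at h1
    norm_num at h1
  refine Real.sqrt_pos.2 ((integral_pos_iff_support_of_nonneg (fun e => by positivity)
    (integrable_ellNorm_pow hq 4)).2 ?_)
  have hsupp : Function.support (fun e : USphere dx dy => ellNorm q (e : Vec dx dy) ^ 4) = univ :=
    eq_univ_of_forall fun e => pow_ne_zero 4 (hne e)
  rw [hsupp]
  simp

/-- Integrates the pointwise inequality `t ^ 2 ≤ (t ^ 4 / a ^ 2 + a ^ 2) / 2`. -/
lemma lintegral_ellNorm_sq_le (hq : 1 ≤ q) {a : ℝ} (ha : sphereMoment dx dy q ≤ a ^ 2)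
    (ha0 : 0 < a ^ 2) :
    ∫⁻ e : USphere dx dy, ENNReal.ofReal (ellNorm q (e : Vec dx dy) ^ 2) ∂(sphereUniform dx dy) ≤
      ENNReal.ofReal (a ^ 2) := by
  have : IsProbabilityMeasure (sphereUniform dx dy) :=
    inferInstanceAs (IsProbabilityMeasure (unifSphere (Vec dx dy)))
  rw [← ofReal_integral_eq_lintegral_ofReal (integrable_ellNorm_pow hq 2)
    (ae_of_all _ fun e => by positivity)]
  refine ENNReal.ofReal_le_ofReal ?_
  have h4 : ∫ e : USphere dx dy, ellNorm q (e : Vec dx dy) ^ 4 ∂(sphereUniform dx dy) ≤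
      (a ^ 2) ^ 2 := (Real.sqrt_le_left ha0.le).1 ha
  have hi := (((integrable_ellNorm_pow (dx := dx) (dy := dy) hq 4).div_const (a ^ 2)).add
    (integrable_const (a ^ 2))).div_const 2
  refine (integral_mono (integrable_ellNorm_pow hq 2) hi fun e => ?_).trans ?_
  · have ha1 : a ≠ 0 := pow_ne_zero_iff two_ne_zero |>.1 ha0.ne'
    simp only [Pi.add_apply]
    rw [le_div_iff₀ two_pos, ← sub_nonneg]
    have : ellNorm q (e : Vec dx dy) ^ 4 / a ^ 2 + a ^ 2 - ellNorm q (e : Vec dx dy) ^ 2 * 2 =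
        (ellNorm q (e : Vec dx dy) ^ 2 - a ^ 2) ^ 2 / a ^ 2 := by
      field_simp
      ring
    rw [this]
    positivity
  · simp only [Pi.add_apply]
    rw [integral_div, integral_add ((integrable_ellNorm_pow hq 4).div_const _)
      (integrable_const _), integral_div]
    simp only [integral_const, probReal_univ, one_smul]
    have : (∫ e : USphere dx dy, ellNorm q (e : Vec dx dy) ^ 4 ∂(sphereUniform dx dy)) / a ^ 2 ≤
        a ^ 2 := by
      rw [div_le_iff₀ ha0]
      linarith
    linarith

end Moments

end ZOSMD

theorem theorem1 :
    (∃ c : ℝ, 0 < c ∧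
      ∀ (dx dy : ℕ), 0 < dx → 0 < dy →
      ∀ (p q : ℝ≥0∞), p ≤ 2 → ENNReal.HolderConjugate p q →
      ∀ (X : Set (EuclideanSpace ℝ (Fin dx))) (Y : Set (EuclideanSpace ℝ (Fin dy))),
        Convex ℝ X → IsCompact X → Convex ℝ Y → IsCompact Y → (prodSet X Y).Nontrivial →
      ∀ (ω : Vec dx dy → ℝ) (D : ℝ), IsProxFunction p (prodSet X Y) ω →
        IsOmegaDiameter (prodSet X Y) ω D →
      ∀ (Ξ : Type*) [MeasurableSpace Ξ] (Pξ : Measure Ξ) [IsProbabilityMeasure Pξ]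
        (f : Vec dx dy → Ξ → ℝ) (τ M₂ : ℝ), 0 < τ → 0 < M₂ →
        IsLipschitzOracle Pξ (Metric.cthickening τ (prodSet X Y)) f M₂ →
        ConvexConcaveOn (Metric.cthickening τ (prodSet X Y)) (objective Pξ f) →
      ∀ (xs : EuclideanSpace ℝ (Fin dx)) (ys : EuclideanSpace ℝ (Fin dy)), xs ∈ X → ys ∈ Y →
        IsSaddlePointOn X Y (fun x y => objective Pξ f (pair x y)) xs ys →
      ∀ (a : ℝ), sphereMoment dx dy q ≤ a ^ 2 →
      ∀ (Ω : Type*) [MeasurableSpace Ω] (P : Measure Ω) [IsProbabilityMeasure P]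
        (e : ℕ → Ω → USphere dx dy) (ξ : ℕ → Ω → Ξ), IsSampling P Pξ e ξ →
      ∀ (N : ℕ), 0 < N →
      ∀ (δ : Vec dx dy → ℝ) (z : ℕ → Ω → Vec dx dy),
        -- bounded noise
        (∀ (Δ M : ℝ) (γ : ℕ → ℝ), Measurable δ →
          (∀ w ∈ Metric.cthickening τ (prodSet X Y), |δ w| ≤ Δ) →
          M = Real.sqrt (c * (((dx + dy : ℕ) : ℝ) * a ^ 2 * M₂ ^ 2 +
            ((dx + dy : ℕ) : ℝ) ^ 2 * a ^ 2 * Δ ^ 2 / τ ^ 2)) →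
          (∀ k, γ k = D / M * Real.sqrt (2 / (N : ℝ))) →
          (∀ θ, IsRun (prodSet X Y) ω (fun w s => f w s + δ w) τ γ N
            (fun k => e k θ) (fun k => ξ k θ) (fun k => z k θ)) →
          Integrable (fun θ =>
            objective Pξ f (pair (xPart (output γ N (fun k => z k θ))) ys) -
            objective Pξ f (pair xs (yPart (output γ N (fun k => z k θ))))) P ∧
          ∫ θ, (objective Pξ f (pair (xPart (output γ N (fun k => z k θ))) ys) -
              objective Pξ f (pair xs (yPart (output γ N (fun k => z k θ))))) ∂P
            ≤ M * D * Real.sqrt (2 / (N : ℝ)) +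
              Real.sqrt ((dx + dy : ℕ) : ℝ) * Δ * D / τ + 2 * τ * M₂) ∧
        -- Lipschitz noise
        (∀ (Mδ M : ℝ) (γ : ℕ → ℝ),
          (∀ w ∈ Metric.cthickening τ (prodSet X Y),
            ∀ w' ∈ Metric.cthickening τ (prodSet X Y), |δ w - δ w'| ≤ Mδ * ‖w - w'‖) →
          M = Real.sqrt (c * (((dx + dy : ℕ) : ℝ) * a ^ 2 * (M₂ ^ 2 + Mδ ^ 2))) →
          (∀ k, γ k = D / M * Real.sqrt (2 / (N : ℝ))) →
          (∀ θ, IsRun (prodSet X Y) ω (fun w s => f w s + δ w) τ γ N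
            (fun k => e k θ) (fun k => ξ k θ) (fun k => z k θ)) →
          Integrable (fun θ =>
            objective Pξ f (pair (xPart (output γ N (fun k => z k θ))) ys) -
            objective Pξ f (pair xs (yPart (output γ N (fun k => z k θ))))) P ∧
          ∫ θ, (objective Pξ f (pair (xPart (output γ N (fun k => z k θ))) ys) -
              objective Pξ f (pair xs (yPart (output γ N (fun k => z k θ))))) ∂P
            ≤ M * D * Real.sqrt (2 / (N : ℝ)) +
              Mδ * Real.sqrt ((dx + dy : ℕ) : ℝ) * D + 2 * τ * M₂)) ∧
    -- the order of `a_q²`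
    (∃ C : ℝ, 0 < C ∧ ∀ (dx dy : ℕ), 0 < dx → 0 < dy → ∀ q : ℝ≥0∞, 2 ≤ q →
      sphereMoment dx dy q ≤
        C * (min q (ENNReal.ofReal (Real.log ((dx + dy : ℕ) : ℝ)))).toReal *
          ((dx + dy : ℕ) : ℝ) ^ ((2 / q).toReal - 1)) := by
  -- `312 = 624 / 2`: the two-point constant, halved by the prefactor `d ^ 2 / (2 * τ ^ 2)`.
  refine ⟨⟨312, by norm_num, ?_⟩, ⟨300, by norm_num, fun dx dy hx hy q hq =>
    sphereMoment_le hx hy hq⟩⟩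
  intro dx dy hdx hdy p q hp hpq X Y hX hXc hY hYc hne ω D hω hD Ξ _ Pξ _ f τ M₂ hτ hM₂ hf hcc
    xs ys hxs hys _ a ha Ω _ P _ e ξ hs N hN δ z
  have hnt : Nontrivial (Vec dx dy) := nontrivial_vec hdx
  have hpt : p ≠ ∞ := (hp.trans_lt (by simp)).ne
  have h1q : 1 ≤ q := by
    have := hpq.symm
    exact ENNReal.HolderConjugate.one_le q p
  have ha0 : 0 < a ^ 2 := (sphereMoment_pos hpq hpt h1q).trans_le ha
  set d : ℝ := ((dx + dy : ℕ) : ℝ) with hd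
  have hd0 : 0 < d := by
    rw [hd]
    exact_mod_cast Nat.add_pos_left hdx dy
  have hdist : ∀ (v : Vec dx dy) (u : USphere dx dy),
      ‖v + τ • (u : Vec dx dy) - (v - τ • (u : Vec dx dy))‖ = 2 * τ := fun v u => by
    rw [add_sub_sub_cancel, ← two_smul ℝ, smul_smul, norm_smul, norm_eq_of_mem_sphere, mul_one,
      Real.norm_of_nonneg (by positivity)]
  have hplus : ∀ v ∈ prodSet X Y, ∀ u : USphere dx dy,
      v + τ • (u : Vec dx dy) ∈ Metric.cthickening τ (prodSet X Y) := fun v hv u =>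
    add_smul_mem_cthickening hv hτ.le (norm_eq_of_mem_sphere u).le
  have hminus : ∀ v ∈ prodSet X Y, ∀ u : USphere dx dy,
      v - τ • (u : Vec dx dy) ∈ Metric.cthickening τ (prodSet X Y) := fun v hv u =>
    sub_smul_mem_cthickening hv hτ.le (norm_eq_of_mem_sphere u).le
  refine ⟨fun Δ M γ hδ hΔ hM hγ hrun => ?_, fun Mδ M γ hδ hM hγ hrun => ?_⟩
  · have hΔ0 : 0 ≤ Δ := by
      obtain ⟨v, hv⟩ := hne.nonempty
      exact (abs_nonneg _).trans (hΔ v (Metric.self_subset_cthickening _ hv))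
    have hpos : 0 < 312 * (d * a ^ 2 * M₂ ^ 2 + d ^ 2 * a ^ 2 * Δ ^ 2 / τ ^ 2) := by positivity
    have hM0 : 0 < M := by
      rw [hM]
      exact Real.sqrt_pos.2 hpos
    have hMsq : M ^ 2 = 312 * (d * a ^ 2 * M₂ ^ 2 + d ^ 2 * a ^ 2 * Δ ^ 2 / τ ^ 2) := by
      rw [hM]
      exact Real.sq_sqrt hpos.le
    -- Bounded noise has no Lipschitz structure to exploit, so `κ = 2 * Δ` and `σ = (2 * Δ) ^ 2 * a
    -- ^ 2` come from the crude bound, and the second moment keeps the factor `d ^ 2`.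
    have hκ : ∀ v ∈ prodSet X Y, ∀ u : USphere dx dy,
        |δ (v + τ • (u : Vec dx dy)) - δ (v - τ • (u : Vec dx dy))| ≤ 2 * Δ := fun v hv u => by
      have h1 := abs_le.1 (hΔ _ (hplus v hv u))
      have h2 := abs_le.1 (hΔ _ (hminus v hv u))
      rw [abs_le]
      constructor <;> linarith
    have hσ : ∀ v ∈ prodSet X Y, ∫⁻ u : USphere dx dy, ENNReal.ofReal
        ((δ (v + τ • (u : Vec dx dy)) - δ (v - τ • (u : Vec dx dy))) ^ 2 *
          ellNorm q (u : Vec dx dy) ^ 2) ∂(sphereUniform dx dy) ≤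
        ENNReal.ofReal ((2 * Δ) ^ 2 * a ^ 2) := fun v hv => by
      calc _ ≤ ∫⁻ u : USphere dx dy, ENNReal.ofReal ((2 * Δ) ^ 2) *
            ENNReal.ofReal (ellNorm q (u : Vec dx dy) ^ 2) ∂(sphereUniform dx dy) := by
            refine lintegral_mono fun u => ?_
            rw [← ENNReal.ofReal_mul (by positivity)]
            refine ENNReal.ofReal_le_ofReal ?_
            have := sq_le_sq' (abs_le.1 (hκ v hv u)).1 (abs_le.1 (hκ v hv u)).2
            gcongr
        _ ≤ _ := by
            rw [lintegral_const_mul' _ _ ENNReal.ofReal_ne_top, ENNReal.ofReal_mul (by positivity)]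
            gcongr
            exact lintegral_ellNorm_sq_le h1q ha ha0
    have hmain := integral_saddleGap_output_le hp hpq hX hXc hY hYc hne hω hD hτ hM₂ hf hcc hxs hys
      ha hs hN (hδ.indicator Metric.isClosed_cthickening.measurableSet) (by positivity) hκ
      (by positivity) hσ hM0 (by
        rw [hMsq]
        have h1 : d ^ 2 / (2 * τ ^ 2) * (624 * τ ^ 2 * M₂ ^ 2 / d * a ^ 2 + (2 * Δ) ^ 2 * a ^ 2) =
            312 * (d * a ^ 2 * M₂ ^ 2) + 2 * (d ^ 2 * a ^ 2 * Δ ^ 2 / τ ^ 2) := by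
          field_simp
          ring
        have h2 : 0 ≤ d ^ 2 * a ^ 2 * Δ ^ 2 / τ ^ 2 := by positivity
        rw [← hd, h1]
        linarith) hγ hrun
    refine ⟨hmain.1, hmain.2.trans (le_of_eq ?_)⟩
    rw [← hd]
    field_simp
  · have hMδ0 : 0 ≤ Mδ := by
      obtain ⟨v, hv, w, hw, hvw⟩ := hne
      have h1 := (abs_nonneg _).trans (hδ v (Metric.self_subset_cthickening _ hv) w
        (Metric.self_subset_cthickening _ hw))
      exact nonneg_of_mul_nonneg_left h1 (norm_pos_iff.2 (sub_ne_zero.2 hvw))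
    have hpos : 0 < 312 * (d * a ^ 2 * (M₂ ^ 2 + Mδ ^ 2)) := by positivity
    have hM0 : 0 < M := by
      rw [hM]
      exact Real.sqrt_pos.2 hpos
    have hMsq : M ^ 2 = 312 * (d * a ^ 2 * (M₂ ^ 2 + Mδ ^ 2)) := by
      rw [hM]
      exact Real.sq_sqrt hpos.le
    have hκ : ∀ v ∈ prodSet X Y, ∀ u : USphere dx dy,
        |δ (v + τ • (u : Vec dx dy)) - δ (v - τ • (u : Vec dx dy))| ≤ Mδ * (2 * τ) :=
      fun v hv u => by
        rw [← hdist v u]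
        exact hδ _ (hplus v hv u) _ (hminus v hv u)
    have hmain := integral_saddleGap_output_le hp hpq hX hXc hY hYc hne hω hD hτ hM₂ hf hcc hxs hys
      ha hs hN (measurable_indicator_of_lipschitz Metric.isClosed_cthickening hδ) (by positivity) hκ
      -- Lipschitz noise obeys the same concentration estimate as the oracle, so the two constants
      -- enter symmetrically.
      (σ := 624 * τ ^ 2 * Mδ ^ 2 / d * a ^ 2) (by positivity)
      (fun v hv => lintegral_two_point_sq_le h1q ha hτ hv hδ) hM0 (by
        rw [hMsq, ← hd]
        refine le_of_eq ?_
        field_simp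
        ring) hγ hrun
    refine ⟨hmain.1, hmain.2.trans (le_of_eq ?_)⟩
    rw [← hd]
    field_simp
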